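/- **Model.** Let $\Delta,a,\sigma>0$ and $L\ge 2$. For each $N$ one observes $x(n)=\sum_{l=1}^{L}A_l e^{j2\pi f_l n}+w(n)$, $n=0,\dots,N-1$, where $w(0),w(1),\dots$ are independent circular complex Gaussian variables with mean $0$ and variance $E|w(n)|^2=\sigma^2$; put $\rho_l=|A_l|^2/\sigma^2$. The amplitudes $A_l\in\mathbb C$ and the frequencies $f_l\in[-\frac12,\frac12]$ are deterministic and may be constant or vary with $N$, with $|A_l|\ge a$ and $|A_l|/N\to0$. Assumption 1 (frequency separation of order $1$, independent of $N$): $\Delta\le|f_l-f_p|\le 1-\Delta$ for all $l\ne p$. The integers $\hat m_l$ are the true maximum bins: measurable functions of the outcome such that almost surely, for all large $N$, $f_l=(\hat m_l+\delta_l)/N$ with residuals $\delta_l\in[-\frac12,\frac12]$, $l=1,\dots,L$. **Algorithm.** Put $D(y)=\frac1N\sum_{n=0}^{N-1}e^{j2\pi yn/N}$. Given current estimates $(\hat\delta_l,\hat A_l)_{l}$, let $$\hat S_p(y)=\frac1N\sum_{n=0}^{N-1}x(n)e^{-j2\pi yn/N}-\sum_{l\ne p}\hat A_l\,D(\hat m_l+\hat\delta_l-y),$$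 $\hat S_{p,\pm}=\hat S_p(\hat m_p+\hat\delta_p\pm\frac12)$ and $h_p=\frac12\,\frac{\hat S_{p,+}+\hat S_{p,-}}{\hat S_{p,+}-\hat S_{p,-}}$. The update of component $p$ is $$\hat\delta_p'=\hat\delta_p-\frac{N}{2\pi}\,\Im\ln\!\left(\cos\frac{\pi}{N}-2jh_p\sin\frac{\pi}{N}\right),\qquad \hat A_p'=\hat S_p(\hat m_p+\hat\delta_p').$$ One iteration $T$ updates all components, either simultaneously from the estimates of the previous iteration, or consecutively ($p=1,\dots,L$), each with the newest estimates. All estimates are initialised to $0$. Let $K$ be the set of all $(\hat\delta_l,\hat A_l)_l$ with $|\hat\delta_l|\le\frac34$ and $|\hat A_l|\le2\max_k|A_k|$. **Theorem 2.** There is a constant $C$, depending only on $\Delta$, $a$ and $\sigma$, such that for both versions of the algorithm: 1. Almost surely, for all sufficiently large $N$, $T$ maps $K$ into itself and is a contraction of $K$ for the Euclidean distance, it has exactly one fixed point in $K$, and the iterates of the algorithm converge to it. Its residual components $(\delta^*_1,\dots,\delta^*_L)$ are asymptotically the true residuals: almost surely $\delta_l^*-\delta_l\to0$ as $N\to\infty$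 for every $l$. 2. Almost surely, for all sufficiently large $N$, the convergence rate $r_L$, i.e. the least Lipschitz constant of $T$ on $K$, satisfies $$r_L\le\sqrt L\;C\max_{l\ne p}\left\{\sqrt{\Gamma_{l,p}},\ \sqrt{\frac{\ln N}{N}}\right\}<1,\qquad \Gamma_{l,p}=\frac{|A_l|^2}{\langle N(f_l-f_p)\rangle^2},$$ where $\langle\cdot\rangle$ is the nearest integer. 3. For every $p$, the estimate $\hat f_p=(\hat m_p+\delta^*_p)/N$ is asymptotically normal and unbiased with variance $\frac{\pi^2}{64\rho_pN^3}$: $\sqrt{\rho_pN^3}\,(\hat f_p-f_p)$ converges in distribution to $\mathcal N(0,\frac{\pi^2}{64})$. The Fisher information matrix of the parameters $(f_l,\Re A_l,\Im A_l)_l$ is positive definite for all large $N$, and the Cramér–Rao lower bound for $f_p$, the diagonal entry of its inverse, multiplied by $\rho_pN^3$ tends to $\frac{6}{4\pi^2}$. The asymptotic variance is thus $\frac{\pi^2/64}{6/(4\pi^2)}=1.0147$ (rounded to four decimals) times the asymptotic Cramér–Rao lower bound. -/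

import Mathlib

open Filter Topology MeasureTheory ProbabilityTheory

noncomputable section

namespace MultiTone

/-! ### Signal model -/

/-- The noise-free signal `∑ l, A l * exp (2 π i f l n)`. -/
def signal {L : ℕ} (A : Fin L → ℂ) (f : Fin L → ℝ) (n : ℕ) : ℂ :=
  ∑ l, A l * Complex.exp (2 * Real.pi * Complex.I * f l * n)

/-- The noisy observation. -/
def observed {L : ℕ} (A : Fin L → ℂ) (f : Fin L → ℝ) (w : ℕ → ℂ) (n : ℕ) : ℂ :=
  signal A f n + w n

/-- White circular complex Gaussian noise of variance `σ ^ 2` (i.e. `E |w n| ^ 2 = σ ^ 2`): the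
samples are independent, and the real and imaginary parts of each sample are independent centred
Gaussians of variance `σ ^ 2 / 2`. -/
structure IsWhiteGaussianNoise {Ω : Type*} [MeasurableSpace Ω] (P : Measure Ω) (σ : ℝ)
    (w : ℕ → Ω → ℂ) : Prop where
  measurable : ∀ n, Measurable (w n)
  indep : iIndepFun w P
  re_law : ∀ n, P.map (fun ω => (w n ω).re) = gaussianReal 0 (Real.toNNReal (σ ^ 2 / 2))
  im_law : ∀ n, P.map (fun ω => (w n ω).im) = gaussianReal 0 (Real.toNNReal (σ ^ 2 / 2))
  re_indep_im : ∀ n, IndepFun (fun ω => (w n ω).re) (fun ω => (w n ω).im) P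

/-- Signal to noise ratio of a component of complex amplitude `A`. -/
def snr (σ : ℝ) (A : ℂ) : ℝ := ‖A‖ ^ 2 / σ ^ 2

/-! ### The estimator

Frequencies are measured in bins: the (real) bin location `y` is the normalised frequency `y / N`. -/

/-- Fourier coefficient `(1 / N) ∑ n < N, x n * exp (- 2 π i y n / N)` at the bin location `y`. -/
def fourierCoeffAt (N : ℕ) (x : ℕ → ℂ) (y : ℝ) : ℂ :=
  (1 / (N : ℂ)) * ∑ n ∈ Finset.range N, x n * Complex.exp (-(2 * Real.pi * Complex.I * y * n / N))

/-- Fourier coefficient at bin location `0` of a unit amplitude exponential at bin location `y`.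
It is equal to `(1 - exp (2 π i y)) / (N * (1 - exp (2 π i y / N)))`
whenever this denominator does not vanish. -/
def tone (N : ℕ) (y : ℝ) : ℂ :=
  (1 / (N : ℂ)) * ∑ n ∈ Finset.range N, Complex.exp (2 * Real.pi * Complex.I * y * n / N)

/-- The current estimates: `(s l).1` is the estimate of the residual of component `l`, and
`(s l).2` that of its complex amplitude. -/
abbrev Estimates (L : ℕ) : Type := Fin L → ℝ × ℂ

/-- Total estimated leakage of the components `l ≠ p` at the bin location `y`. -/
def leakage {L : ℕ} (N : ℕ) (m : Fin L → ℤ) (s : Estimates L) (p : Fin L) (y : ℝ) : ℂ :=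
  ∑ l ∈ Finset.univ.erase p, (s l).2 * tone N (m l + (s l).1 - y)

/-- Fourier coefficient at the bin location `y`, the estimated leakage being subtracted. -/
def leakFree {L : ℕ} (N : ℕ) (x : ℕ → ℂ) (m : Fin L → ℤ) (s : Estimates L) (p : Fin L)
    (y : ℝ) : ℂ :=
  fourierCoeffAt N x y - leakage N m s p y

/-- The interpolation function `h`. -/
def interpolant (Splus Sminus : ℂ) : ℂ := (1 / 2) * ((Splus + Sminus) / (Splus - Sminus))

/-- The residual `- (N / 2 π) Im log (cos (π / N) - 2 i h sin (π / N))`. -/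
def residualOf (N : ℕ) (h : ℂ) : ℝ :=
  -((N : ℝ) / (2 * Real.pi)) *
    (Complex.log (Real.cos (Real.pi / N) - 2 * Complex.I * h * Real.sin (Real.pi / N))).im

/-- The new residual of component `p`: interpolation on the leakage-free coefficients half a bin
away from the current location, the current residual estimate being removed and added back. -/
def newResidual {L : ℕ} (N : ℕ) (x : ℕ → ℂ) (m : Fin L → ℤ) (s : Estimates L) (p : Fin L) : ℝ :=
  (s p).1 + residualOf N (interpolant
    (leakFree N x m s p (m p + (s p).1 + 1 / 2)) (leakFree N x m s p (m p + (s p).1 - 1 / 2)))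

/-- The new estimates for component `p`: its new residual, and then its new amplitude, which is the
leakage-free Fourier coefficient at the new frequency. -/
def update {L : ℕ} (N : ℕ) (x : ℕ → ℂ) (m : Fin L → ℤ) (s : Estimates L) (p : Fin L) : ℝ × ℂ :=
  (newResidual N x m s p, leakFree N x m s p (m p + newResidual N x m s p))

/-- Within one iteration, the components can be updated all at once from the estimates of the
previous iteration, or one after the other, each using the newest available estimates. -/
inductive Schedule
  | simultaneous
  | sequential

/-- One iteration of the algorithm. -/
def sweep {L : ℕ} (sch : Schedule) (N : ℕ) (x : ℕ → ℂ) (m : Fin L → ℤ) (s : Estimates L) :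
    Estimates L :=
  match sch with
  | .simultaneous => fun p => update N x m s p
  | .sequential =>
      (List.finRange L).foldl (fun t p => Function.update t p (update N x m t p)) s

/-- The estimates after `q` iterations; all of them are initialised to `0`. -/
def estimates {L : ℕ} (sch : Schedule) (N : ℕ) (x : ℕ → ℂ) (m : Fin L → ℤ) (q : ℕ) : Estimates L :=
  (sweep sch N x m)^[q] 0

/-- Euclidean distance of two sets of estimates. -/
def estDist {L : ℕ} (s t : Estimates L) : ℝ :=
  Real.sqrt (∑ l, (((s l).1 - (t l).1) ^ 2 + ‖(s l).2 - (t l).2‖ ^ 2))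

/-- The region where the iteration is studied. The residuals range over a neighbourhood of
`[-1/2, 1/2] ^ L` (a true residual may be `± 1/2`, and then its estimates overshoot it); the
amplitudes range up to twice the largest true amplitude. -/
def region {L : ℕ} (A : Fin L → ℂ) : Set (Estimates L) :=
  {s | ∀ l, |(s l).1| ≤ 3 / 4 ∧ ‖(s l).2‖ ≤ 2 * ⨆ k, ‖A k‖}

/-- `Γ l p = |A l| ^ 2 / ⟨N (f l - f p)⟩ ^ 2`, where `⟨·⟩` is the nearest integer. -/
def Gam {L : ℕ} (N : ℕ) (A : Fin L → ℂ) (f : Fin L → ℝ) (l p : Fin L) : ℝ :=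
  ‖A l‖ ^ 2 / ((round ((N : ℝ) * (f l - f p)) : ℤ) : ℝ) ^ 2

/-- `max { √(Γ l p), √(ln N / N) }` over all `l ≠ p`. -/
def rateBound {L : ℕ} (N : ℕ) (A : Fin L → ℂ) (f : Fin L → ℝ) : ℝ :=
  max (⨆ q : {q : Fin L × Fin L // q.1 ≠ q.2}, Real.sqrt (Gam N A f q.1.1 q.1.2))
    (Real.sqrt (Real.log N / N))

/-! ### The Cramér-Rao lower bound -/

/-- The real parameters of the signal: `(l, 0)`, `(l, 1)`, `(l, 2)` are the frequency, the real and
the imaginary part of the amplitude of component `l`. -/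
def params {L : ℕ} (A : Fin L → ℂ) (f : Fin L → ℝ) : Fin L × Fin 3 → ℝ :=
  fun i => ![f i.1, (A i.1).re, (A i.1).im] i.2

/-- The signal with a given vector of real parameters. -/
def paramSignal {L : ℕ} (θ : Fin L × Fin 3 → ℝ) : ℕ → ℂ :=
  signal (fun l => ⟨θ (l, 1), θ (l, 2)⟩) (fun l => θ (l, 0))

/-- Log-likelihood of the parameters `θ`, given the data `x 0, …, x (N - 1)`. -/
def logLikelihood {L : ℕ} (σ : ℝ) (N : ℕ) (x : ℕ → ℂ) (θ : Fin L × Fin 3 → ℝ) : ℝ :=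
  -(N : ℝ) * Real.log (Real.pi * σ ^ 2)
    - (1 / σ ^ 2) * ∑ n ∈ Finset.range N, ‖x n - paramSignal θ n‖ ^ 2

/-- Partial derivative of the log-likelihood with respect to parameter `i`. -/
def score {L : ℕ} (σ : ℝ) (N : ℕ) (x : ℕ → ℂ) (θ : Fin L × Fin 3 → ℝ) (i : Fin L × Fin 3) : ℝ :=
  deriv (fun t => logLikelihood σ N x (Function.update θ i t)) (θ i)

/-- The Fisher information matrix: the second moments of the score at the true parameters. -/
def fisherInfo {L : ℕ} {Ω : Type*} [MeasurableSpace Ω] (P : Measure Ω) (σ : ℝ) (w : ℕ → Ω → ℂ)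
    (N : ℕ) (A : Fin L → ℂ) (f : Fin L → ℝ) : Matrix (Fin L × Fin 3) (Fin L × Fin 3) ℝ :=
  Matrix.of fun i j => ∫ ω,
    score σ N (observed A f (fun n => w n ω)) (params A f) i *
      score σ N (observed A f (fun n => w n ω)) (params A f) j ∂P

/-- The Cramér-Rao lower bound for the frequency of component `p`. -/
def crlb {L : ℕ} {Ω : Type*} [MeasurableSpace Ω] (P : Measure Ω) (σ : ℝ) (w : ℕ → Ω → ℂ)
    (N : ℕ) (A : Fin L → ℂ) (f : Fin L → ℝ) (p : Fin L) : ℝ :=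
  (fisherInfo P σ w N A f)⁻¹ (p, 0) (p, 0)

end MultiTone

end

/-! After the estimated leakage is subtracted, component `p` sees one tone of amplitude `A p` at the
location `N * f p` plus an error function `E`: the Fourier transform of the noise and the leakage
not yet compensated. For a pure tone the interpolation is exact, because the coefficients half a bin
to either side have the same numerator (`tone_interpolation`). With errors, the rotated argument of
the logarithm is exactly `1 + R / N`, where `R` is a quotient with numerator linear in the two
errors and denominator bounded below by a multiple of `‖A p‖` (`residualOf_interpolant`,
`le_norm_gap`). So one step maps any nearby location to the true one up to a multiple of the error.

Let `η` bound `E`, its Lipschitz constant in the location, and its Lipschitz constant in the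
estimates. Then the update is Lipschitz with constant of order `η`, and the Euclidean norm over the
components contributes `√L`. Two facts make `η` small. Separated tones leak only by `O(1 / N)`, in
value and in slope (`far_bounds`). The noise transform and its derivative are almost surely `O(√(log
N / N))` on all bins, by Gaussian tails on a polynomial grid and Borel-Cantelli
(`IsWhiteGaussianNoise.ae_noiseBound`). Together `η` is at most a constant times `rateBound`, which
tends to `0`; separation also bounds `L`, so that this constant is independent of `L`.

At the fixed point leakage is generated only by the estimation errors themselves and is damped by `1
/ N`, so these errors are of the order of the noise (`Regime.fixedPoint_error_le`). Linearising
around the true location, the frequency error is a linear functional of the noise up to a remainder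
negligible at the scale `N ^ (-3 / 2)` (`Regime.fixedPoint_linearization`). That functional is
exactly Gaussian, of normalised variance `π ^ 2 / 64` (`map_linearError`), and a Slutsky argument
gives the limit law.

The score is linear in the noise, so the Fisher matrix is a multiple of the Gram matrix of the
signal derivatives. After scaling and centring the time variable, distinct components decouple and
the Gram matrix tends to a diagonal one (`tendsto_sampleGram`), from which the Cramér-Rao limit is
read off. The ratio of the variances is `π ^ 4 / 96`. -/

noncomputable section

namespace MultiTone

/-! ### The unit circle -/

/-- The point `exp (2 π i x)` of the unit circle. -/
def cis (x : ℝ) : ℂ := Complex.exp (2 * Real.pi * Complex.I * x)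

lemma cis_eq (x : ℝ) : cis x = Complex.exp ((2 * Real.pi * x : ℝ) * Complex.I) := by
  unfold cis; congr 1; push_cast; ring

lemma norm_cis (x : ℝ) : ‖cis x‖ = 1 := by
  rw [cis_eq, Complex.norm_exp_ofReal_mul_I]

lemma cis_add (x y : ℝ) : cis (x + y) = cis x * cis y := by
  unfold cis; rw [← Complex.exp_add]; congr 1; push_cast; ring

lemma cis_zero : cis 0 = 1 := by simp [cis]

lemma cis_nat_mul (n : ℕ) (x : ℝ) : cis (n * x) = cis x ^ n := by
  unfold cis; rw [← Complex.exp_nat_mul]; congr 1; push_cast; ring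

lemma cis_re (x : ℝ) : (cis x).re = Real.cos (2 * Real.pi * x) := by
  rw [cis_eq, Complex.exp_ofReal_mul_I_re]

lemma cis_im (x : ℝ) : (cis x).im = Real.sin (2 * Real.pi * x) := by
  rw [cis_eq, Complex.exp_ofReal_mul_I_im]

lemma cis_eq_cos_add_sin (x : ℝ) :
    cis x = (Real.cos (2 * Real.pi * x) : ℝ) + (Real.sin (2 * Real.pi * x) : ℝ) * Complex.I := by
  apply Complex.ext <;> simp [cis_re, cis_im, -Complex.ofReal_cos, -Complex.ofReal_sin]

lemma cis_int (n : ℤ) : cis n = 1 := by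
  unfold cis
  rw [Complex.exp_eq_one_iff]
  exact ⟨n, by push_cast; ring⟩

lemma cis_half : cis (1 / 2) = -1 := by
  apply Complex.ext <;> simp only [cis_re, cis_im] <;>
    rw [show 2 * Real.pi * (1 / 2) = Real.pi by ring] <;> simp

lemma cis_neg_half : cis (-(1 / 2)) = -1 := by
  apply Complex.ext <;> simp only [cis_re, cis_im] <;>
    rw [show 2 * Real.pi * -(1 / 2) = -Real.pi by ring] <;> simp

lemma norm_one_sub_cis (x : ℝ) : ‖1 - cis x‖ = 2 * |Real.sin (Real.pi * x)| := by
  have h : ‖1 - cis x‖ ^ 2 = (2 * |Real.sin (Real.pi * x)|) ^ 2 := by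
    rw [← Complex.normSq_eq_norm_sq, Complex.normSq_apply, mul_pow, sq_abs]
    simp only [Complex.sub_re, Complex.sub_im, Complex.one_re, Complex.one_im, cis_re, cis_im]
    rw [show 2 * Real.pi * x = 2 * (Real.pi * x) by ring, Real.sin_two_mul, Real.cos_two_mul]
    have := Real.sin_sq_add_cos_sq (Real.pi * x)
    have hc : Real.cos (Real.pi * x) ^ 2 = 1 - Real.sin (Real.pi * x) ^ 2 := by linarith
    ring_nf
    rw [show Real.cos (Real.pi * x) ^ 4 = (Real.cos (Real.pi * x) ^ 2) ^ 2 by ring, hc]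
    ring
  exact (pow_left_inj₀ (norm_nonneg _) (by positivity) two_ne_zero).1 h

lemma norm_cis_sub_cis (x y : ℝ) : ‖cis x - cis y‖ = 2 * |Real.sin (Real.pi * (y - x))| := by
  have : cis x - cis y = cis x * (1 - cis (y - x)) := by
    rw [mul_sub, ← cis_add]; simp
  rw [this, norm_mul, norm_cis, one_mul, norm_one_sub_cis]

lemma norm_cis_sub_cis_le (x y : ℝ) : ‖cis x - cis y‖ ≤ 2 * Real.pi * |x - y| := by
  rw [norm_cis_sub_cis, abs_sub_comm x y, mul_assoc]
  refine mul_le_mul_of_nonneg_left ?_ two_pos.le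
  refine Real.abs_sin_le_abs.trans ?_
  rw [abs_mul, abs_of_pos Real.pi_pos]

lemma norm_cis_sub_one_le (x : ℝ) : ‖cis x - 1‖ ≤ 2 * Real.pi * |x| := by
  simpa [cis_zero] using norm_cis_sub_cis_le x 0

lemma two_mul_le_sin_pi_mul {x : ℝ} (h0 : 0 ≤ x) (h : x ≤ 1 / 2) :
    2 * x ≤ Real.sin (Real.pi * x) := by
  have := Real.mul_le_sin (x := Real.pi * x) (by positivity) (by nlinarith [Real.pi_pos])
  refine le_trans (le_of_eq ?_) this
  field_simp

/-- By Jordan's inequality for `sin`, reflected at `1 / 2`. The upper bound on `|x|` excludes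
wrap-around: frequencies nearly `1` apart are close on the circle. -/
lemma le_norm_one_sub_cis {d x : ℝ} (hd : 0 ≤ d) (h1 : d ≤ |x|) (h2 : |x| ≤ 1 - d) :
    4 * d ≤ ‖1 - cis x‖ := by
  have hx : |Real.sin (Real.pi * x)| = |Real.sin (Real.pi * |x|)| := by
    rcases abs_cases x with h | h <;> rw [h.1]
    rw [mul_neg, Real.sin_neg, abs_neg]
  rw [norm_one_sub_cis, hx]
  have : 2 * d ≤ Real.sin (Real.pi * |x|) := by
    rcases le_total |x| (1 / 2) with h | h
    · linarith [two_mul_le_sin_pi_mul (abs_nonneg x) h]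
    · have := two_mul_le_sin_pi_mul (x := 1 - |x|) (by linarith) (by linarith)
      rw [show Real.pi * (1 - |x|) = Real.pi - Real.pi * |x| by ring, Real.sin_pi_sub] at this
      linarith
  linarith [le_abs_self (Real.sin (Real.pi * |x|))]

/-! ### The Fourier coefficient of a pure tone -/

lemma tone_eq_sum (N : ℕ) (y : ℝ) :
    tone N y = (1 / (N : ℂ)) * ∑ n ∈ Finset.range N, cis (y * n / N) := by
  unfold tone cis
  congr 1
  refine Finset.sum_congr rfl fun n _ => ?_
  congr 1; push_cast; ring

lemma norm_tone_sub_le (N : ℕ) (y y' : ℝ) :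
    ‖tone N y - tone N y'‖ ≤ 2 * Real.pi * |y - y'| := by
  rcases Nat.eq_zero_or_pos N with rfl | hN
  · simp [tone]; positivity
  have hN' : (0 : ℝ) < N := by exact_mod_cast hN
  rw [tone_eq_sum, tone_eq_sum, ← mul_sub, ← Finset.sum_sub_distrib, norm_mul]
  have : ‖∑ n ∈ Finset.range N, (cis (y * n / N) - cis (y' * n / N))‖
      ≤ N * (2 * Real.pi * |y - y'|) := by
    refine (norm_sum_le _ _).trans ?_
    refine (Finset.sum_le_card_nsmul _ _ (2 * Real.pi * |y - y'|) fun n hn => ?_).trans (by simp)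
    refine (norm_cis_sub_cis_le _ _).trans ?_
    refine mul_le_mul_of_nonneg_left ?_ (by positivity)
    rw [← sub_div, ← sub_mul, abs_div, abs_mul, Nat.abs_cast, Nat.abs_cast, div_le_iff₀ hN']
    exact mul_le_mul_of_nonneg_left (by exact_mod_cast (Finset.mem_range.1 hn).le) (abs_nonneg _)
  simp only [one_div, norm_inv, Complex.norm_natCast]
  rwa [inv_mul_le_iff₀ hN']

/-- Geometric sum. The product form stays valid where the denominator vanishes. -/
lemma tone_mul {N : ℕ} (hN : N ≠ 0) (y : ℝ) :
    N * tone N y * (1 - cis (y / N)) = 1 - cis y := by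
  have hN' : (N : ℂ) ≠ 0 := by exact_mod_cast hN
  have hR : (N : ℝ) ≠ 0 := by exact_mod_cast hN
  have h1 : ∀ n ∈ Finset.range N, cis (y * n / N) = cis (y / N) ^ n := fun n _ => by
    rw [← cis_nat_mul]; congr 1; ring
  rw [tone_eq_sum, Finset.sum_congr rfl h1, ← mul_assoc, mul_one_div_cancel hN', one_mul,
    geom_sum_mul_neg, ← cis_nat_mul]
  congr 2; field_simp

lemma tone_zero {N : ℕ} (hN : N ≠ 0) : tone N 0 = 1 := by
  have hN' : (N : ℂ) ≠ 0 := by exact_mod_cast hN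
  simp [tone_eq_sum, cis_zero, hN']

/-- The numerator `1 - cis y` never exceeds `2`, so off the main lobe only the factor `1 / N`
remains. This is why separated components interact weakly. -/
lemma norm_tone_le_of_far {N : ℕ} (hN : N ≠ 0) {d y : ℝ} (hd : 0 < d)
    (h : d ≤ ‖1 - cis (y / N)‖) : ‖tone N y‖ ≤ 2 / d / N := by
  have hN' : (0 : ℝ) < N := by exact_mod_cast Nat.pos_of_ne_zero hN
  have h1 := congrArg norm (tone_mul hN y)
  rw [norm_mul, norm_mul, Complex.norm_natCast] at h1
  have h2 : ‖1 - cis y‖ ≤ 2 := by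
    refine (norm_sub_le _ _).trans ?_
    rw [norm_cis]; norm_num
  rw [div_div, le_div_iff₀ (by positivity)]
  have : ‖tone N y‖ * N * d ≤ ‖tone N y‖ * N * ‖1 - cis (y / N)‖ := by gcongr
  nlinarith

/-- The global Lipschitz bound lacks the factor `1 / N`. Subtracting the two product forms of
`tone_mul` retains it. -/
lemma norm_tone_sub_le_of_far {N : ℕ} (hN : N ≠ 0) {d y y' : ℝ} (hd : 0 < d)
    (h : d ≤ ‖1 - cis (y / N)‖) (h' : d ≤ ‖1 - cis (y' / N)‖) :
    ‖tone N y - tone N y'‖ ≤ 2 * Real.pi * (1 / d + 2 / d ^ 2) / N * |y - y'| := by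
  have hN' : (0 : ℝ) < N := by exact_mod_cast Nat.pos_of_ne_zero hN
  have hN1 : (1 : ℝ) ≤ N := by exact_mod_cast Nat.pos_of_ne_zero hN
  have e1 := tone_mul hN y
  have e2 := tone_mul hN y'
  have key : N * (tone N y - tone N y') * (1 - cis (y / N)) =
      (cis y' - cis y) + N * tone N y' * (cis (y / N) - cis (y' / N)) := by
    linear_combination e1 - e2
  have h1 := congrArg norm key
  rw [norm_mul, norm_mul, Complex.norm_natCast] at h1
  have h2 : ‖(cis y' - cis y) + N * tone N y' * (cis (y / N) - cis (y' / N))‖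
      ≤ 2 * Real.pi * |y - y'| * (1 + 2 / d) := by
    refine (norm_add_le _ _).trans ?_
    rw [norm_mul, norm_mul, Complex.norm_natCast]
    have a1 := norm_cis_sub_cis_le y' y
    have a2 := norm_cis_sub_cis_le (y / N) (y' / N)
    have a3 := norm_tone_le_of_far hN hd h'
    rw [abs_sub_comm] at a1
    rw [← sub_div, abs_div, Nat.abs_cast] at a2
    have a4 : N * ‖tone N y'‖ ≤ 2 / d := by
      rw [le_div_iff₀ hN'] at a3; linarith
    have a5 : 2 * Real.pi * (|y - y'| / N) ≤ 2 * Real.pi * |y - y'| := by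
      refine mul_le_mul_of_nonneg_left ?_ (by positivity)
      exact div_le_self (abs_nonneg _) hN1
    have a6 : N * ‖tone N y'‖ * ‖cis (y / N) - cis (y' / N)‖ ≤ 2 / d * (2 * Real.pi * |y - y'|) :=
      mul_le_mul a4 (a2.trans a5) (norm_nonneg _) (by positivity)
    linarith
  have h3 : N * ‖tone N y - tone N y'‖ * d ≤ N * ‖tone N y - tone N y'‖ * ‖1 - cis (y / N)‖ := by
    gcongr
  have h4 : N * ‖tone N y - tone N y'‖ * d ≤ 2 * Real.pi * |y - y'| * (1 + 2 / d) := by linarith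
  have h5 : 2 * Real.pi * (1 / d + 2 / d ^ 2) / N * |y - y'| =
      (2 * Real.pi * |y - y'| * (1 + 2 / d)) / (N * d) := by field_simp
  rw [h5, le_div_iff₀ (by positivity)]
  linarith

/-- Difference of the Fourier coefficients half a bin to both sides of a tone, the tone being
off by `e` bins. -/
def gap (N : ℕ) (e : ℝ) : ℂ := tone N (e - 1 / 2) - tone N (e + 1 / 2)

lemma tone_mul_half {N : ℕ} (hN : N ≠ 0) (e : ℝ) :
    N * tone N (e - 1 / 2) * (1 - cis ((e - 1 / 2) / N)) = 1 + cis e ∧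
    N * tone N (e + 1 / 2) * (1 - cis ((e + 1 / 2) / N)) = 1 + cis e := by
  rw [tone_mul hN, tone_mul hN, sub_eq_add_neg e, cis_add, cis_add, cis_half, cis_neg_half]
  constructor <;> ring

/-- Half-bin shifts in either direction turn the numerator `1 - cis` into the same `1 + cis e`. The
relation determines `e` from the ratio of the two coefficients, which is what the estimator
exploits. -/
lemma tone_interpolation {N : ℕ} (hN : N ≠ 0) (e : ℝ) :
    tone N (e - 1 / 2) * (1 - cis ((e - 1 / 2) / N)) =
      tone N (e + 1 / 2) * (1 - cis ((e + 1 / 2) / N)) := by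
  have hN' : (N : ℂ) ≠ 0 := by exact_mod_cast hN
  obtain ⟨h1, h2⟩ := tone_mul_half hN e
  apply mul_left_cancel₀ hN'
  linear_combination h1 - h2

lemma gap_mul {N : ℕ} (hN : N ≠ 0) (e : ℝ) :
    gap N e * N * (1 - cis ((e - 1 / 2) / N)) * (1 - cis ((e + 1 / 2) / N)) =
      (1 + cis e) * (cis ((e - 1 / 2) / N) - cis ((e + 1 / 2) / N)) := by
  obtain ⟨h1, h2⟩ := tone_mul_half hN e
  unfold gap
  linear_combination (1 - cis ((e + 1 / 2) / N)) * h1 - (1 - cis ((e - 1 / 2) / N)) * h2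

lemma norm_gap_sub_le (N : ℕ) (e e' : ℝ) : ‖gap N e - gap N e'‖ ≤ 4 * Real.pi * |e - e'| := by
  have h1 := norm_tone_sub_le N (e - 1 / 2) (e' - 1 / 2)
  have h2 := norm_tone_sub_le N (e + 1 / 2) (e' + 1 / 2)
  rw [show e - 1 / 2 - (e' - 1 / 2) = e - e' by ring] at h1
  rw [show e + 1 / 2 - (e' + 1 / 2) = e - e' by ring] at h2
  have : gap N e - gap N e' = (tone N (e - 1 / 2) - tone N (e' - 1 / 2)) -
    (tone N (e + 1 / 2) - tone N (e' + 1 / 2)) := by unfold gap; ring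
  rw [this]
  linarith [norm_sub_le (tone N (e - 1 / 2) - tone N (e' - 1 / 2))
    (tone N (e + 1 / 2) - tone N (e' + 1 / 2))]

/-- Both sides vanish at `|e| = 1 / 2`. With `u = 1 / 2 - |e|`, the cosine is `sin (π u)`, which is
at least `2 / 3 * |u|` in modulus for `|u| ≤ 3 / 4`. The other factor `|e| + 1 / 2` is at most `7 /
4`, whence `8 / 21`. -/
lemma le_abs_cos_pi_mul {e : ℝ} (he : |e| ≤ 5 / 4) :
    8 / 21 * |e ^ 2 - 1 / 4| ≤ |Real.cos (Real.pi * e)| := by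
  have h1 : |Real.cos (Real.pi * e)| = |Real.sin (Real.pi * (1 / 2 - |e|))| := by
    rw [show Real.pi * (1 / 2 - |e|) = Real.pi / 2 - Real.pi * |e| by ring, Real.sin_pi_div_two_sub]
    rcases abs_cases e with h | h <;> rw [h.1]
    rw [mul_neg, Real.cos_neg]
  have h2 : |e ^ 2 - 1 / 4| = |(1 / 2 - |e|)| * (|e| + 1 / 2) := by
    rw [← sq_abs e, show |e| ^ 2 - 1 / 4 = -((1 / 2 - |e|) * (|e| + 1 / 2)) by ring, abs_neg, abs_mul,
      abs_of_pos (a := |e| + 1 / 2) (by positivity)]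
  have h3 : 2 / 3 * |(1 / 2 - |e|)| ≤ |Real.sin (Real.pi * (1 / 2 - |e|))| := by
    have hu : |(1 / 2 - |e|)| ≤ 3 / 4 := by
      rw [abs_le]; constructor <;> linarith [abs_nonneg e]
    generalize 1 / 2 - |e| = u at hu
    have hx : |Real.sin (Real.pi * u)| = |Real.sin (Real.pi * |u|)| := by
      rcases abs_cases u with h | h <;> rw [h.1]
      rw [mul_neg, Real.sin_neg, abs_neg]
    rw [hx]
    refine le_trans ?_ (le_abs_self _)
    rcases le_total |u| (1 / 2) with h | h
    · linarith [two_mul_le_sin_pi_mul (abs_nonneg u) h, abs_nonneg u]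
    · have := two_mul_le_sin_pi_mul (x := 1 - |u|) (by linarith) (by linarith)
      rw [show Real.pi * (1 - |u|) = Real.pi - Real.pi * |u| by ring, Real.sin_pi_sub] at this
      linarith
  rw [h1, h2]
  nlinarith [abs_nonneg (1 / 2 - |e|), abs_nonneg e, mul_nonneg (abs_nonneg (1 / 2 - |e|)) (abs_nonneg e)]

/-- In `gap_mul` the zeros of `1 + cis e` at `e = ± 1 / 2` are compensated by those of the two
factors on the left. This lower bound keeps the interpolation well conditioned in a range of
locations wider than the bin. -/
lemma le_norm_gap {N : ℕ} (hN : 2 ≤ N) {e : ℝ} (he : |e| ≤ 5 / 4) : 1 / 20 ≤ ‖gap N e‖ := by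
  have hN0 : N ≠ 0 := by omega
  have hN' : (0 : ℝ) < N := by exact_mod_cast Nat.pos_of_ne_zero hN0
  have hN2 : (2 : ℝ) ≤ N := by exact_mod_cast hN
  -- At `e = ± 1 / 2` the identity `gap_mul` reads `0 = 0`. There one coefficient is `1` and the
  -- other `0`.
  by_cases hz : e ^ 2 - 1 / 4 = 0
  · have : (e - 1 / 2) * (e + 1 / 2) = 0 := by linarith [hz, show (e - 1 / 2) * (e + 1 / 2) = e ^ 2 - 1 / 4 by ring]
    have t1 : ∀ y : ℝ, (y = 1 ∨ y = -1) → tone N y = 0 := fun y hy => by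
      have h := tone_mul hN0 y
      have hc : cis y = 1 := by
        rcases hy with rfl | rfl
        · simpa using cis_int 1
        · simpa using cis_int (-1)
      rw [hc, sub_self, mul_eq_zero, mul_eq_zero] at h
      have hy1 : |y| = 1 := by rcases hy with rfl | rfl <;> simp
      have h4 : 4 * (1 / N : ℝ) ≤ ‖1 - cis (y / N)‖ := by
        apply le_norm_one_sub_cis (by positivity)
        · rw [abs_div, hy1, Nat.abs_cast]
        · rw [abs_div, hy1, Nat.abs_cast, le_sub_iff_add_le]
          rw [← add_div, div_le_one hN']; linarith
      have h5 : (1 - cis (y / N)) ≠ 0 := by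
        rw [← norm_pos_iff]; refine lt_of_lt_of_le (by positivity) h4
      rcases h with (h | h) | h
      · exact absurd h (by exact_mod_cast hN0)
      · exact h
      · exact absurd h h5
    rcases mul_eq_zero.1 this with h | h
    · have he1 : e = 1 / 2 := by linarith
      rw [gap, he1, sub_self, tone_zero hN0, t1 (1 / 2 + 1 / 2) (by norm_num)]; norm_num
    · have he1 : e = -(1 / 2) := by linarith
      rw [gap, he1, neg_add_cancel, tone_zero hN0, t1 (-(1 / 2) - 1 / 2) (by norm_num)]; norm_num
  · have h := congrArg norm (gap_mul hN0 e)
    have hcos : ‖1 + cis e‖ = 2 * |Real.cos (Real.pi * e)| := by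
      have : 1 + cis e = 1 - cis (e - 1 / 2) := by
        rw [sub_eq_add_neg e, cis_add, cis_neg_half]; ring
      rw [this, norm_one_sub_cis, show Real.pi * (e - 1 / 2) = Real.pi * e - Real.pi / 2 by ring,
        Real.sin_sub_pi_div_two, abs_neg]
    rw [norm_mul, norm_mul, norm_mul, norm_mul, hcos, Complex.norm_natCast, norm_one_sub_cis,
      norm_one_sub_cis, norm_cis_sub_cis, show (e + 1 / 2) / N - (e - 1 / 2) / N = 1 / (N : ℝ) by
        rw [← sub_div]; ring_nf] at h
    have hs : 2 * (1 / N : ℝ) ≤ |Real.sin (Real.pi * (1 / N))| :=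
      (two_mul_le_sin_pi_mul (by positivity) (by
        rw [div_le_div_iff₀ hN' two_pos]; linarith)).trans (le_abs_self _)
    have hb : ∀ x : ℝ, |Real.sin (Real.pi * (x / N))| ≤ Real.pi * |x| / N := fun x => by
      refine Real.abs_sin_le_abs.trans (le_of_eq ?_)
      rw [abs_mul, abs_div, abs_of_pos Real.pi_pos, Nat.abs_cast]; ring
    have hprod : |e - 1 / 2| * |e + 1 / 2| = |e ^ 2 - 1 / 4| := by
      rw [← abs_mul]; congr 1; ring
    have hpos : 0 < |e ^ 2 - 1 / 4| := abs_pos.2 hz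
    have hcl := le_abs_cos_pi_mul he
    have hpi : Real.pi ^ 2 < 9.87 := by nlinarith [Real.pi_lt_d4, Real.pi_pos]
    have up : ‖gap N e‖ * N * (2 * |Real.sin (Real.pi * ((e - 1 / 2) / N))|) *
        (2 * |Real.sin (Real.pi * ((e + 1 / 2) / N))|) ≤
        ‖gap N e‖ * N * (2 * (Real.pi * |e - 1 / 2| / N)) * (2 * (Real.pi * |e + 1 / 2| / N)) := by
      gcongr
      · exact hb _
      · exact hb _
    have up2 : ‖gap N e‖ * N * (2 * (Real.pi * |e - 1 / 2| / N)) * (2 * (Real.pi * |e + 1 / 2| / N))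
        = (4 * Real.pi ^ 2 * ‖gap N e‖ * |e ^ 2 - 1 / 4|) / N := by
      rw [← hprod]; field_simp; ring
    have lo : 2 * (8 / 21 * |e ^ 2 - 1 / 4|) * (2 * (2 * (1 / N))) ≤
        2 * |Real.cos (Real.pi * e)| * (2 * |Real.sin (Real.pi * (1 / N))|) := by gcongr
    have fin : 2 * (8 / 21 * |e ^ 2 - 1 / 4|) * (2 * (2 * (1 / N))) ≤
        (4 * Real.pi ^ 2 * ‖gap N e‖ * |e ^ 2 - 1 / 4|) / N := by linarith
    rw [le_div_iff₀ hN'] at fin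
    have fin2 : 2 * (8 / 21 * |e ^ 2 - 1 / 4|) * (2 * (2 * (1 / (N : ℝ)))) * N =
        (64 / 21) * |e ^ 2 - 1 / 4| := by field_simp; ring
    rw [fin2] at fin
    have fin3 : 64 / 21 ≤ 4 * Real.pi ^ 2 * ‖gap N e‖ := le_of_mul_le_mul_right fin hpos
    nlinarith [norm_nonneg (gap N e)]

/-- With `x = π / (2 N)`, the gap at `0` is `-(4 i / π) * x cot x`, and `1 - x ≤ x cot x ≤ 1`. -/
lemma norm_gap_zero_sub_le {N : ℕ} (hN : 2 ≤ N) :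
    ‖gap N 0 - -(4 * Complex.I / Real.pi)‖ ≤ 2 / N := by
  have hN0 : N ≠ 0 := by omega
  have hN' : (0 : ℝ) < N := by exact_mod_cast Nat.pos_of_ne_zero hN0
  have hN2 : (2 : ℝ) ≤ N := by exact_mod_cast hN
  have hpi := Real.pi_pos
  set x : ℝ := Real.pi / (2 * N) with hx
  have hx0 : 0 < x := by positivity
  have hx1 : x ≤ Real.pi / 4 := by
    rw [hx]; gcongr; linarith
  have hx2 : x < 1 := by linarith [Real.pi_lt_d2]
  have hs : 0 < Real.sin x := Real.sin_pos_of_pos_of_lt_pi hx0 (by linarith)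
  have h := gap_mul hN0 0
  have c1 : cis ((0 - 1 / 2) / N) = Real.cos x ^ 2 - Real.sin x ^ 2 - 2 * Real.sin x * Real.cos x * Complex.I := by
    have : 2 * Real.pi * ((0 - 1 / 2) / N) = -(2 * x) := by rw [hx]; field_simp; ring
    rw [cis_eq_cos_add_sin, this, Real.cos_neg, Real.sin_neg, Real.cos_two_mul', Real.sin_two_mul]
    push_cast; ring
  have c2 : cis ((0 + 1 / 2) / N) = Real.cos x ^ 2 - Real.sin x ^ 2 + 2 * Real.sin x * Real.cos x * Complex.I := by
    have : 2 * Real.pi * ((0 + 1 / 2) / N) = 2 * x := by rw [hx]; field_simp; ring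
    rw [cis_eq_cos_add_sin, this, Real.cos_two_mul', Real.sin_two_mul]
    push_cast; ring
  have hsc : ((Real.cos x : ℂ)) ^ 2 = 1 - (Real.sin x : ℂ) ^ 2 := by
    have := Real.sin_sq_add_cos_sq x
    rw [eq_sub_iff_add_eq]; exact_mod_cast (by linarith)
  have hsne : ((Real.sin x : ℝ) : ℂ) ≠ 0 := by exact_mod_cast hs.ne'
  have hg : gap N 0 * N * Real.sin x = -(2 * Complex.I * Real.cos x) := by
    rw [c1, c2, cis_zero] at h
    have h4 : (4 * (Real.sin x : ℂ)) ≠ 0 := by simpa using hsne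
    apply mul_left_cancel₀ h4
    have e1 : (1 - ((Real.cos x : ℂ) ^ 2 - Real.sin x ^ 2 - 2 * Real.sin x * Real.cos x * Complex.I)) *
      (1 - ((Real.cos x : ℂ) ^ 2 - Real.sin x ^ 2 + 2 * Real.sin x * Real.cos x * Complex.I)) =
        4 * (Real.sin x : ℂ) ^ 2 := by
      have hI := Complex.I_sq
      rw [hsc]
      linear_combination (-4 * (Real.sin x : ℂ) ^ 2 * (Real.cos x : ℂ) ^ 2) * hI +
         (4 * (Real.sin x : ℂ) ^ 2) * hsc
    linear_combination h - gap N 0 * N * e1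
  have hNc : (N : ℂ) = (Real.pi / (2 * x) : ℝ) := by
    have : (N : ℝ) = Real.pi / (2 * x) := by rw [hx]; field_simp
    exact_mod_cast congrArg (fun t : ℝ => (t : ℂ)) this
  have hxc : (x : ℂ) ≠ 0 := by exact_mod_cast hx0.ne'
  have hpc : (Real.pi : ℂ) ≠ 0 := by exact_mod_cast hpi.ne'
  have hg2 : gap N 0 - -(4 * Complex.I / Real.pi) =
      (4 / Real.pi * (1 - x * Real.cos x / Real.sin x) : ℝ) * Complex.I := by
    have : gap N 0 = -(2 * Complex.I * Real.cos x) / (N * Real.sin x) := by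
      rw [← hg]; have : (N : ℂ) ≠ 0 := by exact_mod_cast hN0
      field_simp
    rw [this, hNc]
    push_cast
    push_cast at hsne
    field_simp
    ring
  rw [hg2, norm_mul, Complex.norm_I, mul_one, Complex.norm_real, Real.norm_eq_abs]
  have hcot1 : x * Real.cos x / Real.sin x ≤ 1 := by
    rw [div_le_one hs]
    have hc : 0 < Real.cos x := Real.cos_pos_of_mem_Ioo ⟨by linarith, by linarith⟩
    have := Real.le_tan hx0.le (by linarith)
    rwa [Real.tan_eq_sin_div_cos, le_div_iff₀ hc] at this
  have hcot2 : 1 - x ≤ x * Real.cos x / Real.sin x := by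
    rw [le_div_iff₀ hs]
    have a1 := Real.sin_le hx0.le
    have a2 := Real.one_sub_sq_div_two_le_cos (x := x)
    have a3 : 1 - x ≤ Real.cos x := by nlinarith
    nlinarith
  rw [abs_of_nonneg (mul_nonneg (by positivity) (by linarith))]
  have : 2 / (N : ℝ) = 4 / Real.pi * x := by rw [hx]; field_simp; ring
  rw [this]
  exact mul_le_mul_of_nonneg_left (by linarith) (by positivity)

/-! ### One interpolation step

The Fourier coefficients half a bin to both sides of the current location are
`A * tone N (e ∓ 1 / 2) + E±`, where `e` is the distance to the true location, and `E±` are errors. -/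

/-- The denominator of the interpolation function. -/
def interpDen (N : ℕ) (A : ℂ) (e : ℝ) (Ep Em : ℂ) : ℂ := A * gap N e + (Ep - Em)

/-- The deviation of the interpolation from the exact location is `N * log (1 + R / N)` up to a
constant factor, where `R` is the present quantity. -/
def interpErr (N : ℕ) (A : ℂ) (e : ℝ) (Ep Em : ℂ) : ℂ :=
  (N * (cis ((e - 1 / 2) / N) - 1) * Ep - N * (cis ((e + 1 / 2) / N) - 1) * Em) /
    interpDen N A e Ep Em

lemma log_one_add_im_abs_le {u : ℂ} (hu : ‖u‖ ≤ 1 / 2) :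
    |(Complex.log (1 + u)).im| ≤ Real.pi / 2 := by
  rw [Complex.log_im, Complex.abs_arg_le_pi_div_two_iff]
  have := (abs_le.1 (Complex.abs_re_le_norm u)).1
  simp only [Complex.add_re, Complex.one_re]
  linarith

/-- Multiplying the argument of the logarithm by `cis (e / N)` cancels the contribution of the pure
tone and leaves `1 + R / N`. The hypotheses `5 ≤ N` and `‖R / N‖ ≤ 1 / 2` keep the two phases within
`π / 2`, so their sum stays in the principal branch. -/
lemma residualOf_interpolant {N : ℕ} (hN : 5 ≤ N) {A : ℂ} {e : ℝ} (he : |e| ≤ 5 / 4) {Ep Em : ℂ}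
    (hden : interpDen N A e Ep Em ≠ 0) (hR : ‖interpErr N A e Ep Em / N‖ ≤ 1 / 2) :
    residualOf N (interpolant (A * tone N (e - 1 / 2) + Ep) (A * tone N (e + 1 / 2) + Em)) =
      e - N / (2 * Real.pi) * (Complex.log (1 + interpErr N A e Ep Em / N)).im := by
  have hN0 : N ≠ 0 := by omega
  have hNc : (N : ℂ) ≠ 0 := by exact_mod_cast hN0
  have hN' : (0 : ℝ) < N := by exact_mod_cast Nat.pos_of_ne_zero hN0
  have hN5 : (5 : ℝ) ≤ N := by exact_mod_cast hN
  set D := interpDen N A e Ep Em with hD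
  set R := interpErr N A e Ep Em with hRdef
  have hpi := Real.pi_pos
  set Sp := A * tone N (e - 1 / 2) + Ep with hSp
  set Sm := A * tone N (e + 1 / 2) + Em with hSm
  have hDS : Sp - Sm = D := by rw [hD, interpDen, gap]; ring
  have hRD : R * D = N * (cis ((e - 1 / 2) / N) - 1) * Ep - N * (cis ((e + 1 / 2) / N) - 1) * Em := by
    rw [hRdef, interpErr, ← hD, div_mul_cancel₀ _ hden]
  have hcc : ((Real.cos (Real.pi / N) : ℝ) : ℂ) - Complex.I * (Real.sin (Real.pi / N) : ℝ) =
      cis (-(1 / 2) / N) := by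
    rw [cis_eq_cos_add_sin, show 2 * Real.pi * (-(1 / 2) / N) = -(Real.pi / N) by ring,
      Real.cos_neg, Real.sin_neg]
    push_cast; ring
  have hcp : ((Real.cos (Real.pi / N) : ℝ) : ℂ) + Complex.I * (Real.sin (Real.pi / N) : ℝ) =
      cis ((1 / 2) / N) := by
    rw [cis_eq_cos_add_sin, show 2 * Real.pi * ((1 / 2) / N) = Real.pi / N by ring]
    push_cast; ring
  have e1 : cis ((e - 1 / 2) / N) = cis (e / N) * cis (-(1 / 2) / N) := by
    rw [← cis_add]; congr 1; ring
  have e2 : cis ((e + 1 / 2) / N) = cis (e / N) * cis ((1 / 2) / N) := by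
    rw [← cis_add]; congr 1; ring
  have hti := tone_interpolation hN0 e
  have key : cis (e / N) * ((Real.cos (Real.pi / N) : ℝ) -
      2 * Complex.I * interpolant Sp Sm * (Real.sin (Real.pi / N) : ℝ)) = 1 + R / N := by
    have h1 : interpolant Sp Sm = (Sp + Sm) / (2 * D) := by
      rw [interpolant, hDS]; field_simp
    have h2 : (1 + R / N) * (N * D) = N * D + R * D := by field_simp
    apply mul_right_cancel₀ (mul_ne_zero hNc hden)
    rw [h2, hRD, h1]
    have h3 : cis (e / N) * ((Real.cos (Real.pi / N) : ℝ) -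
      2 * Complex.I * ((Sp + Sm) / (2 * D)) * (Real.sin (Real.pi / N) : ℝ)) * (N * D) =
      N * cis (e / N) * (((Real.cos (Real.pi / N) : ℝ) : ℂ) * D -
        Complex.I * (Real.sin (Real.pi / N) : ℝ) * (Sp + Sm)) := by
      field_simp
    rw [h3, e1, e2, ← hcc, ← hcp, ← hDS]
    rw [e1, e2, ← hcc, ← hcp] at hti
    rw [hSp, hSm]
    -- All terms in the errors match identically; those in `A` match by the exactness of the
    -- interpolation for a pure tone.
    linear_combination (-(N : ℂ) * A) * hti
  have hq : (Real.cos (Real.pi / N) : ℝ) -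
      2 * Complex.I * interpolant Sp Sm * (Real.sin (Real.pi / N) : ℝ) =
      Complex.exp (-(2 * Real.pi * e / N : ℝ) * Complex.I + Complex.log (1 + R / N)) := by
    have hne : 1 + R / N ≠ 0 := by
      intro h0
      have : ‖R / N‖ = 1 := by
        rw [show R / N = -1 by linear_combination h0]; simp
      linarith
    rw [Complex.exp_add, Complex.exp_log hne, ← key, ← mul_assoc, cis_eq, ← Complex.exp_add]
    have : -((2 * Real.pi * e / N : ℝ) : ℂ) * Complex.I + ((2 * Real.pi * (e / N) : ℝ) : ℂ) * Complex.I = 0 := by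
      push_cast; ring
    rw [this, Complex.exp_zero, one_mul]
  have him := log_one_add_im_abs_le hR
  have hthe : |2 * Real.pi * e / N| ≤ Real.pi / 2 := by
    rw [abs_div, Nat.abs_cast, div_le_iff₀ hN', abs_mul, abs_of_pos (by positivity : 0 < 2 * Real.pi)]
    nlinarith [abs_nonneg e]
  rw [residualOf, hq]
  have him2 : (-((2 * Real.pi * e / N : ℝ) : ℂ) * Complex.I + Complex.log (1 + R / N)).im =
      -(2 * Real.pi * e / N) + (Complex.log (1 + R / N)).im := by
    simp [-Complex.ofReal_div, -Complex.ofReal_mul]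
  have hstrict : |(Complex.log (1 + R / N)).im| < Real.pi / 2 := by
    rw [Complex.log_im, Complex.abs_arg_lt_pi_div_two_iff]
    left
    have := (abs_le.1 (Complex.abs_re_le_norm (R / N))).1
    simp only [Complex.add_re, Complex.one_re]
    linarith
  have b1 := abs_le.1 hthe
  have b2 := abs_lt.1 hstrict
  rw [Complex.log_exp (by rw [him2]; linarith) (by rw [him2]; linarith), him2]
  field_simp
  ring

lemma norm_log_one_add_sub_le {u v : ℂ} (hu : ‖u‖ ≤ 1 / 2) (hv : ‖v‖ ≤ 1 / 2) :
    ‖Complex.log (1 + u) - Complex.log (1 + v)‖ ≤ 2 * ‖u - v‖ := by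
  have hre : ∀ x ∈ Metric.closedBall (0 : ℂ) (1 / 2), 1 / 2 ≤ (1 + x).re := fun x hx => by
    have h1 : ‖x‖ ≤ 1 / 2 := by simpa using hx
    have := (abs_le.1 (Complex.abs_re_le_norm x)).1
    simp only [Complex.add_re, Complex.one_re]
    linarith
  have hd : ∀ x ∈ Metric.closedBall (0 : ℂ) (1 / 2),
      HasDerivWithinAt (fun x => Complex.log (1 + x)) (1 / (1 + x))
        (Metric.closedBall (0 : ℂ) (1 / 2)) x := fun x hx => by
    apply HasDerivAt.hasDerivWithinAt
    have := (HasDerivAt.const_add (1 : ℂ) (hasDerivAt_id x)).clog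
      (Or.inl (by have := hre x hx; simp at this ⊢; linarith))
    simpa using this
  have := (convex_closedBall (0 : ℂ) (1 / 2)).norm_image_sub_le_of_norm_hasDerivWithin_le
    (C := 2) hd (fun x hx => by
      rw [norm_div, norm_one, div_le_iff₀]
      · have := hre x hx
        have := (abs_le.1 (Complex.abs_re_le_norm (1 + x))).2
        linarith [hre x hx]
      · exact norm_pos_iff.2 fun h => by
          have := hre x hx
          rw [h] at this; simp at this; linarith)
    (x := v) (y := u) (by simpa using hv) (by simpa using hu)
  exact this

lemma norm_cis_coeff_le {N : ℕ} (hN : N ≠ 0) {x : ℝ} (hx : |x| ≤ 7 / 4) :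
    ‖(N : ℂ) * (cis (x / N) - 1)‖ ≤ 11 := by
  have hN' : (0 : ℝ) < N := by exact_mod_cast Nat.pos_of_ne_zero hN
  rw [norm_mul, Complex.norm_natCast]
  have := norm_cis_sub_one_le (x / N)
  rw [abs_div, Nat.abs_cast, ← mul_div_assoc, le_div_iff₀ hN'] at this
  nlinarith [Real.pi_lt_d4, abs_nonneg x]

lemma norm_cis_coeff_sub_le {N : ℕ} (hN : N ≠ 0) (x y : ℝ) :
    ‖(N : ℂ) * (cis (x / N) - 1) - N * (cis (y / N) - 1)‖ ≤ 7 * |x - y| := by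
  have hN' : (0 : ℝ) < N := by exact_mod_cast Nat.pos_of_ne_zero hN
  rw [← mul_sub, sub_sub_sub_cancel_right, norm_mul, Complex.norm_natCast]
  have := norm_cis_sub_cis_le (x / N) (y / N)
  rw [← sub_div, abs_div, Nat.abs_cast, ← mul_div_assoc, le_div_iff₀ hN'] at this
  nlinarith [Real.pi_lt_d2, abs_nonneg (x - y)]

lemma abs_half_le {e : ℝ} (he : |e| ≤ 5 / 4) : |e - 1 / 2| ≤ 7 / 4 ∧ |e + 1 / 2| ≤ 7 / 4 := by
  rw [abs_le] at he
  constructor <;> rw [abs_le] <;> constructor <;> linarith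

section Bounds

variable {N : ℕ} {A : ℂ} {e e' η d : ℝ} {Ep Em Ep' Em' : ℂ}

/-- The gap contributes at least `‖A‖ / 20`, of which the two errors can cancel at most `‖A‖ / 40`.
-/
lemma le_norm_interpDen (hN : 2 ≤ N) (he : |e| ≤ 5 / 4) (hp : ‖Ep‖ ≤ η)
    (hm : ‖Em‖ ≤ η) (hη : η ≤ ‖A‖ / 80) : ‖A‖ / 40 ≤ ‖interpDen N A e Ep Em‖ := by
  have h1 := le_norm_gap hN he
  have h2 : ‖A‖ * (1 / 20) ≤ ‖A * gap N e‖ := by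
    rw [norm_mul]; exact mul_le_mul_of_nonneg_left h1 (norm_nonneg _)
  have h3 := norm_sub_le Ep Em
  have h4 := norm_sub_norm_le (A * gap N e) (-(Ep - Em))
  rw [norm_neg, sub_neg_eq_add] at h4
  rw [interpDen]; linarith

lemma norm_interpNum_le (hN : N ≠ 0) (he : |e| ≤ 5 / 4) (hp : ‖Ep‖ ≤ η)
    (hm : ‖Em‖ ≤ η) :
    ‖N * (cis ((e - 1 / 2) / N) - 1) * Ep - N * (cis ((e + 1 / 2) / N) - 1) * Em‖ ≤ 22 * η := by
  obtain ⟨h1, h2⟩ := abs_half_le he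
  have a1 := norm_cis_coeff_le hN h1
  have a2 := norm_cis_coeff_le hN h2
  refine (norm_sub_le _ _).trans ?_
  rw [norm_mul _ Ep, norm_mul _ Em]
  have b1 := mul_le_mul a1 hp (norm_nonneg _) (by norm_num)
  have b2 := mul_le_mul a2 hm (norm_nonneg _) (by norm_num)
  linarith

lemma norm_interpErr_le (hN : 2 ≤ N) (hA : 0 < ‖A‖) (he : |e| ≤ 5 / 4) (hp : ‖Ep‖ ≤ η)
    (hm : ‖Em‖ ≤ η) (hη : η ≤ ‖A‖ / 80) : ‖interpErr N A e Ep Em‖ ≤ 880 * η / ‖A‖ := by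
  have h1 := le_norm_interpDen hN he hp hm hη
  have h2 := norm_interpNum_le (N := N) (by omega) he hp hm
  rw [interpErr, norm_div, div_le_div_iff₀ (by linarith) hA]
  have h0 : 0 ≤ η := (norm_nonneg _).trans hp
  calc _ ≤ 22 * η * ‖A‖ := by gcongr
    _ = 880 * η * (‖A‖ / 40) := by ring
    _ ≤ _ := by gcongr

/-- Difference of two quotients `M / D`. The errors are allowed to change by `2 * η * d`: one `η *
d` for the displaced location and one for the changed estimates of the other components. The factor
`η` survives because `M` is linear in the errors and `R'` is itself of order `η / ‖A‖`. -/
lemma norm_interpErr_sub_le (hN : 2 ≤ N) (hA : 0 < ‖A‖) (he : |e| ≤ 5 / 4) (he' : |e'| ≤ 5 / 4)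
    (hp : ‖Ep‖ ≤ η) (hm : ‖Em‖ ≤ η) (hp' : ‖Ep'‖ ≤ η) (hm' : ‖Em'‖ ≤ η) (hη : η ≤ ‖A‖ / 80)
    (hee : |e - e'| ≤ d) (hpp : ‖Ep - Ep'‖ ≤ 2 * η * d) (hmm : ‖Em - Em'‖ ≤ 2 * η * d) :
    ‖interpErr N A e Ep Em - interpErr N A e' Ep' Em'‖ ≤ 500000 * η * d / ‖A‖ := by
  have hN0 : N ≠ 0 := by omega
  have hη0 : 0 ≤ η := (norm_nonneg _).trans hp
  have hd0 : 0 ≤ d := (abs_nonneg _).trans hee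
  have hD := le_norm_interpDen hN he hp hm hη
  have hD' := le_norm_interpDen hN he' hp' hm' hη
  have hR' := norm_interpErr_le hN hA he' hp' hm' hη
  set D := interpDen N A e Ep Em with hDdef
  set D' := interpDen N A e' Ep' Em' with hDdef'
  have hDne : D ≠ 0 := norm_pos_iff.1 (by linarith)
  have hDne' : D' ≠ 0 := norm_pos_iff.1 (by linarith)
  set M := N * (cis ((e - 1 / 2) / N) - 1) * Ep - N * (cis ((e + 1 / 2) / N) - 1) * Em with hM
  set M' := N * (cis ((e' - 1 / 2) / N) - 1) * Ep' - N * (cis ((e' + 1 / 2) / N) - 1) * Em' with hM'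
  obtain ⟨h1, h2⟩ := abs_half_le he'
  have a1 := norm_cis_coeff_le hN0 h1
  have a2 := norm_cis_coeff_le hN0 h2
  have l1 := norm_cis_coeff_sub_le hN0 (e - 1 / 2) (e' - 1 / 2)
  have l2 := norm_cis_coeff_sub_le hN0 (e + 1 / 2) (e' + 1 / 2)
  rw [show e - 1 / 2 - (e' - 1 / 2) = e - e' by ring] at l1
  rw [show e + 1 / 2 - (e' + 1 / 2) = e - e' by ring] at l2
  have hMM : ‖M - M'‖ ≤ 58 * η * d := by
    have : M - M' = ((N * (cis ((e - 1 / 2) / N) - 1) - N * (cis ((e' - 1 / 2) / N) - 1)) * Ep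
        + N * (cis ((e' - 1 / 2) / N) - 1) * (Ep - Ep'))
      - ((N * (cis ((e + 1 / 2) / N) - 1) - N * (cis ((e' + 1 / 2) / N) - 1)) * Em
        + N * (cis ((e' + 1 / 2) / N) - 1) * (Em - Em')) := by rw [hM, hM']; ring
    rw [this]
    refine (norm_sub_le _ _).trans ?_
    have c1 := norm_add_le ((N * (cis ((e - 1 / 2) / N) - 1) - N * (cis ((e' - 1 / 2) / N) - 1)) * Ep)
      (N * (cis ((e' - 1 / 2) / N) - 1) * (Ep - Ep'))
    have c2 := norm_add_le ((N * (cis ((e + 1 / 2) / N) - 1) - N * (cis ((e' + 1 / 2) / N) - 1)) * Em)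
      (N * (cis ((e' + 1 / 2) / N) - 1) * (Em - Em'))
    rw [norm_mul _ Ep, norm_mul _ (Ep - Ep')] at c1
    rw [norm_mul _ Em, norm_mul _ (Em - Em')] at c2
    have d1 := mul_le_mul (l1.trans (mul_le_mul_of_nonneg_left hee (by norm_num))) hp (norm_nonneg _) (by positivity)
    have d2 := mul_le_mul (l2.trans (mul_le_mul_of_nonneg_left hee (by norm_num))) hm (norm_nonneg _) (by positivity)
    have d3 := mul_le_mul a1 hpp (norm_nonneg _) (by norm_num)
    have d4 := mul_le_mul a2 hmm (norm_nonneg _) (by norm_num)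
    linarith
  have hDD : ‖D' - D‖ ≤ 14 * ‖A‖ * d := by
    have : D' - D = -(A * (gap N e - gap N e')) + ((Em - Em') - (Ep - Ep')) := by
      rw [hDdef, hDdef', interpDen, interpDen]; ring
    rw [this]
    have c1 := norm_add_le (-(A * (gap N e - gap N e'))) ((Em - Em') - (Ep - Ep'))
    have c2 := norm_sub_le (Em - Em') (Ep - Ep')
    rw [norm_neg, norm_mul] at c1
    have c3 : ‖gap N e - gap N e'‖ ≤ 12.6 * d :=
      (norm_gap_sub_le N e e').trans (by nlinarith [Real.pi_lt_d2, abs_nonneg (e - e'), Real.pi_pos])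
    have c4 := mul_le_mul_of_nonneg_left c3 hA.le
    have c5 : η * d ≤ ‖A‖ / 80 * d := by gcongr
    nlinarith
  -- This form of the quotient difference puts the variation of the denominator, which is of order
  -- `‖A‖`, next to the small factor `R'`.
  have key : interpErr N A e Ep Em - interpErr N A e' Ep' Em' =
      ((M - M') + interpErr N A e' Ep' Em' * (D' - D)) / D := by
    rw [interpErr, interpErr, ← hDdef, ← hDdef', ← hM, ← hM']
    field_simp
    ring
  rw [key, norm_div, div_le_div_iff₀ (by linarith) hA]
  have h3 : ‖(M - M') + interpErr N A e' Ep' Em' * (D' - D)‖ ≤ 12378 * η * d := by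
    refine (norm_add_le _ _).trans ?_
    rw [norm_mul]
    have := mul_le_mul hR' hDD (norm_nonneg _) (by positivity)
    have e3 : 880 * η / ‖A‖ * (14 * ‖A‖ * d) = 12320 * η * d := by field_simp; ring
    linarith
  calc _ ≤ 12378 * η * d * ‖A‖ := by gcongr
    _ ≤ 500000 * η * d * (‖A‖ / 40) := by nlinarith [mul_nonneg (mul_nonneg hη0 hd0) hA.le]
    _ ≤ _ := by gcongr

/-- The logarithm is Lipschitz near `1`, and its increments of order `1 / N` absorb the prefactor
`N`. -/
lemma log_im_sub_le {R R' : ℂ} (hN : N ≠ 0) (h : ‖R / N‖ ≤ 1 / 2) (h' : ‖R' / N‖ ≤ 1 / 2) :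
    |N / (2 * Real.pi) * (Complex.log (1 + R / N)).im -
      N / (2 * Real.pi) * (Complex.log (1 + R' / N)).im| ≤ ‖R - R'‖ / Real.pi := by
  have hN' : (0 : ℝ) < N := by exact_mod_cast Nat.pos_of_ne_zero hN
  have hpi := Real.pi_pos
  have h1 := norm_log_one_add_sub_le h h'
  have h2 := Complex.abs_im_le_norm (Complex.log (1 + R / N) - Complex.log (1 + R' / N))
  rw [Complex.sub_im] at h2
  rw [← sub_div, norm_div, Complex.norm_natCast] at h1
  rw [← mul_sub, abs_mul, abs_of_pos (by positivity)]
  have h3 := mul_le_mul_of_nonneg_left (h2.trans h1) (by positivity : 0 ≤ N / (2 * Real.pi))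
  refine h3.trans (le_of_eq ?_)
  field_simp

end Bounds

/-! ### The update of one component, with a general error term -/

/-- A tone of amplitude `A` at the location `y₀` with an error term `E`. -/
def perturbedTone (N : ℕ) (A : ℂ) (y₀ : ℝ) (E : ℝ → ℂ) (y : ℝ) : ℂ := A * tone N (y₀ - y) + E y

/-- The interpolated location, starting from the location `u`. -/
def newLoc (N : ℕ) (A : ℂ) (y₀ : ℝ) (E : ℝ → ℂ) (u : ℝ) : ℝ :=
  u + residualOf N (interpolant (perturbedTone N A y₀ E (u + 1 / 2))
    (perturbedTone N A y₀ E (u - 1 / 2)))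

section Step

variable {N : ℕ} {A : ℂ} {y₀ u u' η d : ℝ} {E E' : ℝ → ℂ}

lemma abs_add_half_sub_le (hu : |y₀ - u| ≤ 5 / 4) :
    |u + 1 / 2 - y₀| ≤ 2 ∧ |u - 1 / 2 - y₀| ≤ 2 := by
  rw [abs_le] at hu
  constructor <;> rw [abs_le] <;> constructor <;> linarith

/-- Here `‖R‖ ≤ 880 / 80 = 11`, which explains the threshold `22` on `N`. -/
lemma norm_interpErr_div_le (hN : 22 ≤ N) (hA : 0 < ‖A‖) (hu : |y₀ - u| ≤ 5 / 4)
    (hE : ∀ y, |y - y₀| ≤ 2 → ‖E y‖ ≤ η) (hη : η ≤ ‖A‖ / 80) :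
    ‖interpErr N A (y₀ - u) (E (u + 1 / 2)) (E (u - 1 / 2)) / N‖ ≤ 1 / 2 := by
  have hN22 : (22 : ℝ) ≤ N := by exact_mod_cast hN
  obtain ⟨h1, h2⟩ := abs_add_half_sub_le hu
  have h := norm_interpErr_le (N := N) (by omega) hA hu (hE _ h1) (hE _ h2) hη
  rw [norm_div, Complex.norm_natCast, div_le_iff₀ (by linarith)]
  refine h.trans ?_
  rw [div_le_iff₀ hA]
  nlinarith

lemma newLoc_eq (hN : 22 ≤ N) (hA : 0 < ‖A‖) (hu : |y₀ - u| ≤ 5 / 4)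
    (hE : ∀ y, |y - y₀| ≤ 2 → ‖E y‖ ≤ η) (hη : η ≤ ‖A‖ / 80) :
    newLoc N A y₀ E u = y₀ - N / (2 * Real.pi) * (Complex.log
      (1 + interpErr N A (y₀ - u) (E (u + 1 / 2)) (E (u - 1 / 2)) / N)).im := by
  obtain ⟨h1, h2⟩ := abs_add_half_sub_le hu
  have hD := le_norm_interpDen (N := N) (by omega) hu (hE _ h1) (hE _ h2) hη
  have := residualOf_interpolant (N := N) (by omega) hu (A := A) (Ep := E (u + 1 / 2))
    (Em := E (u - 1 / 2)) (norm_pos_iff.1 (by linarith)) (norm_interpErr_div_le hN hA hu hE hη)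
  rw [newLoc, perturbedTone, perturbedTone, show y₀ - (u + 1 / 2) = y₀ - u - 1 / 2 by ring,
    show y₀ - (u - 1 / 2) = y₀ - u + 1 / 2 by ring, this]
  ring

/-- The exact case `R = 0` serves as comparison. The bound is weighted by `‖A‖`, since a mislocated
component leaks in proportion to its amplitude. -/
lemma abs_newLoc_sub_le (hN : 22 ≤ N) (hA : 0 < ‖A‖) (hu : |y₀ - u| ≤ 5 / 4)
    (hE : ∀ y, |y - y₀| ≤ 2 → ‖E y‖ ≤ η) (hη : η ≤ ‖A‖ / 80) :
    ‖A‖ * |newLoc N A y₀ E u - y₀| ≤ 300 * η := by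
  obtain ⟨h1, h2⟩ := abs_add_half_sub_le hu
  have hη0 : 0 ≤ η := (norm_nonneg _).trans (hE _ h1)
  have hR := norm_interpErr_le (N := N) (by omega) hA hu (hE _ h1) (hE _ h2) hη
  have hl := log_im_sub_le (N := N) (R' := 0) (by omega) (norm_interpErr_div_le hN hA hu hE hη)
    (by simp)
  rw [newLoc_eq hN hA hu hE hη, sub_sub_cancel_left, abs_neg]
  simp only [zero_div, add_zero, Complex.log_one, Complex.zero_im, mul_zero, sub_zero] at hl
  have h3 := mul_le_mul_of_nonneg_left hl hA.le
  refine h3.trans ?_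
  rw [le_div_iff₀ hA] at hR
  rw [← mul_div_assoc, div_le_iff₀ Real.pi_pos]
  nlinarith [Real.pi_gt_d2]

lemma norm_perturbedTone_newLoc_sub_le (hN : 22 ≤ N) (hA : 0 < ‖A‖) (hu : |y₀ - u| ≤ 5 / 4)
    (hE : ∀ y, |y - y₀| ≤ 2 → ‖E y‖ ≤ η) (hη : η ≤ ‖A‖ / 80)
    (hloc : |newLoc N A y₀ E u - y₀| ≤ 2) :
    ‖perturbedTone N A y₀ E (newLoc N A y₀ E u) - A‖ ≤ 2000 * η := by
  have h1 := abs_newLoc_sub_le hN hA hu hE hη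
  have h2 := hE _ hloc
  set v := newLoc N A y₀ E u
  have h3 := norm_tone_sub_le N (y₀ - v) 0
  rw [tone_zero (by omega), sub_zero, abs_sub_comm] at h3
  have : perturbedTone N A y₀ E v - A = A * (tone N (y₀ - v) - 1) + E v := by
    rw [perturbedTone]; ring
  rw [this]
  refine (norm_add_le _ _).trans ?_
  rw [norm_mul]
  have h4 := mul_le_mul_of_nonneg_left h3 hA.le
  have hη0 : 0 ≤ η := (norm_nonneg _).trans h2
  have h5 : ‖A‖ * (2 * Real.pi * |v - y₀|) ≤ 2 * Real.pi * (300 * η) := by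
    calc _ = 2 * Real.pi * (‖A‖ * |v - y₀|) := by ring
      _ ≤ _ := mul_le_mul_of_nonneg_left h1 (by positivity)
  nlinarith [Real.pi_lt_d2]

/-- The new location depends on the old one only through the errors, so its Lipschitz constant
carries the factor `η`. The same `η` serves as a bound of `E` and of both kinds of variation of `E`.
-/
lemma abs_newLoc_sub_newLoc_le (hN : 22 ≤ N) (hA : 0 < ‖A‖) (hu : |y₀ - u| ≤ 5 / 4)
    (hu' : |y₀ - u'| ≤ 5 / 4) (hE : ∀ y, |y - y₀| ≤ 2 → ‖E y‖ ≤ η)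
    (hE' : ∀ y, |y - y₀| ≤ 2 → ‖E' y‖ ≤ η) (hη : η ≤ ‖A‖ / 80)
    (hlip : ∀ y y', |y - y₀| ≤ 2 → |y' - y₀| ≤ 2 → ‖E y - E y'‖ ≤ η * |y - y'|)
    (hEE : ∀ y, |y - y₀| ≤ 2 → ‖E y - E' y‖ ≤ η * d) (hd : |u - u'| ≤ d) :
    ‖A‖ * |newLoc N A y₀ E u - newLoc N A y₀ E' u'| ≤ 160000 * η * d := by
  obtain ⟨h1, h2⟩ := abs_add_half_sub_le hu
  obtain ⟨h1', h2'⟩ := abs_add_half_sub_le hu'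
  have hη0 : 0 ≤ η := (norm_nonneg _).trans (hE _ h1)
  have hd0 : 0 ≤ d := (abs_nonneg _).trans hd
  have dif : ∀ y y', |y - y₀| ≤ 2 → |y' - y₀| ≤ 2 → y - y' = u - u' →
      ‖E y - E' y'‖ ≤ 2 * η * d := fun y y' hy hy' hyy => by
    have a1 := hlip y y' hy hy'
    have a2 := hEE y' hy'
    rw [hyy] at a1
    have a3 := norm_add_le (E y - E y') (E y' - E' y')
    rw [sub_add_sub_cancel] at a3
    have := mul_le_mul_of_nonneg_left hd hη0
    linarith
  have hR := norm_interpErr_sub_le (N := N) (by omega) hA hu hu' (hE _ h1) (hE _ h2) (hE' _ h1')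
    (hE' _ h2') hη (d := d) (by rwa [sub_sub_sub_cancel_left, abs_sub_comm])
    (dif _ _ h1 h1' (by ring)) (dif _ _ h2 h2' (by ring))
  have hl := log_im_sub_le (N := N) (by omega) (norm_interpErr_div_le hN hA hu hE hη)
    (norm_interpErr_div_le hN hA hu' hE' hη)
  rw [newLoc_eq hN hA hu hE hη, newLoc_eq hN hA hu' hE' hη, sub_sub_sub_cancel_left,
    abs_sub_comm]
  refine (mul_le_mul_of_nonneg_left hl hA.le).trans ?_
  rw [le_div_iff₀ hA] at hR
  rw [← mul_div_assoc, div_le_iff₀ Real.pi_pos]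
  nlinarith [Real.pi_gt_d2, mul_nonneg hη0 hd0]

lemma norm_perturbedTone_sub_le {v v' : ℝ} (hη : η ≤ ‖A‖ / 80) (hη0 : 0 ≤ η) (hd : 0 ≤ d)
    (hv : |v - y₀| ≤ 2) (hv' : |v' - y₀| ≤ 2)
    (hlip : ∀ y y', |y - y₀| ≤ 2 → |y' - y₀| ≤ 2 → ‖E y - E y'‖ ≤ η * |y - y'|)
    (hEE : ∀ y, |y - y₀| ≤ 2 → ‖E y - E' y‖ ≤ η * d)
    (hvv : ‖A‖ * |v - v'| ≤ 160000 * η * d) :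
    ‖perturbedTone N A y₀ E v - perturbedTone N A y₀ E' v'‖ ≤ 1100000 * η * d := by
  have : perturbedTone N A y₀ E v - perturbedTone N A y₀ E' v' =
      A * (tone N (y₀ - v) - tone N (y₀ - v')) + ((E v - E v') + (E v' - E' v')) := by
    rw [perturbedTone, perturbedTone]; ring
  rw [this]
  have a1 := norm_tone_sub_le N (y₀ - v) (y₀ - v')
  rw [sub_sub_sub_cancel_left, abs_sub_comm] at a1
  have a2 := norm_add_le (A * (tone N (y₀ - v) - tone N (y₀ - v'))) ((E v - E v') + (E v' - E' v'))
  have a3 := norm_add_le (E v - E v') (E v' - E' v')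
  rw [norm_mul] at a2
  have a4 := mul_le_mul_of_nonneg_left a1 (norm_nonneg A)
  have a5 := hlip v v' hv hv'
  have a6 := hEE v' hv'
  have a7 : η * |v - v'| ≤ ‖A‖ / 80 * |v - v'| := by gcongr
  have a8 : ‖A‖ * (2 * Real.pi * |v - v'|) ≤ 6.3 * (‖A‖ * |v - v'|) := by
    nlinarith [Real.pi_lt_d2, mul_nonneg (norm_nonneg A) (abs_nonneg (v - v'))]
  nlinarith [mul_nonneg hη0 hd]

end Step

/-! ### The error term of a component -/

/-- Noise and uncompensated leakage at the bin location `y`, when component `p` is updated. -/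
def errTerm {L : ℕ} (N : ℕ) (A : Fin L → ℂ) (f : Fin L → ℝ) (w : ℕ → ℂ) (m : Fin L → ℤ)
    (s : Estimates L) (p : Fin L) (y : ℝ) : ℂ :=
  fourierCoeffAt N w y + ∑ l ∈ Finset.univ.erase p,
    (A l * tone N (N * f l - y) - (s l).2 * tone N (m l + (s l).1 - y))

lemma fourierCoeffAt_add (N : ℕ) (x w : ℕ → ℂ) (y : ℝ) :
    fourierCoeffAt N (fun n => x n + w n) y = fourierCoeffAt N x y + fourierCoeffAt N w y := by
  simp only [fourierCoeffAt, add_mul, Finset.sum_add_distrib, mul_add]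

lemma fourierCoeffAt_signal {L : ℕ} {N : ℕ} (hN : N ≠ 0) (A : Fin L → ℂ) (f : Fin L → ℝ) (y : ℝ) :
    fourierCoeffAt N (signal A f) y = ∑ l, A l * tone N (N * f l - y) := by
  have hN' : (N : ℂ) ≠ 0 := by exact_mod_cast hN
  simp only [fourierCoeffAt, signal, Finset.sum_mul, tone]
  rw [Finset.sum_comm, Finset.mul_sum]
  refine Finset.sum_congr rfl fun l _ => ?_
  rw [Finset.mul_sum, Finset.mul_sum, Finset.mul_sum]
  refine Finset.sum_congr rfl fun n _ => ?_
  rw [mul_assoc (A l), ← Complex.exp_add]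
  have : 2 * Real.pi * Complex.I * f l * n + -(2 * Real.pi * Complex.I * y * n / N) =
      2 * Real.pi * Complex.I * ((N * f l - y : ℝ) : ℂ) * n / N := by
    push_cast; field_simp; ring
  rw [this]
  ring

/-- This reduces the coupled problem to the one-tone step: the noise and the other components enter
only through `errTerm`. -/
lemma leakFree_observed {L : ℕ} {N : ℕ} (hN : N ≠ 0) (A : Fin L → ℂ) (f : Fin L → ℝ) (w : ℕ → ℂ)
    (m : Fin L → ℤ) (s : Estimates L) (p : Fin L) (y : ℝ) :
    leakFree N (observed A f w) m s p y =
      perturbedTone N (A p) (N * f p) (errTerm N A f w m s p) y := by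
  have : observed A f w = fun n => signal A f n + w n := rfl
  rw [leakFree, this, fourierCoeffAt_add, fourierCoeffAt_signal hN, leakage, perturbedTone, errTerm,
    Finset.sum_sub_distrib, ← Finset.add_sum_erase Finset.univ _ (Finset.mem_univ p)]
  ring

lemma newResidual_observed {L : ℕ} {N : ℕ} (hN : N ≠ 0) (A : Fin L → ℂ) (f : Fin L → ℝ) (w : ℕ → ℂ)
    (m : Fin L → ℤ) (s : Estimates L) (p : Fin L) :
    m p + newResidual N (observed A f w) m s p =
      newLoc N (A p) (N * f p) (errTerm N A f w m s p) (m p + (s p).1) := by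
  rw [newResidual, newLoc, leakFree_observed hN, leakFree_observed hN]; ring

/-- The noise and its variation with the bin location are bounded by `τ`. -/
def NoiseBound (N : ℕ) (w : ℕ → ℂ) (τ : ℝ) : Prop :=
  ∀ y y' : ℝ, |y| ≤ N → |y'| ≤ N → ‖fourierCoeffAt N w y‖ ≤ τ ∧
    ‖fourierCoeffAt N w y - fourierCoeffAt N w y'‖ ≤ τ * |y - y'|

/-- The leakage constant. -/
def leakConst (Δ : ℝ) : ℝ := 7 * (1 / Δ + 1 / Δ ^ 2)

lemma leakConst_pos {Δ : ℝ} (hΔ : 0 < Δ) : 0 < leakConst Δ := by unfold leakConst; positivity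

/-- A displacement by `7 / 2` bins changes the frequency by at most `Δ / 2` once `7 / Δ ≤ N`. A
distance `Δ / 2` to the integers remains, which gives `‖1 - cis‖ ≥ 2 * Δ`. -/
lemma far_bounds {N : ℕ} {Δ g y y' : ℝ} (hΔ : 0 < Δ) (hN : 7 / Δ ≤ N) (hg : Δ ≤ |g|)
    (hg' : |g| ≤ 1 - Δ) (hy : |y - N * g| ≤ 7 / 2) (hy' : |y' - N * g| ≤ 7 / 2) :
    ‖tone N y‖ ≤ leakConst Δ / N ∧ ‖tone N y - tone N y'‖ ≤ leakConst Δ / N * |y - y'| := by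
  have hN' : (0 : ℝ) < N := lt_of_lt_of_le (by positivity) hN
  have hN0 : N ≠ 0 := by rintro rfl; simp at hN'
  have hNΔ : 7 ≤ N * Δ := by rwa [div_le_iff₀ hΔ] at hN
  have key : ∀ y, |y - N * g| ≤ 7 / 2 → 2 * Δ ≤ ‖1 - cis (y / N)‖ := fun y hy => by
    have h1 : |y / N - g| ≤ Δ / 2 := by
      have : y / N - g = (y - N * g) / N := by field_simp
      rw [this, abs_div, Nat.abs_cast, div_le_iff₀ hN']; linarith
    have h2 := abs_sub_abs_le_abs_sub (y / N) g
    have h3 := abs_sub_abs_le_abs_sub g (y / N)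
    rw [abs_sub_comm] at h3
    have := le_norm_one_sub_cis (d := Δ / 2) (x := y / N) (by linarith) (by linarith) (by linarith)
    linarith
  have h1 := norm_tone_le_of_far hN0 (by positivity : 0 < 2 * Δ) (key y hy)
  have h2 := norm_tone_sub_le_of_far hN0 (by positivity : 0 < 2 * Δ) (key y hy) (key y' hy')
  constructor
  · refine h1.trans ?_
    gcongr
    rw [leakConst, show 2 / (2 * Δ) = 1 / Δ by field_simp]
    have : 0 < 1 / Δ := by positivity
    have : 0 < 1 / Δ ^ 2 := by positivity
    linarith
  · refine h2.trans ?_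
    gcongr
    rw [leakConst, show 1 / (2 * Δ) + 2 / (2 * Δ) ^ 2 = (1 / Δ + 1 / Δ ^ 2) / 2 by field_simp]
    have : 0 < 1 / Δ + 1 / Δ ^ 2 := by positivity
    nlinarith [Real.pi_lt_d2]

section Leak

variable {L N : ℕ} {A : Fin L → ℂ} {f : Fin L → ℝ} {w : ℕ → ℂ} {m : Fin L → ℤ}
  {s t : Estimates L} {p : Fin L} {Δ a B τ d X y y' : ℝ}

/-- The standing assumptions on the parameters of the signal and the bins. -/
structure Params (Δ : ℝ) (N : ℕ) (f : Fin L → ℝ) (m : Fin L → ℤ) : Prop where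
  pos : 0 < Δ
  large : 7 / Δ ≤ N
  ge : 22 ≤ N
  mem : ∀ l, f l ∈ Set.Icc (-(1 / 2) : ℝ) (1 / 2)
  sep : ∀ l p, l ≠ p → Δ ≤ |f l - f p| ∧ |f l - f p| ≤ 1 - Δ
  bin : ∀ l, |(N : ℝ) * f l - m l| ≤ 1 / 2

lemma Params.natCast_pos (h : Params Δ N f m) : (0 : ℝ) < N := by
  have := h.ge; exact_mod_cast (by omega : 0 < N)

lemma Params.noise (h : Params Δ N f m) (hw : NoiseBound N w τ) (hy : |y - N * f p| ≤ 2)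
    (hy' : |y' - N * f p| ≤ 2) : ‖fourierCoeffAt N w y‖ ≤ τ ∧
    ‖fourierCoeffAt N w y - fourierCoeffAt N w y'‖ ≤ τ * |y - y'| := by
  have hN22 : (22 : ℝ) ≤ N := by exact_mod_cast h.ge
  have hf : |N * f p| ≤ N / 2 := by
    rw [abs_mul, Nat.abs_cast]
    have : |f p| ≤ 1 / 2 := abs_le.2 (h.mem p)
    nlinarith
  have key : ∀ y, |y - N * f p| ≤ 2 → |y| ≤ N := fun y hy => by
    have := abs_add_le (y - N * f p) (N * f p)
    rw [sub_add_cancel] at this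
    linarith
  exact hw y y' (key y hy) (key y' hy')

lemma Params.far (h : Params Δ N f m) {l : Fin L} (hlp : l ≠ p) {b b' : ℝ}
    (hb : |b - N * f l| ≤ 3 / 2) (hb' : |b' - N * f l| ≤ 3 / 2) (hy : |y - N * f p| ≤ 2)
    (hy' : |y' - N * f p| ≤ 2) :
    ‖tone N (b - y)‖ ≤ leakConst Δ / N ∧
      ‖tone N (b - y) - tone N (b' - y')‖ ≤ leakConst Δ / N * |(b - b') - (y - y')| := by
  have key : ∀ b y, |b - N * f l| ≤ 3 / 2 → |y - N * f p| ≤ 2 →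
      |b - y - N * (f l - f p)| ≤ 7 / 2 := fun b y hb hy => by
    rw [show b - y - N * (f l - f p) = (b - N * f l) - (y - N * f p) by ring]
    refine (abs_sub _ _).trans (by linarith)
  have := far_bounds h.pos h.large (h.sep l p hlp).1 (h.sep l p hlp).2 (key b y hb hy)
    (key b' y' hb' hy')
  rwa [show b - y - (b' - y') = (b - b') - (y - y') by ring] at this

lemma Params.est (h : Params Δ N f m) {l : Fin L} (hs : |(s l).1| ≤ 3 / 4) :
    |m l + (s l).1 - N * f l| ≤ 5 / 4 := by
  have := h.bin l
  rw [abs_le] at *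
  constructor <;> linarith

lemma norm_sum_erase_le {g : Fin L → ℂ} {c : ℝ} (hc : 0 ≤ c) (hg : ∀ l, l ≠ p → ‖g l‖ ≤ c) :
    ‖∑ l ∈ Finset.univ.erase p, g l‖ ≤ L * c := by
  refine (norm_sum_le _ _).trans ?_
  refine (Finset.sum_le_card_nsmul _ _ c fun l hl => hg l (Finset.ne_of_mem_erase hl)).trans ?_
  rw [nsmul_eq_mul]
  gcongr
  simp

/-- Each other component contributes a true tone of amplitude at most `B` and an estimated one of
amplitude at most `2 * B`, hence the `3 * B`. -/
lemma Params.norm_errTerm_le (h : Params Δ N f m) (hw : NoiseBound N w τ) (hB : 0 ≤ B)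
    (hA : ∀ l, ‖A l‖ ≤ B) (hs : ∀ l, |(s l).1| ≤ 3 / 4 ∧ ‖(s l).2‖ ≤ 2 * B)
    (hy : |y - N * f p| ≤ 2) (hy' : |y' - N * f p| ≤ 2) :
    ‖errTerm N A f w m s p y‖ ≤ τ + L * (3 * B * (leakConst Δ / N)) ∧
    ‖errTerm N A f w m s p y - errTerm N A f w m s p y'‖ ≤
      (τ + L * (3 * B * (leakConst Δ / N))) * |y - y'| := by
  have hN := h.natCast_pos
  have hc : 0 ≤ leakConst Δ / N := div_nonneg (leakConst_pos h.pos).le hN.le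
  have e1 : ∀ l, |(N : ℝ) * f l - N * f l| ≤ 3 / 2 := fun l => by simp; norm_num
  have e2 : ∀ l, |m l + (s l).1 - N * f l| ≤ 3 / 2 := fun l => (h.est (hs l).1).trans (by norm_num)
  constructor
  · refine (norm_add_le _ _).trans (add_le_add (h.noise hw hy hy).1 ?_)
    refine norm_sum_erase_le (by positivity) fun l hl => (norm_sub_le _ _).trans ?_
    rw [norm_mul, norm_mul]
    have a1 := mul_le_mul (hA l) (h.far hl (e1 l) (e1 l) hy hy).1 (norm_nonneg _) hB
    have a2 := mul_le_mul (hs l).2 (h.far hl (e2 l) (e2 l) hy hy).1 (norm_nonneg _) (by positivity)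
    linarith
  · rw [errTerm, errTerm, add_sub_add_comm, ← Finset.sum_sub_distrib, add_mul]
    refine (norm_add_le _ _).trans (add_le_add (h.noise hw hy hy').2 ?_)
    rw [mul_assoc]
    refine norm_sum_erase_le (by positivity) fun l hl => ?_
    rw [sub_sub_sub_comm, ← mul_sub, ← mul_sub]
    refine (norm_sub_le _ _).trans ?_
    rw [norm_mul, norm_mul]
    have b1 := (h.far hl (e1 l) (e1 l) hy hy').2
    have b2 := (h.far hl (e2 l) (e2 l) hy hy').2
    rw [sub_self, zero_sub, abs_neg] at b1 b2
    have a1 := mul_le_mul (hA l) b1 (norm_nonneg _) hB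
    have a2 := mul_le_mul (hs l).2 b2 (norm_nonneg _) (by positivity)
    linarith

/-- Noise and true tones cancel. In `1 + 2 * B`, the `1` accounts for the change of amplitude and `2
* B` for the change of location at bounded amplitude. -/
lemma Params.norm_errTerm_sub_le (h : Params Δ N f m) (hB : 0 ≤ B)
    (hs : ∀ l, |(s l).1| ≤ 3 / 4 ∧ ‖(s l).2‖ ≤ 2 * B)
    (ht : ∀ l, |(t l).1| ≤ 3 / 4 ∧ ‖(t l).2‖ ≤ 2 * B)
    (hst : ∀ l, |(s l).1 - (t l).1| ≤ d ∧ ‖(s l).2 - (t l).2‖ ≤ d) (hd : 0 ≤ d)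
    (hy : |y - N * f p| ≤ 2) :
    ‖errTerm N A f w m s p y - errTerm N A f w m t p y‖ ≤
      L * ((1 + 2 * B) * (leakConst Δ / N)) * d := by
  have hN := h.natCast_pos
  have hc : 0 ≤ leakConst Δ / N := div_nonneg (leakConst_pos h.pos).le hN.le
  have e2 : ∀ l, |m l + (s l).1 - N * f l| ≤ 3 / 2 := fun l => (h.est (hs l).1).trans (by norm_num)
  have e3 : ∀ l, |m l + (t l).1 - N * f l| ≤ 3 / 2 := fun l => (h.est (ht l).1).trans (by norm_num)
  rw [errTerm, errTerm, add_sub_add_left_eq_sub, ← Finset.sum_sub_distrib, mul_assoc]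
  refine norm_sum_erase_le (by positivity) fun l hl => ?_
  rw [sub_sub_sub_cancel_left, show (t l).2 * tone N (m l + (t l).1 - y) -
      (s l).2 * tone N (m l + (s l).1 - y) = -(((s l).2 - (t l).2) * tone N (m l + (s l).1 - y) +
        (t l).2 * (tone N (m l + (s l).1 - y) - tone N (m l + (t l).1 - y))) by ring, norm_neg]
  refine (norm_add_le _ _).trans ?_
  rw [norm_mul, norm_mul]
  obtain ⟨b1, b2⟩ := h.far hl (e2 l) (e3 l) hy hy
  rw [sub_self, sub_zero, add_sub_add_left_eq_sub] at b2
  have b3 := b2.trans (mul_le_mul_of_nonneg_left (hst l).1 hc)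
  have a1 := mul_le_mul (hst l).2 b1 (norm_nonneg _) hd
  have a2 := mul_le_mul (ht l).2 b3 (norm_nonneg _) (by positivity)
  linarith

/-- Compensation works up to the estimation errors: uncompensated leakage is their weighted size
`X`, damped by `1 / N`. This gain over the uniform bound is used at the fixed point. -/
lemma Params.norm_errTerm_sub_noise_le (h : Params Δ N f m)
    (hs : ∀ l, |(s l).1| ≤ 3 / 4) (hX : 0 ≤ X)
    (hsX : ∀ l, ‖A l‖ * |m l + (s l).1 - N * f l| + ‖(s l).2 - A l‖ ≤ X)
    (hy : |y - N * f p| ≤ 2) :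
    ‖errTerm N A f w m s p y - fourierCoeffAt N w y‖ ≤ L * (leakConst Δ / N * X) := by
  have hN := h.natCast_pos
  have hc : 0 ≤ leakConst Δ / N := div_nonneg (leakConst_pos h.pos).le hN.le
  have e1 : ∀ l, |(N : ℝ) * f l - N * f l| ≤ 3 / 2 := fun l => by simp; norm_num
  have e2 : ∀ l, |m l + (s l).1 - N * f l| ≤ 3 / 2 := fun l => (h.est (hs l)).trans (by norm_num)
  rw [errTerm, add_sub_cancel_left]
  refine norm_sum_erase_le (by positivity) fun l hl => ?_
  rw [show A l * tone N (N * f l - y) - (s l).2 * tone N (m l + (s l).1 - y) =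
    -(A l * (tone N (m l + (s l).1 - y) - tone N (N * f l - y)) +
      ((s l).2 - A l) * tone N (m l + (s l).1 - y)) by ring, norm_neg]
  refine (norm_add_le _ _).trans ?_
  rw [norm_mul, norm_mul]
  obtain ⟨b1, b2⟩ := h.far hl (e2 l) (e1 l) hy hy
  rw [sub_self, sub_zero] at b2
  have a1 := mul_le_mul_of_nonneg_left b2 (norm_nonneg (A l))
  have a2 := mul_le_mul_of_nonneg_left b1 (norm_nonneg ((s l).2 - A l))
  have a3 := mul_le_mul_of_nonneg_left (hsX l) hc
  linarith

end Leak

/-! ### Sweeps over all components -/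

section Sweep

variable {L : ℕ} {s t u : Estimates L} {κ r : ℝ}

/-- Squared distance of the estimates of one component. -/
def sqDist (x y : ℝ × ℂ) : ℝ := (x.1 - y.1) ^ 2 + ‖x.2 - y.2‖ ^ 2

lemma sqDist_nonneg (x y : ℝ × ℂ) : 0 ≤ sqDist x y := by unfold sqDist; positivity

lemma estDist_eq (s t : Estimates L) : estDist s t = √(∑ l, sqDist (s l) (t l)) := rfl

lemma estDist_nonneg (s t : Estimates L) : 0 ≤ estDist s t := Real.sqrt_nonneg _

lemma estDist_sq (s t : Estimates L) : estDist s t ^ 2 = ∑ l, sqDist (s l) (t l) :=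
  Real.sq_sqrt (Finset.sum_nonneg fun _ _ => sqDist_nonneg _ _)

lemma estDist_self (s : Estimates L) : estDist s s = 0 := by simp [estDist]

lemma sqDist_le (s t : Estimates L) (l : Fin L) : sqDist (s l) (t l) ≤ estDist s t ^ 2 := by
  rw [estDist_sq]
  exact Finset.single_le_sum (f := fun l => sqDist (s l) (t l)) (fun _ _ => sqDist_nonneg _ _)
    (Finset.mem_univ l)

lemma abs_fst_sub_le (s t : Estimates L) (l : Fin L) : |(s l).1 - (t l).1| ≤ estDist s t :=
  abs_le_of_sq_le_sq ((le_add_of_nonneg_right (by positivity)).trans (sqDist_le s t l))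
    (estDist_nonneg s t)

lemma norm_snd_sub_le (s t : Estimates L) (l : Fin L) : ‖(s l).2 - (t l).2‖ ≤ estDist s t :=
  (pow_le_pow_iff_left₀ (norm_nonneg _) (estDist_nonneg s t) two_ne_zero).1
    ((le_add_of_nonneg_left (by positivity)).trans (sqDist_le s t l))

lemma dist_le_estDist (s t : Estimates L) : dist s t ≤ estDist s t := by
  refine (dist_pi_le_iff (estDist_nonneg s t)).2 fun l => ?_
  rw [Prod.dist_eq, Real.dist_eq, dist_eq_norm]
  exact max_le (abs_fst_sub_le s t l) (norm_snd_sub_le s t l)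

lemma estDist_le_of_sqDist_le {c : ℝ} (hc : 0 ≤ c) (h : ∀ l, sqDist (s l) (t l) ≤ c ^ 2) :
    estDist s t ≤ √L * c := by
  rw [estDist_eq, ← Real.sqrt_sq hc, ← Real.sqrt_mul (by positivity)]
  refine Real.sqrt_le_sqrt ((Finset.sum_le_card_nsmul _ _ _ fun l _ => h l).trans ?_)
  simp

lemma eq_of_estDist_eq_zero (h : estDist s t = 0) : s = t :=
  dist_le_zero.1 ((dist_le_estDist s t).trans h.le)

lemma continuous_estDist (t : Estimates L) : Continuous fun s => estDist s t := by
  unfold estDist; fun_prop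

variable (U : Estimates L → Fin L → ℝ × ℂ)

/-- Consecutive updates of the components in a list, each with the newest estimates. -/
def sweepList (l : List (Fin L)) (s : Estimates L) : Estimates L :=
  l.foldl (fun t p => Function.update t p (U t p)) s

lemma sweepList_append_singleton (l : List (Fin L)) (p : Fin L) (s : Estimates L) :
    sweepList U (l ++ [p]) s =
      Function.update (sweepList U l s) p (U (sweepList U l s) p) := by
  simp [sweepList]

variable {U} {K : Set (ℝ × ℂ)}

lemma sweepList_mem (hU : ∀ s, (∀ l, s l ∈ K) → ∀ p, U s p ∈ K) (hs : ∀ l, s l ∈ K)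
    (l : List (Fin L)) : ∀ q, sweepList U l s q ∈ K := by
  induction l using List.reverseRecOn with
  | nil => exact hs
  | append_singleton l p ih =>
    intro q
    rw [sweepList_append_singleton]
    rcases eq_or_ne q p with rfl | hq
    · rw [Function.update_self]; exact hU _ ih _
    · rw [Function.update_of_ne hq]; exact ih q

/-- Invariant of a consecutive sweep: components already visited are within `2 * κ * d`, the others
are untouched. The intermediate squared distance is then at most `(4 * L * κ ^ 2 + 1) * d ^ 2 ≤ (2 *
d) ^ 2`, so the next update again gives `2 * κ * d`. -/
lemma sweepList_lipschitz (hU : ∀ s, (∀ l, s l ∈ K) → ∀ p, U s p ∈ K)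
    (hκ : 0 ≤ κ) (hκL : 4 * L * κ ^ 2 ≤ 3)
    (hlip : ∀ s t, (∀ l, s l ∈ K) → (∀ l, t l ∈ K) → ∀ p,
      sqDist (U s p) (U t p) ≤ (κ * estDist s t) ^ 2)
    (hs : ∀ l, s l ∈ K) (ht : ∀ l, t l ∈ K) (l : List (Fin L)) :
    ∀ q, (q ∈ l → sqDist (sweepList U l s q) (sweepList U l t q) ≤ (2 * κ * estDist s t) ^ 2) ∧
      (q ∉ l → sqDist (sweepList U l s q) (sweepList U l t q) = sqDist (s q) (t q)) := by
  induction l using List.reverseRecOn with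
  | nil => intro q; simp [sweepList]
  | append_singleton l p ih =>
    have hd : estDist (sweepList U l s) (sweepList U l t) ≤ 2 * estDist s t := by
      refine (pow_le_pow_iff_left₀ (estDist_nonneg _ _)
        (mul_nonneg two_pos.le (estDist_nonneg _ _)) two_ne_zero).1 ?_
      rw [estDist_sq]
      have : ∀ q, sqDist (sweepList U l s q) (sweepList U l t q) ≤
          (2 * κ * estDist s t) ^ 2 + sqDist (s q) (t q) := fun q => by
        by_cases hq : q ∈ l
        · exact ((ih q).1 hq).trans (le_add_of_nonneg_right (sqDist_nonneg _ _))
        · rw [(ih q).2 hq]; exact le_add_of_nonneg_left (by positivity)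
      refine (Finset.sum_le_sum fun q _ => this q).trans ?_
      rw [Finset.sum_add_distrib, ← estDist_sq]
      simp only [Finset.sum_const, Finset.card_univ, Fintype.card_fin, nsmul_eq_mul]
      nlinarith [mul_le_mul_of_nonneg_right hκL (sq_nonneg (estDist s t))]
    intro q
    rw [sweepList_append_singleton, sweepList_append_singleton]
    rcases eq_or_ne q p with rfl | hq
    · refine ⟨fun _ => ?_, fun h => absurd (by simp) h⟩
      rw [Function.update_self, Function.update_self]
      refine (hlip _ _ (sweepList_mem hU hs l) (sweepList_mem hU ht l) q).trans ?_
      have := mul_le_mul_of_nonneg_left hd hκ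
      refine pow_le_pow_left₀ (mul_nonneg hκ (estDist_nonneg _ _)) (by linarith) 2
    · rw [Function.update_of_ne hq, Function.update_of_ne hq]
      refine ⟨fun h => (ih q).1 (by simpa [hq] using h), fun h => (ih q).2 fun h' => h (by simp [h'])⟩

lemma sweepList_apply_of_notMem {l : List (Fin L)} {q : Fin L} (hq : q ∉ l) (s : Estimates L) :
    sweepList U l s q = s q := by
  induction l using List.reverseRecOn with
  | nil => rfl
  | append_singleton l p ih =>
    simp only [List.mem_append, List.mem_singleton, not_or] at hq
    rw [sweepList_append_singleton, Function.update_of_ne hq.2, ih hq.1]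

/-- Without repetitions no component is overwritten after its visit. The first update must therefore
be trivial already, and the remaining list starts from the same estimates. Both schedules thus have
the same fixed points. -/
lemma eq_of_sweepList_eq {l : List (Fin L)} (hl : l.Nodup) (h : sweepList U l s = s) :
    ∀ p ∈ l, U s p = s p := by
  induction l with
  | nil => simp
  | cons p l ih =>
    have hp := (List.nodup_cons.1 hl).1
    have h' : sweepList U l (Function.update s p (U s p)) = s := h
    have h1 : U s p = s p := by
      have := congrFun h' p
      rwa [sweepList_apply_of_notMem hp, Function.update_self] at this
    rw [h1, Function.update_eq_self] at h'
    intro q hq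
    rcases List.mem_cons.1 hq with rfl | hq
    · exact h1
    · exact ih (List.nodup_cons.1 hl).2 h' q hq

/-- Contractions for the Euclidean distance have a unique fixed point, which attracts all orbits. -/
lemma exists_fixedPoint {T : Estimates L → Estimates L} {K : Set (Estimates L)} (hK : IsClosed K)
    (h0 : 0 ∈ K) (hT : Set.MapsTo T K K) (hr0 : 0 ≤ r) (hr : r < 1)
    (hlip : ∀ u ∈ K, ∀ v ∈ K, estDist (T u) (T v) ≤ r * estDist u v) :
    ∃ s ∈ K, Tendsto (fun q => T^[q] 0) atTop (𝓝 s) ∧ ∀ u ∈ K, T u = u ↔ u = s := by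
  have hmem : ∀ q, T^[q] 0 ∈ K := fun q => hT.iterate q h0
  have hstep : ∀ q, estDist (T^[q] 0) (T^[q + 1] 0) ≤ estDist 0 (T 0) * r ^ q := fun q => by
    induction q with
    | zero => simp
    | succ q ih =>
      rw [Function.iterate_succ_apply' T (q + 1), Function.iterate_succ_apply' T q]
      rw [Function.iterate_succ_apply' T q] at ih
      refine (hlip _ (hmem q) _ ?_).trans ?_
      · exact hT (hmem q)
      · rw [pow_succ]; nlinarith
  -- Completeness is that of the supremum distance of the type, which `estDist` dominates.
  have hc : CauchySeq fun q => T^[q] 0 :=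
    cauchySeq_of_le_geometric r _ hr fun q => (dist_le_estDist _ _).trans (hstep q)
  obtain ⟨s, hs⟩ := cauchySeq_tendsto_of_complete hc
  have hsK : s ∈ K := hK.mem_of_tendsto hs (Eventually.of_forall hmem)
  have hsd : Tendsto (fun q => estDist (T^[q] 0) s) atTop (𝓝 0) := by
    have := ((continuous_estDist s).tendsto s).comp hs
    rwa [estDist_self] at this
  have hfix : T s = s := by
    have h1 : Tendsto (fun q => T^[q + 1] 0) atTop (𝓝 (T s)) := by
      rw [tendsto_iff_dist_tendsto_zero]
      refine squeeze_zero (fun _ => dist_nonneg) (fun q => (dist_le_estDist _ _).trans ?_)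
        (by simpa using hsd.const_mul r)
      rw [Function.iterate_succ_apply']
      exact hlip _ (hmem q) _ hsK
    exact tendsto_nhds_unique h1 (hs.comp (tendsto_add_atTop_nat 1))
  refine ⟨s, hsK, hs, fun u hu => ⟨fun hu' => ?_, fun h => by rw [h, hfix]⟩⟩
  have h1 := hlip u hu s hsK
  rw [hu', hfix] at h1
  refine eq_of_estDist_eq_zero (le_antisymm ?_ (estDist_nonneg _ _))
  nlinarith [estDist_nonneg u s]

end Sweep

/-! ### The update map as a contraction -/

lemma norm_le_iSup {L : ℕ} (A : Fin L → ℂ) (l : Fin L) : ‖A l‖ ≤ ⨆ k, ‖A k‖ :=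
  le_ciSup (Set.finite_range fun k => ‖A k‖).bddAbove l

section Update

variable {L N : ℕ} {A : Fin L → ℂ} {f : Fin L → ℝ} {w : ℕ → ℂ} {m : Fin L → ℤ}
  {s t : Estimates L} {p : Fin L} {Δ a B τ η X : ℝ}

/-- Bound of the error terms and their variation. -/
def errBound (L N : ℕ) (Δ a B τ : ℝ) : ℝ := τ + L * ((3 + 1 / a) * B * (leakConst Δ / N))

/-- The assumptions under which the update map is studied: `τ` bounds the noise, and the resulting
error terms are small. -/
structure Regime (Δ a B τ : ℝ) (N : ℕ) (A : Fin L → ℂ) (f : Fin L → ℝ) (w : ℕ → ℂ)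
    (m : Fin L → ℤ) : Prop extends Params Δ N f m where
  a_pos : 0 < a
  le_norm : ∀ l, a ≤ ‖A l‖
  norm_le : ∀ l, ‖A l‖ ≤ B
  noiseBound : NoiseBound N w τ
  small : 2000 * errBound L N Δ a B τ ≤ a

lemma update_observed (hN : N ≠ 0) (s : Estimates L) (p : Fin L) :
    update N (observed A f w) m s p =
      (newLoc N (A p) (N * f p) (errTerm N A f w m s p) (m p + (s p).1) - m p,
        perturbedTone N (A p) (N * f p) (errTerm N A f w m s p)
          (newLoc N (A p) (N * f p) (errTerm N A f w m s p) (m p + (s p).1))) := by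
  rw [update, leakFree_observed hN, newResidual_observed hN, ← newResidual_observed hN,
    add_sub_cancel_left]

namespace Regime

variable (h : Regime Δ a B τ N A f w m)
include h

lemma A_pos (l : Fin L) : 0 < ‖A l‖ := h.a_pos.trans_le (h.le_norm l)

lemma B_pos (p : Fin L) : 0 < B := (h.A_pos p).trans_le (h.norm_le p)

lemma ne_zero : N ≠ 0 := by have := h.ge; omega

lemma errBound_le (p : Fin L) : errBound L N Δ a B τ ≤ ‖A p‖ / 80 := by
  have := h.small
  have := h.le_norm p
  have := h.a_pos
  linarith

lemma errTerm_le (hs : ∀ l, |(s l).1| ≤ 3 / 4 ∧ ‖(s l).2‖ ≤ 2 * B) (p : Fin L) {y y' : ℝ}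
    (hy : |y - N * f p| ≤ 2) (hy' : |y' - N * f p| ≤ 2) :
    ‖errTerm N A f w m s p y‖ ≤ errBound L N Δ a B τ ∧
    ‖errTerm N A f w m s p y - errTerm N A f w m s p y'‖ ≤ errBound L N Δ a B τ * |y - y'| := by
  have hB := (h.B_pos p).le
  have hN := h.natCast_pos
  have hc := leakConst_pos h.pos
  have ha := h.a_pos
  have h1 := h.toParams.norm_errTerm_le h.noiseBound hB h.norm_le hs hy hy'
  have h2 : τ + L * (3 * B * (leakConst Δ / N)) ≤ errBound L N Δ a B τ := by
    unfold errBound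
    gcongr
    rw [le_add_iff_nonneg_right]; positivity
  exact ⟨h1.1.trans h2, h1.2.trans (by gcongr)⟩

lemma tau_nonneg (p : Fin L) : 0 ≤ τ := by
  have h1 := h.toParams.noise (p := p) (y := N * f p) (y' := N * f p) h.noiseBound (by simp) (by simp)
  exact (norm_nonneg _).trans h1.1

/-- Since `a ≤ B`, the amplitude-free term `1` in `1 + 2 * B` is at most `1 / a * B`. This is the
origin of `1 / a` in `errBound`. -/
lemma errTerm_sub_le (hs : ∀ l, |(s l).1| ≤ 3 / 4 ∧ ‖(s l).2‖ ≤ 2 * B)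
    (ht : ∀ l, |(t l).1| ≤ 3 / 4 ∧ ‖(t l).2‖ ≤ 2 * B) (p : Fin L) {y : ℝ}
    (hy : |y - N * f p| ≤ 2) :
    ‖errTerm N A f w m s p y - errTerm N A f w m t p y‖ ≤
      errBound L N Δ a B τ * estDist s t := by
  have hB := (h.B_pos p).le
  have hN := h.natCast_pos
  have hc := leakConst_pos h.pos
  have ha := h.a_pos
  have h1 := h.toParams.norm_errTerm_sub_le (A := A) (w := w) hB hs ht
    (fun l => ⟨abs_fst_sub_le s t l, norm_snd_sub_le s t l⟩) (estDist_nonneg s t) hy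
  refine h1.trans (mul_le_mul_of_nonneg_right ?_ (estDist_nonneg s t))
  have h2 : 1 + 2 * B ≤ (3 + 1 / a) * B := by
    have : a ≤ B := (h.le_norm p).trans (h.norm_le p)
    have : 1 ≤ 1 / a * B := by rw [one_div_mul_eq_div, one_le_div ha]; exact this
    linarith
  have h3 := h.tau_nonneg p
  unfold errBound
  have : L * ((1 + 2 * B) * (leakConst Δ / N)) ≤ L * ((3 + 1 / a) * B * (leakConst Δ / N)) := by
    gcongr
  linarith

lemma loc_sub_le (hs : ∀ l, |(s l).1| ≤ 3 / 4 ∧ ‖(s l).2‖ ≤ 2 * B) (p : Fin L) :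
    |(N : ℝ) * f p - (m p + (s p).1)| ≤ 5 / 4 := by
  rw [abs_sub_comm]; exact h.toParams.est (hs p).1

/-- Together with a true residual of at most `1 / 2`, the value `1 / 4` yields the `3 / 4` of the
invariant region. -/
lemma newLoc_sub_le (hs : ∀ l, |(s l).1| ≤ 3 / 4 ∧ ‖(s l).2‖ ≤ 2 * B) (p : Fin L) :
    |newLoc N (A p) (N * f p) (errTerm N A f w m s p) (m p + (s p).1) - N * f p| ≤ 1 / 4 := by
  have h1 := abs_newLoc_sub_le h.ge (h.A_pos p) (h.loc_sub_le hs p)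
    (fun y hy => (h.errTerm_le hs p hy hy).1) (h.errBound_le p)
  have h2 := h.small
  have h3 := h.le_norm p
  have h4 := h.A_pos p
  by_contra! hlt
  nlinarith

lemma update_error_le (hs : ∀ l, |(s l).1| ≤ 3 / 4 ∧ ‖(s l).2‖ ≤ 2 * B) (p : Fin L)
    (hE : ∀ y, |y - N * f p| ≤ 2 → ‖errTerm N A f w m s p y‖ ≤ η) :
    ‖A p‖ * |m p + (update N (observed A f w) m s p).1 - N * f p| ≤ 300 * η ∧
      ‖(update N (observed A f w) m s p).2 - A p‖ ≤ 2000 * η := by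
  -- The given `η` need not satisfy the smallness required by the one-tone step; its minimum with
  -- `errBound` does.
  have hE' : ∀ y, |y - N * f p| ≤ 2 → ‖errTerm N A f w m s p y‖ ≤ min η (errBound L N Δ a B τ) :=
    fun y hy => le_min (hE y hy) (h.errTerm_le hs p hy hy).1
  have hm : min η (errBound L N Δ a B τ) ≤ ‖A p‖ / 80 := (min_le_right _ _).trans (h.errBound_le p)
  have hloc := h.newLoc_sub_le hs p
  have h1 := abs_newLoc_sub_le h.ge (h.A_pos p) (h.loc_sub_le hs p) hE' hm
  have h2 := norm_perturbedTone_newLoc_sub_le h.ge (h.A_pos p) (h.loc_sub_le hs p) hE' hm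
    (hloc.trans (by norm_num))
  rw [update_observed h.ne_zero]
  simp only [add_sub_cancel]
  have := min_le_left η (errBound L N Δ a B τ)
  exact ⟨by linarith, by linarith⟩

/-- The amplitude error is at most `2000 * errBound ≤ a ≤ ‖A p‖ ≤ B`, so the new amplitude stays
below `2 * B`. -/
lemma update_mem (hs : ∀ l, |(s l).1| ≤ 3 / 4 ∧ ‖(s l).2‖ ≤ 2 * B) (p : Fin L) :
    |(update N (observed A f w) m s p).1| ≤ 3 / 4 ∧
      ‖(update N (observed A f w) m s p).2‖ ≤ 2 * B := by
  have h1 := (h.update_error_le hs p fun y hy => (h.errTerm_le hs p hy hy).1).2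
  have h2 := h.newLoc_sub_le hs p
  have h3 := h.bin p
  constructor
  · rw [update_observed h.ne_zero]
    rw [abs_le] at *
    constructor <;> linarith
  · have := norm_sub_norm_le (update N (observed A f w) m s p).2 (A p)
    have := h.small
    have := h.norm_le p
    have := h.le_norm p
    linarith

lemma update_lipschitz (hs : ∀ l, |(s l).1| ≤ 3 / 4 ∧ ‖(s l).2‖ ≤ 2 * B)
    (ht : ∀ l, |(t l).1| ≤ 3 / 4 ∧ ‖(t l).2‖ ≤ 2 * B) (p : Fin L) :
    sqDist (update N (observed A f w) m s p) (update N (observed A f w) m t p) ≤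
      ((160000 / a + 1100000) * errBound L N Δ a B τ * estDist s t) ^ 2 := by
  have hη0 : 0 ≤ errBound L N Δ a B τ := (norm_nonneg _).trans
    (h.errTerm_le hs p (y := N * f p) (y' := N * f p) (by simp) (by simp)).1
  have hd0 := estDist_nonneg s t
  have ha := h.a_pos
  have hlip := fun y y' (hy : |y - N * f p| ≤ 2) (hy' : |y' - N * f p| ≤ 2) =>
    (h.errTerm_le hs p hy hy').2
  have h1 := abs_newLoc_sub_newLoc_le h.ge (h.A_pos p) (h.loc_sub_le hs p) (h.loc_sub_le ht p)
    (fun y hy => (h.errTerm_le hs p hy hy).1) (fun y hy => (h.errTerm_le ht p hy hy).1)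
    (h.errBound_le p) hlip (fun y hy => h.errTerm_sub_le hs ht p hy)
    (by rw [add_sub_add_left_eq_sub]; exact abs_fst_sub_le s t p)
  have h2 := norm_perturbedTone_sub_le (N := N) (h.errBound_le p) hη0 hd0
    ((h.newLoc_sub_le hs p).trans (by norm_num)) ((h.newLoc_sub_le ht p).trans (by norm_num))
    hlip (fun y hy => h.errTerm_sub_le hs ht p hy) h1
  rw [update_observed h.ne_zero, update_observed h.ne_zero, sqDist]
  simp only [sub_sub_sub_cancel_right]
  set η := errBound L N Δ a B τ
  set d := estDist s t
  have h3 : |newLoc N (A p) (N * f p) (errTerm N A f w m s p) (m p + (s p).1) -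
      newLoc N (A p) (N * f p) (errTerm N A f w m t p) (m p + (t p).1)| ≤ 160000 / a * η * d := by
    rw [div_mul_eq_mul_div, div_mul_eq_mul_div, le_div_iff₀ ha]
    have := mul_le_mul_of_nonneg_right (h.le_norm p) (abs_nonneg
      (newLoc N (A p) (N * f p) (errTerm N A f w m s p) (m p + (s p).1) -
      newLoc N (A p) (N * f p) (errTerm N A f w m t p) (m p + (t p).1)))
    linarith
  rw [← sq_abs]
  have h4 : 0 ≤ 160000 / a * η * d := by positivity
  have h5 : 0 ≤ 1100000 * η * d := by positivity
  have h6 := pow_le_pow_left₀ (abs_nonneg _) h3 2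
  have h7 := pow_le_pow_left₀ (norm_nonneg _) h2 2
  calc _ ≤ (160000 / a * η * d) ^ 2 + (1100000 * η * d) ^ 2 := add_le_add h6 h7
    _ ≤ (160000 / a * η * d + 1100000 * η * d) ^ 2 := by nlinarith
    _ = _ := by ring

end Regime

end Update

section Contraction

variable {L N : ℕ} {A : Fin L → ℂ} {f : Fin L → ℝ} {w : ℕ → ℂ} {m : Fin L → ℤ}
  {s t : Estimates L} {Δ a τ r : ℝ}

lemma sweep_sequential (N : ℕ) (x : ℕ → ℂ) (m : Fin L → ℤ) (s : Estimates L) :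
    sweep .sequential N x m s = sweepList (update N x m) (List.finRange L) s := rfl

lemma update_eq_of_sweep_eq {sch : Schedule} {x : ℕ → ℂ} (h : sweep sch N x m s = s) (p : Fin L) :
    update N x m s p = s p := by
  cases sch with
  | simultaneous => exact congrFun h p
  | sequential => exact eq_of_sweepList_eq (List.nodup_finRange L) h p (List.mem_finRange p)

lemma isClosed_region (A : Fin L → ℂ) : IsClosed (region A) := by
  simp only [region, Set.ofPred_forall, Set.ofPred_and]
  refine isClosed_iInter fun l => IsClosed.inter ?_ ?_
  · exact isClosed_le (by fun_prop) continuous_const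
  · exact isClosed_le (by fun_prop) continuous_const

lemma Regime.sweep_contraction (h : Regime Δ a (⨆ k, ‖A k‖) τ N A f w m) (sch : Schedule)
    (hr : √L * (2 * ((160000 / a + 1100000) * errBound L N Δ a (⨆ k, ‖A k‖) τ)) ≤ r)
    (hr1 : r < 1) :
    Set.MapsTo (sweep sch N (observed A f w) m) (region A) (region A) ∧
    ∀ u ∈ region A, ∀ v ∈ region A, estDist (sweep sch N (observed A f w) m u)
      (sweep sch N (observed A f w) m v) ≤ r * estDist u v := by
  set B := ⨆ k, ‖A k‖ with hB
  set κ := (160000 / a + 1100000) * errBound L N Δ a B τ with hκ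
  set K : Set (ℝ × ℂ) := {x | |x.1| ≤ 3 / 4 ∧ ‖x.2‖ ≤ 2 * B} with hK
  have hU : ∀ s, (∀ l, s l ∈ K) → ∀ p, update N (observed A f w) m s p ∈ K :=
    fun s hs p => h.update_mem hs p
  have hlip : ∀ s t, (∀ l, s l ∈ K) → (∀ l, t l ∈ K) → ∀ p,
      sqDist (update N (observed A f w) m s p) (update N (observed A f w) m t p) ≤
        (κ * estDist s t) ^ 2 := fun s t hs ht p => h.update_lipschitz hs ht p
  rcases Nat.eq_zero_or_pos L with rfl | hL
  · refine ⟨fun s _ l => l.elim0, fun u _ v _ => ?_⟩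
    have : ∀ u v : Estimates 0, estDist u v = 0 := fun u v => by simp [estDist]
    rw [this, this]; simp
  have hκ0 : 0 ≤ κ := by
    have p : Fin L := ⟨0, hL⟩
    have ha := h.a_pos
    have hη0 : 0 ≤ errBound L N Δ a B τ := (norm_nonneg _).trans
      (h.errTerm_le (s := 0) (fun l => ⟨by simp; norm_num, by simpa using (h.B_pos p).le⟩) p
        (y := N * f p) (y' := N * f p) (by simp) (by simp)).1
    positivity
  cases sch with
  | simultaneous =>
    refine ⟨fun s hs p => hU s hs p, fun u hu v hv => ?_⟩
    refine (estDist_le_of_sqDist_le (mul_nonneg hκ0 (estDist_nonneg u v))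
      fun p => hlip u v hu hv p).trans ?_
    rw [← mul_assoc]
    refine mul_le_mul_of_nonneg_right (le_trans ?_ hr) (estDist_nonneg _ _)
    gcongr
    linarith
  | sequential =>
    -- The factor `2` in the rate, superfluous for simultaneous updates, makes the hypothesis of the
    -- consecutive sweep a consequence of `r < 1`.
    have hκL : 4 * L * κ ^ 2 ≤ 3 := by
      have h1 : √L * (2 * κ) < 1 := hr.trans_lt hr1
      have h2 : (√L * (2 * κ)) ^ 2 ≤ 1 := pow_le_one₀ (by positivity) h1.le
      rw [mul_pow, Real.sq_sqrt (by positivity)] at h2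
      nlinarith
    refine ⟨fun s hs => sweepList_mem hU hs _, fun u hu v hv => ?_⟩
    have h1 := sweepList_lipschitz hU hκ0 hκL hlip hu hv (List.finRange L)
    refine (estDist_le_of_sqDist_le (mul_nonneg (by positivity) (estDist_nonneg u v))
      fun p => (h1 p).1 (List.mem_finRange p)).trans ?_
    rw [← mul_assoc]
    exact mul_le_mul_of_nonneg_right hr (estDist_nonneg _ _)

end Contraction

/-! ### The fixed point -/

lemma norm_cis_coeff_sub_linear_le {N : ℕ} (hN : 22 ≤ N) {x : ℝ} (hx : |x| ≤ 7 / 4) :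
    ‖(N : ℂ) * (cis (x / N) - 1) - 2 * Real.pi * Complex.I * x‖ ≤ 125 / N := by
  have hN0 : (N : ℂ) ≠ 0 := by exact_mod_cast (by omega : N ≠ 0)
  have hN22 : (22 : ℝ) ≤ N := by exact_mod_cast hN
  have hpi := Real.pi_lt_d4
  have hpi0 := Real.pi_pos
  set z : ℂ := 2 * Real.pi * Complex.I * (x / N : ℝ) with hz
  have hzn : ‖z‖ = 2 * Real.pi * |x| / N := by
    rw [hz, norm_mul, norm_mul, norm_mul, Complex.norm_I, Complex.norm_real, Complex.norm_real,
      Real.norm_eq_abs, Real.norm_eq_abs, abs_div, Nat.abs_cast, abs_of_pos hpi0, Complex.norm_two]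
    ring
  have hz11 : 2 * Real.pi * |x| ≤ 11 := by nlinarith [abs_nonneg x]
  have hz1 : ‖z‖ ≤ 1 := by rw [hzn, div_le_one (by linarith)]; linarith
  have h := Complex.norm_exp_sub_one_sub_id_le hz1
  have : (N : ℂ) * (cis (x / N) - 1) - 2 * Real.pi * Complex.I * x =
      N * (Complex.exp z - 1 - z) := by
    have : (2 * Real.pi * Complex.I * x : ℂ) = N * z := by rw [hz]; push_cast; field_simp
    rw [this, cis, ← hz]; ring
  rw [this, norm_mul, Complex.norm_natCast]
  refine (mul_le_mul_of_nonneg_left h (Nat.cast_nonneg N)).trans ?_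
  rw [hzn, div_pow, le_div_iff₀ (by linarith)]
  have h2 : (2 * Real.pi * |x|) ^ 2 ≤ 125 := by nlinarith [abs_nonneg x, mul_nonneg hpi0.le (abs_nonneg x)]
  refine le_trans (le_of_eq ?_) h2
  field_simp

/-- At `e = 0` and for large `N` the two coefficients of the numerator tend to `∓ π i` and the
denominator to `-(4 i / π) A`. Their quotient is the factor `π ^ 2 / 4`. The hypothesis `heη` makes
the displacement `e` as small as the errors, so every correction is of second order or has a factor
`1 / N`. -/
lemma norm_interpErr_sub_linear_le {N : ℕ} {A : ℂ} {e η : ℝ} {Ep Em : ℂ} (hN : 22 ≤ N)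
    (hA : 0 < ‖A‖) (he : |e| ≤ 5 / 4) (hp : ‖Ep‖ ≤ η) (hm : ‖Em‖ ≤ η) (hη : η ≤ ‖A‖ / 80)
    (heη : ‖A‖ * |e| ≤ 300 * η) :
    ‖interpErr N A e Ep Em - Real.pi ^ 2 / 4 * ((Ep + Em) / A)‖ ≤
      η / ‖A‖ * (4000000 * (η / ‖A‖) + 3000 / N) := by
  have hN0 : N ≠ 0 := by omega
  have hN' : (0 : ℝ) < N := by exact_mod_cast Nat.pos_of_ne_zero hN0
  have hη0 : 0 ≤ η := (norm_nonneg _).trans hp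
  have hpi0 := Real.pi_pos
  have hpic : (Real.pi : ℂ) ≠ 0 := by exact_mod_cast hpi0.ne'
  have hAne : A ≠ 0 := norm_pos_iff.1 hA
  have hR := norm_interpErr_le (N := N) (by omega) hA he hp hm hη
  have hD := le_norm_interpDen (N := N) (by omega) he hp hm hη
  have hDne : interpDen N A e Ep Em ≠ 0 := norm_pos_iff.1 (by linarith)
  set R := interpErr N A e Ep Em with hRdef
  set D := interpDen N A e Ep Em with hDdef
  set am := (N : ℂ) * (cis ((e - 1 / 2) / N) - 1) with ham
  set ap := (N : ℂ) * (cis ((e + 1 / 2) / N) - 1) with hap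
  have hRD : R * D = am * Ep - ap * Em := by
    rw [hRdef, interpErr, ← hDdef, div_mul_cancel₀ _ hDne]
  obtain ⟨x1, x2⟩ := abs_half_le he
  have a1 := norm_cis_coeff_sub_linear_le hN x1
  have a2 := norm_cis_coeff_sub_linear_le hN x2
  rw [← ham] at a1
  rw [← hap] at a2
  have hlin : ‖(2 * Real.pi * Complex.I * e : ℂ)‖ ≤ 7 * |e| := by
    rw [norm_mul, norm_mul, norm_mul, Complex.norm_I, Complex.norm_real, Complex.norm_real,
      Real.norm_eq_abs, Real.norm_eq_abs, abs_of_pos hpi0, Complex.norm_two]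
    nlinarith [Real.pi_lt_d2, abs_nonneg e]
  have b1 : ‖am + Real.pi * Complex.I‖ ≤ 125 / N + 7 * |e| := by
    have : am + Real.pi * Complex.I =
      (am - 2 * Real.pi * Complex.I * (e - 1 / 2 : ℝ)) + 2 * Real.pi * Complex.I * e := by
      push_cast; ring
    rw [this]
    exact (norm_add_le _ _).trans (add_le_add a1 hlin)
  have b2 : ‖ap - Real.pi * Complex.I‖ ≤ 125 / N + 7 * |e| := by
    have : ap - Real.pi * Complex.I =
      (ap - 2 * Real.pi * Complex.I * (e + 1 / 2 : ℝ)) + 2 * Real.pi * Complex.I * e := by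
      push_cast; ring
    rw [this]
    exact (norm_add_le _ _).trans (add_le_add a2 hlin)
  have hM : ‖R * D + Real.pi * Complex.I * (Ep + Em)‖ ≤ 2 * η * (125 / N + 7 * |e|) := by
    have : R * D + Real.pi * Complex.I * (Ep + Em) =
      (am + Real.pi * Complex.I) * Ep - (ap - Real.pi * Complex.I) * Em := by rw [hRD]; ring
    rw [this]
    refine (norm_sub_le _ _).trans ?_
    rw [norm_mul, norm_mul]
    have c1 := mul_le_mul b1 hp (norm_nonneg _) (by positivity)
    have c2 := mul_le_mul b2 hm (norm_nonneg _) (by positivity)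
    linarith
  have hDD : ‖D + 4 * Complex.I / Real.pi * A‖ ≤ ‖A‖ * (13 * |e| + 2 / N) + 2 * η := by
    have : D + 4 * Complex.I / Real.pi * A =
      A * ((gap N e - gap N 0) + (gap N 0 - -(4 * Complex.I / Real.pi))) + (Ep - Em) := by
      rw [hDdef, interpDen]; ring
    rw [this]
    refine (norm_add_le _ _).trans ?_
    rw [norm_mul]
    have g1 := norm_gap_sub_le N e 0
    have g2 := norm_gap_zero_sub_le (N := N) (by omega)
    have g3 := norm_add_le (gap N e - gap N 0) (gap N 0 - -(4 * Complex.I / Real.pi))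
    have g4 := norm_sub_le Ep Em
    rw [sub_zero] at g1
    have g5 : 4 * Real.pi * |e| ≤ 13 * |e| := by nlinarith [Real.pi_lt_d2, abs_nonneg e]
    have g6 : ‖gap N e - gap N 0 + (gap N 0 - -(4 * Complex.I / Real.pi))‖ ≤ 13 * |e| + 2 / N := by
      linarith
    have := mul_le_mul_of_nonneg_left g6 hA.le
    linarith
  have key : (R - Real.pi ^ 2 / 4 * ((Ep + Em) / A)) * (4 * Complex.I / Real.pi * A) =
      R * (D + 4 * Complex.I / Real.pi * A) - (R * D + Real.pi * Complex.I * (Ep + Em)) := by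
    field_simp
    ring
  have hK : ‖A‖ ≤ ‖4 * Complex.I / Real.pi * A‖ := by
    rw [norm_mul, norm_div, norm_mul, Complex.norm_I, Complex.norm_real, Real.norm_eq_abs,
      abs_of_pos hpi0]
    have : (1 : ℝ) ≤ ‖(4 : ℂ)‖ * 1 / Real.pi := by
      rw [le_div_iff₀ hpi0]
      norm_num
      linarith [Real.pi_lt_d2]
    nlinarith
  have h1 := congrArg norm key
  rw [norm_mul] at h1
  have h2 := norm_sub_le (R * (D + 4 * Complex.I / Real.pi * A))
    (R * D + Real.pi * Complex.I * (Ep + Em))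
  rw [norm_mul R] at h2
  have h3 := mul_le_mul hR hDD (norm_nonneg _) (by positivity)
  set ρ := η / ‖A‖ with hρ
  have hρ0 : 0 ≤ ρ := by positivity
  have heρ : |e| ≤ 300 * ρ := by
    rw [hρ, ← mul_div_assoc, le_div_iff₀ hA]; linarith
  have hηρ : η = ρ * ‖A‖ := by rw [hρ]; field_simp
  have h4 := mul_le_mul_of_nonneg_left hK (norm_nonneg (R - Real.pi ^ 2 / 4 * ((Ep + Em) / A)))
  refine le_of_mul_le_mul_right (a := ‖A‖) ?_ hA
  have h5 : 880 * η / ‖A‖ = 880 * ρ := by rw [hρ]; ring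
  rw [h5] at h3
  have h6 : 880 * ρ * (‖A‖ * (13 * |e| + 2 / N) + 2 * η) ≤
      880 * ρ * (‖A‖ * (13 * (300 * ρ) + 2 / N) + 2 * η) := by gcongr
  have h7 : 2 * η * (125 / N + 7 * |e|) ≤ 2 * η * (125 / N + 7 * (300 * ρ)) := by gcongr
  have h8 : 880 * ρ * (‖A‖ * (13 * (300 * ρ) + 2 / N) + 2 * η) + 2 * η * (125 / N + 7 * (300 * ρ)) ≤
      ρ * (4000000 * ρ + 3000 / N) * ‖A‖ := by
    rw [hηρ]
    have p1 : 0 ≤ ρ * ρ * ‖A‖ := by positivity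
    have p2 : 0 ≤ ρ * ‖A‖ / N := by positivity
    have e1 : 880 * ρ * (‖A‖ * (13 * (300 * ρ) + 2 / N) + 2 * (ρ * ‖A‖)) +
        2 * (ρ * ‖A‖) * (125 / N + 7 * (300 * ρ)) =
        3437960 * (ρ * ρ * ‖A‖) + 2010 * (ρ * ‖A‖ / N) := by ring
    have e2 : ρ * (4000000 * ρ + 3000 / N) * ‖A‖ =
        4000000 * (ρ * ρ * ‖A‖) + 3000 * (ρ * ‖A‖ / N) := by ring
    rw [e1, e2]; linarith
  linarith

section FixedPoint

variable {L N : ℕ} {A : Fin L → ℂ} {f : Fin L → ℝ} {w : ℕ → ℂ} {m : Fin L → ℤ}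
  {s : Estimates L} {p : Fin L} {Δ a B τ : ℝ}

/-- At the fixed point the errors are of the order of the noise. -/
lemma Regime.fixedPoint_error_le (h : Regime Δ a B τ N A f w m)
    (hs : ∀ l, |(s l).1| ≤ 3 / 4 ∧ ‖(s l).2‖ ≤ 2 * B)
    (hfix : ∀ l, update N (observed A f w) m s l = s l)
    (hN : 4600 * (L * leakConst Δ) ≤ N) (l : Fin L) :
    ‖A l‖ * |m l + (s l).1 - N * f l| + ‖(s l).2 - A l‖ ≤ 4600 * τ := by
  have hN' := h.natCast_pos
  have : Nonempty (Fin L) := ⟨l⟩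
  -- For the worst component, the bound of one update reads `X ≤ 2300 * (τ + L * c / N * X)`, where
  -- `2300 = 300 + 2000` collects location and amplitude. For large `N` half of `X` absorbs the last
  -- term.
  obtain ⟨q, hq⟩ := Finite.exists_max
    (fun l => ‖A l‖ * |m l + (s l).1 - N * f l| + ‖(s l).2 - A l‖)
  set X := ‖A q‖ * |m q + (s q).1 - N * f q| + ‖(s q).2 - A q‖ with hX
  have hX0 : 0 ≤ X := by positivity
  have hE : ∀ y, |y - N * f q| ≤ 2 → ‖errTerm N A f w m s q y‖ ≤ τ + L * (leakConst Δ / N * X) :=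
    fun y hy => by
      have h1 := h.toParams.norm_errTerm_sub_noise_le (fun l => (hs l).1) hX0 hq (w := w) hy
      have h2 := (h.toParams.noise h.noiseBound hy hy).1
      have h3 := norm_add_le (errTerm N A f w m s q y - fourierCoeffAt N w y) (fourierCoeffAt N w y)
      rw [sub_add_cancel] at h3
      linarith
  have h1 := h.update_error_le hs q hE
  rw [hfix] at h1
  have h2 : X ≤ 2300 * (τ + L * (leakConst Δ / N * X)) := by linarith [h1.1, h1.2]
  have h3 : 2300 * (L * (leakConst Δ / N * X)) ≤ X / 2 := by
    have : 2300 * (L * (leakConst Δ / N * X)) = (4600 * (L * leakConst Δ)) * X / (2 * N) := by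
      field_simp; ring
    rw [this, div_le_iff₀ (by positivity)]
    nlinarith
  have := hq l
  linarith

-- Three replacements, each with an error of order `ρ * (ρ + 1 / N)` for `ρ = τ / ‖A p‖`: the
-- logarithm by its argument, `R` by its linear part, and the error term at the estimated location
-- by the bare noise at the true one. The fixed point enters through the displacement `e`, which is
-- itself `O(ρ)`.
set_option maxHeartbeats 1000000 in
lemma Regime.fixedPoint_linearization (h : Regime Δ a B τ N A f w m)
    (hs : ∀ l, |(s l).1| ≤ 3 / 4 ∧ ‖(s l).2‖ ≤ 2 * B)
    (hfix : ∀ l, update N (observed A f w) m s l = s l)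
    (hN : 4600 * (L * leakConst Δ) ≤ N) (p : Fin L) :
    ‖A p‖ * |m p + (s p).1 - N * f p + Real.pi / 8 * ((fourierCoeffAt N w (N * f p + 1 / 2) +
      fourierCoeffAt N w (N * f p - 1 / 2)) / A p).im| ≤
      τ * (10000000 * τ / a + (2000 + 10000 * (L * leakConst Δ)) / N) := by
  have hN' := h.natCast_pos
  have hN0 := h.ne_zero
  have hA := h.A_pos p
  have hτ := h.tau_nonneg p
  have ha := h.a_pos
  have hpi0 := Real.pi_pos
  have hc := leakConst_pos h.pos
  have hX := h.fixedPoint_error_le hs hfix hN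
  have hleak : ∀ y, |y - N * f p| ≤ 2 → ‖errTerm N A f w m s p y - fourierCoeffAt N w y‖ ≤
      L * (leakConst Δ / N * (4600 * τ)) := fun y hy =>
    h.toParams.norm_errTerm_sub_noise_le (fun l => (hs l).1) (by positivity) hX hy
  have hleak1 : L * (leakConst Δ / N * (4600 * τ)) ≤ τ := by
    have : L * (leakConst Δ / N * (4600 * τ)) = (4600 * (L * leakConst Δ)) * τ / N := by field_simp
    rw [this, div_le_iff₀ hN']; nlinarith
  have hE : ∀ y, |y - N * f p| ≤ 2 → ‖errTerm N A f w m s p y‖ ≤ 2 * τ := fun y hy => by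
    have h2 := (h.toParams.noise h.noiseBound hy hy).1
    have h3 := norm_add_le (errTerm N A f w m s p y - fourierCoeffAt N w y) (fourierCoeffAt N w y)
    rw [sub_add_cancel] at h3
    linarith [hleak y hy]
  have hτa : 2 * τ ≤ ‖A p‖ / 80 := by
    have h1 : τ ≤ errBound L N Δ a B τ := by
      have := h.B_pos p
      unfold errBound
      rw [le_add_iff_nonneg_right]; positivity
    have := h.small
    have := h.le_norm p
    linarith
  set u : ℝ := m p + (s p).1 with hu
  set y₀ : ℝ := N * f p with hy₀
  set E := errTerm N A f w m s p with hEdef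
  have hloc : |y₀ - u| ≤ 5 / 4 := h.loc_sub_le hs p
  obtain ⟨x1, x2⟩ := abs_add_half_sub_le hloc
  have hloceq : newLoc N (A p) y₀ E u = u := by
    have := congrArg Prod.fst (hfix p)
    rw [update_observed hN0] at this
    simp only at this
    rw [hu]; linarith
  have heq := newLoc_eq h.ge hA hloc hE hτa
  rw [hloceq] at heq
  have hAe := abs_newLoc_sub_le h.ge hA hloc hE hτa
  rw [hloceq, abs_sub_comm] at hAe
  set e := y₀ - u with he
  have hlin := norm_interpErr_sub_linear_le h.ge hA hloc (hE _ x1) (hE _ x2) hτa hAe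
  have hR := norm_interpErr_le (N := N) (by have := h.ge; omega) hA hloc (hE _ x1) (hE _ x2) hτa
  have hR2 := norm_interpErr_div_le h.ge hA hloc hE hτa
  set R := interpErr N (A p) e (E (u + 1 / 2)) (E (u - 1 / 2)) with hRdef
  have hlog : ‖Complex.log (1 + R / N) - R / N‖ ≤ ‖R / N‖ ^ 2 := by
    have := Complex.norm_log_one_add_sub_self_le (z := R / N) (by linarith)
    refine this.trans ?_
    have h3 : (1 - ‖R / N‖)⁻¹ ≤ 2 := by
      rw [inv_le_comm₀ (by linarith) two_pos]; linarith
    nlinarith [sq_nonneg ‖R / N‖]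
  have hA' : 0 < ‖A p‖ := hA
  set ρ := τ / ‖A p‖ with hρ
  have hρ0 : 0 ≤ ρ := by positivity
  have hρa : ρ ≤ τ / a := by rw [hρ]; gcongr; exact h.le_norm p
  have hτρ : τ = ρ * ‖A p‖ := by rw [hρ]; field_simp
  have hRρ : ‖R‖ ≤ 1760 * ρ := by
    refine hR.trans (le_of_eq ?_); rw [hρ]; ring
  have heρ : |e| ≤ 600 * ρ := by
    rw [hρ, ← mul_div_assoc, le_div_iff₀ hA]; linarith
  have hρ1 : ρ ≤ 1 / 160 := by
    rw [hρ, div_le_iff₀ hA]; linarith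
  have s1 : |e - 1 / (2 * Real.pi) * R.im| ≤ 500000 * ρ ^ 2 := by
    have i1 := Complex.abs_im_le_norm (Complex.log (1 + R / N) - R / N)
    rw [Complex.sub_im, Complex.div_natCast_im] at i1
    have : e - 1 / (2 * Real.pi) * R.im =
        N / (2 * Real.pi) * ((Complex.log (1 + R / N)).im - R.im / N) := by
      have : e = N / (2 * Real.pi) * (Complex.log (1 + R / N)).im := by rw [he]; linarith
      rw [this]; field_simp
    rw [this, abs_mul, abs_of_pos (by positivity)]
    -- The quadratic remainder of the logarithm is of order `(ρ / N) ^ 2`; after multiplication by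
    -- `N` it is even smaller than needed.
    have i2 : ‖R / N‖ ^ 2 ≤ (1760 * ρ) ^ 2 / N ^ 2 := by
      rw [norm_div, Complex.norm_natCast, div_pow]; gcongr
    refine (mul_le_mul_of_nonneg_left ((i1.trans hlog).trans i2) (by positivity)).trans ?_
    have : N / (2 * Real.pi) * ((1760 * ρ) ^ 2 / N ^ 2) = 1760 ^ 2 * ρ ^ 2 / (2 * Real.pi * N) := by
      field_simp
    rw [this, div_le_iff₀ (by positivity)]
    have hN22 : (22 : ℝ) ≤ N := by exact_mod_cast h.ge
    have : (132 : ℝ) ≤ 2 * Real.pi * N := by nlinarith [Real.pi_gt_three]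
    have := mul_le_mul_of_nonneg_left this (by positivity : 0 ≤ 500000 * ρ ^ 2)
    linarith [sq_nonneg ρ]
  have s2 : |1 / (2 * Real.pi) * R.im - Real.pi / 8 * ((E (u + 1 / 2) + E (u - 1 / 2)) / A p).im| ≤
      2 * ρ * (8000000 * ρ + 3000 / N) / (2 * Real.pi) := by
    have i1 := Complex.abs_im_le_norm
      (R - Real.pi ^ 2 / 4 * ((E (u + 1 / 2) + E (u - 1 / 2)) / A p))
    have i2 : (R - Real.pi ^ 2 / 4 * ((E (u + 1 / 2) + E (u - 1 / 2)) / A p)).im =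
        R.im - Real.pi ^ 2 / 4 * ((E (u + 1 / 2) + E (u - 1 / 2)) / A p).im := by
      rw [Complex.sub_im, show (Real.pi : ℂ) ^ 2 / 4 = ((Real.pi ^ 2 / 4 : ℝ) : ℂ) by push_cast; ring,
        Complex.im_ofReal_mul]
    rw [i2] at i1
    have i3 : 1 / (2 * Real.pi) * R.im - Real.pi / 8 * ((E (u + 1 / 2) + E (u - 1 / 2)) / A p).im =
        (R.im - Real.pi ^ 2 / 4 * ((E (u + 1 / 2) + E (u - 1 / 2)) / A p).im) / (2 * Real.pi) := by
      field_simp; ring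
    rw [i3, abs_div, abs_of_pos (by positivity : 0 < 2 * Real.pi)]
    gcongr
    refine (i1.trans hlin).trans (le_of_eq ?_)
    rw [hρ]; ring
  -- The first term is the leakage left at the fixed point; the second moves the noise transform
  -- from `u` to `y₀`, using that its Lipschitz constant is `τ` as well.
  have s3 : ‖(E (u + 1 / 2) + E (u - 1 / 2)) -
      (fourierCoeffAt N w (y₀ + 1 / 2) + fourierCoeffAt N w (y₀ - 1 / 2))‖ ≤
      2 * (L * (leakConst Δ / N * (4600 * τ)) + τ * |e|) := by
    have n1 := (h.toParams.noise h.noiseBound (p := p) (y := u + 1 / 2) (y' := y₀ + 1 / 2) x1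
      (by rw [← hy₀, add_sub_cancel_left]; norm_num)).2
    have n2 := (h.toParams.noise h.noiseBound (p := p) (y := u - 1 / 2) (y' := y₀ - 1 / 2) x2
      (by rw [← hy₀, sub_sub_cancel_left]; norm_num)).2
    rw [show |u + 1 / 2 - (y₀ + 1 / 2)| = |e| by rw [he, abs_sub_comm]; congr 1; ring] at n1
    rw [show |u - 1 / 2 - (y₀ - 1 / 2)| = |e| by rw [he, abs_sub_comm]; congr 1; ring] at n2
    have l1 := hleak _ x1
    have l2 := hleak _ x2
    have : (E (u + 1 / 2) + E (u - 1 / 2)) -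
      (fourierCoeffAt N w (y₀ + 1 / 2) + fourierCoeffAt N w (y₀ - 1 / 2)) =
      ((E (u + 1 / 2) - fourierCoeffAt N w (u + 1 / 2)) +
        (fourierCoeffAt N w (u + 1 / 2) - fourierCoeffAt N w (y₀ + 1 / 2))) +
      ((E (u - 1 / 2) - fourierCoeffAt N w (u - 1 / 2)) +
        (fourierCoeffAt N w (u - 1 / 2) - fourierCoeffAt N w (y₀ - 1 / 2))) := by ring
    rw [this]
    refine (norm_add_le _ _).trans ?_
    have := norm_add_le (E (u + 1 / 2) - fourierCoeffAt N w (u + 1 / 2))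
        (fourierCoeffAt N w (u + 1 / 2) - fourierCoeffAt N w (y₀ + 1 / 2))
    have := norm_add_le (E (u - 1 / 2) - fourierCoeffAt N w (u - 1 / 2))
        (fourierCoeffAt N w (u - 1 / 2) - fourierCoeffAt N w (y₀ - 1 / 2))
    linarith
  have s4 : |Real.pi / 8 * ((E (u + 1 / 2) + E (u - 1 / 2)) / A p).im -
      Real.pi / 8 * ((fourierCoeffAt N w (y₀ + 1 / 2) + fourierCoeffAt N w (y₀ - 1 / 2)) / A p).im| ≤
      L * leakConst Δ * 4600 * ρ / N + 600 * ρ ^ 2 := by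
    rw [← mul_sub, ← Complex.sub_im, ← sub_div, abs_mul, abs_of_pos (by positivity)]
    refine (mul_le_mul_of_nonneg_left (Complex.abs_im_le_norm _) (by positivity)).trans ?_
    rw [norm_div]
    have h4 : Real.pi / 8 ≤ 1 / 2 := by linarith [Real.pi_le_four]
    refine (mul_le_mul h4 (div_le_div_of_nonneg_right s3 hA.le) (by positivity) (by norm_num)).trans ?_
    have e1 : 1 / 2 * (2 * (L * (leakConst Δ / N * (4600 * τ)) + τ * |e|) / ‖A p‖) =
        L * leakConst Δ * 4600 * ρ / N + ρ * |e| := by rw [hρ]; field_simp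
    rw [e1]
    nlinarith
  have s5 : |u - y₀ + Real.pi / 8 *
      ((fourierCoeffAt N w (y₀ + 1 / 2) + fourierCoeffAt N w (y₀ - 1 / 2)) / A p).im| ≤
      500000 * ρ ^ 2 + 2 * ρ * (8000000 * ρ + 3000 / N) / (2 * Real.pi) +
        (L * leakConst Δ * 4600 * ρ / N + 600 * ρ ^ 2) := by
    rw [abs_le] at *
    constructor <;> linarith [s1.1, s1.2, s2.1, s2.2, s4.1, s4.2]
  have s6 : 2 * ρ * (8000000 * ρ + 3000 / N) / (2 * Real.pi) ≤ ρ * (8000000 * ρ + 3000 / N) / 3 := by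
    rw [mul_assoc, mul_div_mul_left _ _ two_ne_zero]
    gcongr
    exact Real.pi_gt_three.le
  calc _ ≤ ‖A p‖ * (500000 * ρ ^ 2 + ρ * (8000000 * ρ + 3000 / N) / 3 +
        (L * leakConst Δ * 4600 * ρ / N + 600 * ρ ^ 2)) := by gcongr; linarith
    _ = τ * ((500600 + 8000000 / 3) * ρ + (1000 + L * leakConst Δ * 4600) / N) := by
        rw [hτρ]; ring
    _ ≤ τ * (10000000 * ρ + (2000 + 10000 * (L * leakConst Δ)) / N) := by
        have q := mul_nonneg (Nat.cast_nonneg (α := ℝ) L) hc.le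
        exact mul_le_mul_of_nonneg_left (add_le_add (by linarith)
          (div_le_div_of_nonneg_right (by linarith) hN'.le)) hτ
    _ ≤ _ := by
        rw [mul_div_assoc]; gcongr

end FixedPoint

/-! ### Linear functionals of the noise -/

section Gaussian

variable {Ω : Type*} [MeasurableSpace Ω] {P : Measure Ω} {σ : ℝ} {w : ℕ → Ω → ℂ}

/-- Circularity: the real part of `c * w n` is a sum of independent Gaussians with weights `c.re`
and `-c.im`, so only `‖c‖` enters the law. -/
lemma IsWhiteGaussianNoise.map_re_mul (h : IsWhiteGaussianNoise P σ w) (c : ℂ) (n : ℕ) :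
    P.map (fun ω => (c * w n ω).re) = gaussianReal 0 (Real.toNNReal (σ ^ 2 / 2 * ‖c‖ ^ 2)) := by
  have hm := h.measurable n
  have h1 : HasLaw (fun ω => (w n ω).re) (gaussianReal 0 (Real.toNNReal (σ ^ 2 / 2))) P :=
    ⟨by fun_prop, h.re_law n⟩
  have h2 : HasLaw (fun ω => (w n ω).im) (gaussianReal 0 (Real.toNNReal (σ ^ 2 / 2))) P :=
    ⟨by fun_prop, h.im_law n⟩
  have h3 := gaussianReal_const_mul h1 c.re
  have h4 := gaussianReal_const_mul h2 (-c.im)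
  have hi : IndepFun (fun ω => c.re * (w n ω).re) (fun ω => -c.im * (w n ω).im) P :=
    (h.re_indep_im n).comp (φ := fun x => c.re * x) (ψ := fun x => -c.im * x)
      (by fun_prop) (by fun_prop)
  have h5 := gaussianReal_add_gaussianReal_of_indepFun hi h3.map_eq h4.map_eq
  have h6 : (fun ω => (c * w n ω).re) = (fun ω => c.re * (w n ω).re) + fun ω => -c.im * (w n ω).im := by
    ext ω; simp [Complex.mul_re, sub_eq_add_neg]
  rw [h6, h5]
  congr 1
  · simp
  · rw [← NNReal.coe_inj]
    simp only [NNReal.coe_add, NNReal.coe_mul, NNReal.coe_mk]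
    rw [Real.coe_toNNReal _ (by positivity), Real.coe_toNNReal _ (by positivity),
      ← Complex.normSq_eq_norm_sq, Complex.normSq_apply]
    ring

lemma IsWhiteGaussianNoise.map_re_sum [IsProbabilityMeasure P] (h : IsWhiteGaussianNoise P σ w)
    (c : ℕ → ℂ) (N : ℕ) :
    P.map (fun ω => (∑ n ∈ Finset.range N, c n * w n ω).re) =
      gaussianReal 0 (Real.toNNReal (σ ^ 2 / 2 * ∑ n ∈ Finset.range N, ‖c n‖ ^ 2)) := by
  have hind : iIndepFun (fun n ω => (c n * w n ω).re) P :=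
    h.indep.comp (fun n z => (c n * z).re) fun n => by fun_prop
  have hmeas : ∀ n, Measurable fun ω => (c n * w n ω).re := fun n => by
    have := h.measurable n; fun_prop
  induction N with
  | zero => simp [gaussianReal_zero_var, Measure.map_const]
  | succ N ih =>
    have hi := hind.indepFun_finsetSum_of_notMem hmeas (s := Finset.range N) (i := N) (by simp)
    have e1 : (∑ j ∈ Finset.range N, fun ω => (c j * w j ω).re) =
        fun ω => (∑ n ∈ Finset.range N, c n * w n ω).re := by
      ext ω; simp [Finset.sum_apply]
    rw [e1] at hi
    have h5 := gaussianReal_add_gaussianReal_of_indepFun hi ih (h.map_re_mul (c N) N)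
    have e2 : (fun ω => (∑ n ∈ Finset.range (N + 1), c n * w n ω).re) =
        (fun ω => (∑ n ∈ Finset.range N, c n * w n ω).re) + fun ω => (c N * w N ω).re := by
      ext ω; simp [Finset.sum_range_succ]
    rw [e2, h5, add_zero, Finset.sum_range_succ, mul_add, Real.toNNReal_add]
    · exact mul_nonneg (by positivity) (Finset.sum_nonneg fun _ _ => by positivity)
    · positivity

/-- Chernoff bound with an upper bound `V` in place of the variance, so that one tail serves a whole
family of functionals, degenerate ones included. -/
lemma measureReal_le_of_map_eq_gaussianReal {X : Ω → ℝ} (hX : AEMeasurable X P) {v V : ℝ} (hv : 0 ≤ v)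
    (hV : v ≤ V) (h : P.map X = gaussianReal 0 (Real.toNNReal v)) {ε : ℝ} (hε : 0 ≤ ε) :
    P.real {ω | ε ≤ X ω} ≤ Real.exp (-ε ^ 2 / (2 * V)) := by
  have hs : HasSubgaussianMGF X (Real.toNNReal V) P := by
    refine ⟨fun t => ?_, fun t => ?_⟩
    · have : Integrable (fun x => Real.exp (t * x)) (P.map X) := by
        rw [h]; exact integrable_exp_mul_gaussianReal t
      exact this.comp_aemeasurable hX
    · rw [mgf_gaussianReal h, Real.coe_toNNReal _ hv, Real.coe_toNNReal _ (hv.trans hV), zero_mul,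
        zero_add]
      gcongr
  have := hs.measure_ge_le hε
  rwa [Real.coe_toNNReal _ (hv.trans hV)] at this

variable [IsProbabilityMeasure P]

/-- Four rotations reduce a complex modulus to one-sided bounds of real parts, to which the Gaussian
tail applies. -/
lemma norm_lt_of_rotations {z : ℂ} {ε : ℝ} (h : ∀ j < 4, (Complex.I ^ j * z).re < ε) :
    ‖z‖ ≤ 2 * ε := by
  have h0 := h 0 (by norm_num)
  have h1 := h 1 (by norm_num)
  have h2 := h 2 (by norm_num)
  have h3 := h 3 (by norm_num)
  have e3 : Complex.I ^ 3 = -Complex.I := by rw [pow_succ, Complex.I_sq]; ring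
  rw [e3] at h3
  simp at h0 h1 h2 h3
  have hr : |z.re| ≤ ε := abs_le.2 ⟨by linarith, by linarith⟩
  have hi : |z.im| ≤ ε := abs_le.2 ⟨by linarith, by linarith⟩
  linarith [Complex.norm_le_abs_re_add_abs_im z]

/-- The scale of the noise in the Fourier coefficients. -/
def noiseScale (σ : ℝ) (N : ℕ) : ℝ := σ * √(5 * (Real.log N / N))

lemma noiseScale_nonneg (hσ : 0 < σ) (N : ℕ) : 0 ≤ noiseScale σ N := by
  unfold noiseScale; positivity

/-- Polynomially many normalised linear functionals of the noise are eventually bounded by the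
noise scale. -/
lemma IsWhiteGaussianNoise.ae_eventually_norm_le (h : IsWhiteGaussianNoise P σ w) (hσ : 0 < σ)
    (c : ℕ → ℕ → ℕ → ℂ) (hc : ∀ N i, ∀ n < N, ‖c N i n‖ ≤ 1 / N) :
    ∀ᵐ ω ∂P, ∀ᶠ N : ℕ in atTop, ∀ i < 3 * N ^ 3,
      ‖∑ n ∈ Finset.range N, c N i n * w n ω‖ ≤ 2 * noiseScale σ N := by
  set S : ℕ → Set Ω := fun N => ⋃ i ∈ Finset.range (3 * N ^ 3), ⋃ j ∈ Finset.range 4,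
    {ω | noiseScale σ N ≤ (∑ n ∈ Finset.range N, (Complex.I ^ j * c N i n) * w n ω).re} with hS
  have hbound : ∀ N, P (S N) ≤ ENNReal.ofReal (12 * (1 / (N : ℝ) ^ 2)) := fun N => by
    rcases Nat.eq_zero_or_pos N with rfl | hN
    · simp [hS]
    have hN' : (0 : ℝ) < N := by exact_mod_cast hN
    have h1 : ∀ i j, P.real {ω | noiseScale σ N ≤
        (∑ n ∈ Finset.range N, (Complex.I ^ j * c N i n) * w n ω).re} ≤ 1 / (N : ℝ) ^ 5 := by
      intro i j
      have hm : AEMeasurable (fun ω => (∑ n ∈ Finset.range N, (Complex.I ^ j * c N i n) * w n ω).re) P := by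
        have := h.measurable
        fun_prop
      have hV : σ ^ 2 / 2 * ∑ n ∈ Finset.range N, ‖Complex.I ^ j * c N i n‖ ^ 2 ≤ σ ^ 2 / 2 * (1 / N) := by
        gcongr
        refine (Finset.sum_le_card_nsmul _ _ ((1 / (N : ℝ)) ^ 2) fun n hn => ?_).trans ?_
        · rw [norm_mul, norm_pow, Complex.norm_I, one_pow, one_mul]
          gcongr
          exact hc N i n (Finset.mem_range.1 hn)
        · rw [Finset.card_range, nsmul_eq_mul]
          refine le_of_eq ?_
          field_simp
      refine (measureReal_le_of_map_eq_gaussianReal hm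
        (mul_nonneg (by positivity) (Finset.sum_nonneg fun _ _ => by positivity)) hV
        (h.map_re_sum _ N) (noiseScale_nonneg hσ N)).trans (le_of_eq ?_)
      have hlog : 0 ≤ Real.log N := Real.log_natCast_nonneg N
      rw [noiseScale, mul_pow, Real.sq_sqrt (by positivity)]
      -- The `5` in `noiseScale` yields the tail `N ^ (-5)`. Over `3 * N ^ 3` functionals and four
      -- rotations the total is `12 / N ^ 2`, which is summable, as Borel-Cantelli requires.
      have : -(σ ^ 2 * (5 * (Real.log N / N))) / (2 * (σ ^ 2 / 2 * (1 / N))) =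
          -(((5 : ℕ) : ℝ) * Real.log N) := by
        field_simp; push_cast; ring
      rw [this, Real.exp_neg, Real.exp_nat_mul, Real.exp_log hN', one_div]
    have h2 : P.real (S N) ≤ 12 * (1 / (N : ℝ) ^ 2) := by
      refine (measureReal_biUnion_finset_le _ _).trans ?_
      refine (Finset.sum_le_sum fun i _ => (measureReal_biUnion_finset_le _ _).trans
        (Finset.sum_le_sum fun j _ => h1 i j)).trans (le_of_eq ?_)
      simp only [Finset.sum_const, Finset.card_range, nsmul_eq_mul]
      push_cast
      field_simp
      norm_num
    rw [← ofReal_measureReal (measure_ne_top _ _)]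
    exact ENNReal.ofReal_le_ofReal h2
  have hsum : (∑' N, P (S N)) ≠ ⊤ := by
    refine ne_top_of_le_ne_top ?_ (ENNReal.tsum_le_tsum hbound)
    refine Summable.tsum_ofReal_ne_top ?_
    exact (Real.summable_one_div_nat_pow.2 one_lt_two).mul_left 12
  filter_upwards [ae_eventually_notMem hsum] with ω hω
  filter_upwards [hω] with N hN i hi
  refine norm_lt_of_rotations fun j hj => ?_
  by_contra! hlt
  apply hN
  simp only [hS, Set.mem_iUnion, Finset.mem_range]
  refine ⟨i, hi, j, hj, ?_⟩
  change noiseScale σ N ≤ _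
  refine hlt.trans (le_of_eq ?_)
  rw [Finset.mul_sum]
  simp only [mul_assoc]

end Gaussian

/-! ### Uniform bounds of the Fourier transform of the noise -/

/-- Fourier transform with weights `b`. -/
def weightedCoeff (N : ℕ) (b : ℕ → ℝ) (w : ℕ → ℂ) (y : ℝ) : ℂ :=
  ∑ n ∈ Finset.range N, (b n / N : ℝ) * cis (-(y * n / N)) * w n

lemma fourierCoeffAt_eq (N : ℕ) (w : ℕ → ℂ) (y : ℝ) :
    fourierCoeffAt N w y = ∑ n ∈ Finset.range N, (1 / N : ℝ) * cis (-(y * n / N)) * w n := by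
  rw [fourierCoeffAt, Finset.mul_sum]
  refine Finset.sum_congr rfl fun n _ => ?_
  rw [cis, show 2 * Real.pi * Complex.I * ((-(y * n / N) : ℝ) : ℂ) =
    -(2 * Real.pi * Complex.I * y * n / N) by push_cast; ring]
  push_cast; ring

/-- A crude Lipschitz bound by the largest noise sample, sufficient between the points of a fine
grid. -/
lemma norm_weightedCoeff_sub_le {N : ℕ} (hN : 0 < N) {b : ℕ → ℝ} {w : ℕ → ℂ} {M : ℝ}
    (hb : ∀ n < N, |b n| ≤ 1) (hM : ∀ n < N, ‖w n‖ ≤ M) (y y' : ℝ) :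
    ‖weightedCoeff N b w y - weightedCoeff N b w y'‖ ≤ 2 * Real.pi * M * |y - y'| := by
  have hN' : (0 : ℝ) < N := by exact_mod_cast hN
  rw [weightedCoeff, weightedCoeff, ← Finset.sum_sub_distrib]
  refine (norm_sum_le _ _).trans ((Finset.sum_le_card_nsmul _ _ (2 * Real.pi * M * |y - y'| / N)
    fun n hn => ?_).trans (le_of_eq ?_))
  · have hn' := Finset.mem_range.1 hn
    rw [← sub_mul, ← mul_sub, norm_mul, norm_mul, Complex.norm_real, Real.norm_eq_abs, abs_div,
      Nat.abs_cast]
    have h1 : ‖cis (-(y * n / N)) - cis (-(y' * n / N))‖ ≤ 2 * Real.pi * |y - y'| := by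
      refine (norm_cis_sub_cis_le _ _).trans ?_
      refine mul_le_mul_of_nonneg_left ?_ (by positivity)
      rw [neg_sub_neg, ← sub_div, ← sub_mul, abs_div, abs_mul, Nat.abs_cast, Nat.abs_cast,
        div_le_iff₀ hN', abs_sub_comm]
      exact mul_le_mul_of_nonneg_left (by exact_mod_cast hn'.le) (abs_nonneg _)
    calc _ ≤ 1 / N * (2 * Real.pi * |y - y'|) * M := by
          gcongr
          · exact hb n hn'
          · exact hM n hn'
      _ = _ := by ring
  · rw [Finset.card_range, nsmul_eq_mul]; field_simp

/-- The derivative is again a transform of the noise, with weights `n / N ≤ 1`. The variation of the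
noise transform therefore obeys the same logarithmic bound as its value. -/
lemma hasDerivAt_fourierCoeffAt (N : ℕ) (w : ℕ → ℂ) (y : ℝ) :
    HasDerivAt (fourierCoeffAt N w)
      (-(2 * Real.pi * Complex.I) * weightedCoeff N (fun n => n / N) w y) y := by
  have h1 : ∀ n ∈ Finset.range N, HasDerivAt
      (fun y : ℝ => ((1 / N : ℝ) : ℂ) * cis (-(y * n / N)) * w n)
      (-(2 * Real.pi * Complex.I) * ((((n / N : ℝ) / N : ℝ) : ℂ) * cis (-(y * n / N)) * w n)) y := fun n _ => by
    have h2 : HasDerivAt (fun y : ℝ => (2 * Real.pi * Complex.I * ((-(y * n / N) : ℝ) : ℂ) : ℂ))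
        (2 * Real.pi * Complex.I * ((-(1 * n / N) : ℝ) : ℂ)) y :=
      ((((hasDerivAt_id y).mul_const (n : ℝ)).div_const (N : ℝ)).neg.ofReal_comp).const_mul _
    have h3 := (h2.cexp.const_mul ((1 / N : ℝ) : ℂ)).mul_const (w n)
    refine h3.congr_deriv ?_
    rw [← cis]
    push_cast; ring
  have := HasDerivAt.fun_sum h1
  rw [← Finset.mul_sum] at this
  exact this.congr_of_eventuallyEq (Eventually.of_forall fun y => fourierCoeffAt_eq N w y)

/-- Spacing `1 / N ^ 2` on `[-N, N]` needs `2 * N ^ 3 + 1` points, at most `3 * N ^ 3`. -/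
lemma exists_grid {N : ℕ} (hN : 0 < N) {y : ℝ} (hy : |y| ≤ N) :
    ∃ i < 3 * N ^ 3, |y - ((i : ℝ) - N ^ 3) / N ^ 2| ≤ 1 / (N : ℝ) ^ 2 := by
  have hN' : (1 : ℝ) ≤ N := by exact_mod_cast hN
  obtain ⟨h1, h2⟩ := abs_le.1 hy
  have h0 : 0 ≤ y * N ^ 2 + N ^ 3 := by
    have : 0 ≤ (y + N) * (N : ℝ) ^ 2 := mul_nonneg (by linarith) (by positivity)
    nlinarith
  refine ⟨⌊y * N ^ 2 + N ^ 3⌋₊, ?_, ?_⟩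
  · rw [Nat.floor_lt h0]
    push_cast
    have : y * (N : ℝ) ^ 2 ≤ N * N ^ 2 := by gcongr
    have : 1 ≤ (N : ℝ) ^ 3 := one_le_pow₀ hN'
    nlinarith
  · have a1 := Nat.floor_le h0
    have a2 := Nat.lt_floor_add_one (y * (N : ℝ) ^ 2 + N ^ 3)
    set k : ℝ := (⌊y * (N : ℝ) ^ 2 + N ^ 3⌋₊ : ℝ)
    have : y - (k - N ^ 3) / N ^ 2 = (y * N ^ 2 + N ^ 3 - k) / N ^ 2 := by field_simp; ring
    rw [this, abs_div, abs_of_pos (by positivity : (0 : ℝ) < (N : ℝ) ^ 2)]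
    gcongr
    rw [abs_le]; constructor <;> linarith

lemma IsWhiteGaussianNoise.ae_noiseBound {Ω : Type*} [MeasurableSpace Ω] {P : Measure Ω}
    [IsProbabilityMeasure P] {σ : ℝ} {w : ℕ → Ω → ℂ} (h : IsWhiteGaussianNoise P σ w)
    (hσ : 0 < σ) :
    ∀ᵐ ω ∂P, ∀ᶠ N : ℕ in atTop, NoiseBound N (fun n => w n ω) (26 * noiseScale σ N) := by
  have hbd : ∀ (b : ℕ → ℕ → ℝ), (∀ N, ∀ n < N, |b N n| ≤ 1) → ∀ᵐ ω ∂P, ∀ᶠ N : ℕ in atTop,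
      ∀ i < 3 * N ^ 3, ‖weightedCoeff N (b N) (fun n => w n ω) (((i : ℝ) - N ^ 3) / N ^ 2)‖ ≤
        2 * noiseScale σ N := fun b hb => by
    refine h.ae_eventually_norm_le hσ
      (fun N i n => (b N n / N : ℝ) * cis (-((((i : ℝ) - N ^ 3) / N ^ 2) * n / N))) fun N i n hn => ?_
    rw [norm_mul, norm_cis, mul_one, Complex.norm_real, Real.norm_eq_abs, abs_div, Nat.abs_cast]
    gcongr
    exact hb N n hn
  have hone : ∀ N : ℕ, ∀ n < N, |(1 : ℝ)| ≤ 1 := by simp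
  have hramp : ∀ N : ℕ, ∀ n < N, |((n : ℝ) / N)| ≤ 1 := fun N n hn => by
    rw [abs_div, Nat.abs_cast, Nat.abs_cast]
    exact div_le_one_of_le₀ (by exact_mod_cast hn.le) (Nat.cast_nonneg N)
  -- Single samples divided by `N` are functionals of the same kind, so the largest sample is at
  -- most `2 * N` times the noise scale.
  have hsup := h.ae_eventually_norm_le hσ (fun N i n => if n = i then (1 / N : ℝ) else 0)
    fun N i n _ => by split_ifs <;> simp
  filter_upwards [hbd (fun _ _ => 1) hone, hbd (fun N n => n / N) hramp, hsup] with ω h0 h1 h2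
  filter_upwards [h0, h1, h2, eventually_ge_atTop 7] with N h0 h1 h2 hN7
  have hN' : (7 : ℝ) ≤ N := by exact_mod_cast hN7
  have hN0 : (0 : ℝ) < N := by linarith
  set ε := noiseScale σ N with hε
  have hε0 : 0 ≤ ε := noiseScale_nonneg hσ N
  have hM : ∀ n < N, ‖w n ω‖ ≤ 2 * ε * N := fun n hn => by
    have := h2 n (lt_of_lt_of_le hn (by nlinarith [Nat.one_le_pow 2 N (by omega), pow_succ N 2]))
    simp only [ite_mul, zero_mul, Finset.sum_ite_eq', Finset.mem_range, hn, if_true, norm_mul,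
      Complex.norm_real, Real.norm_eq_abs, abs_div, abs_one, Nat.abs_cast] at this
    rw [one_div_mul_eq_div, div_le_iff₀ hN0] at this
    exact this
  have key : ∀ b : ℕ → ℝ, (∀ n < N, |b n| ≤ 1) → (∀ i < 3 * N ^ 3,
      ‖weightedCoeff N b (fun n => w n ω) (((i : ℝ) - N ^ 3) / N ^ 2)‖ ≤ 2 * ε) →
      ∀ y : ℝ, |y| ≤ N → ‖weightedCoeff N b (fun n => w n ω) y‖ ≤ 4 * ε := fun b hb hg y hy => by
    obtain ⟨i, hi, hiy⟩ := exists_grid (by omega) hy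
    have a1 := norm_weightedCoeff_sub_le (by omega) hb hM y (((i : ℝ) - N ^ 3) / N ^ 2)
    have a2 := norm_sub_norm_le (weightedCoeff N b (fun n => w n ω) y)
      (weightedCoeff N b (fun n => w n ω) (((i : ℝ) - N ^ 3) / N ^ 2))
    have a3 := hg i hi
    -- The spacing `1 / N ^ 2` beats the crude Lipschitz constant of order `ε * N`; the remaining `2
    -- * π / N` is at most `1` since `7 ≤ N`.
    have a4 : 2 * Real.pi * (2 * ε * N) * |y - ((i : ℝ) - N ^ 3) / N ^ 2| ≤
        2 * Real.pi * (2 * ε * N) * (1 / (N : ℝ) ^ 2) := by gcongr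
    have a5 : 2 * Real.pi * (2 * ε * N) * (1 / (N : ℝ) ^ 2) ≤ 2 * ε := by
      have : 2 * Real.pi * (2 * ε * N) * (1 / (N : ℝ) ^ 2) = 2 * ε * (2 * Real.pi) / N := by
        field_simp
      rw [this, div_le_iff₀ hN0]
      gcongr
      linarith [Real.pi_lt_d2]
    linarith
  have k0 := key (fun _ => 1) (hone N) h0
  have k1 := key (fun n => n / N) (hramp N) h1
  have e0 : ∀ y, fourierCoeffAt N (fun n => w n ω) y = weightedCoeff N (fun _ => 1) (fun n => w n ω) y :=
    fun y => fourierCoeffAt_eq N _ y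
  intro y y' hy hy'
  constructor
  · rw [e0]; linarith [k0 y hy]
  · have hd := (convex_Icc (-(N : ℝ)) N).norm_image_sub_le_of_norm_hasDerivWithin_le
      (f := fourierCoeffAt N (fun n => w n ω)) (C := 26 * ε)
      (fun x _ => (hasDerivAt_fourierCoeffAt N (fun n => w n ω) x).hasDerivWithinAt)
      (fun x hx => by
        rw [norm_mul, norm_neg, norm_mul, norm_mul, Complex.norm_I, Complex.norm_real,
          Real.norm_eq_abs, abs_of_pos Real.pi_pos, Complex.norm_two]
        have := k1 x (abs_le.2 hx)
        nlinarith [Real.pi_lt_d2, Real.pi_pos])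
      (abs_le.1 hy') (abs_le.1 hy)
    simpa using hd

/-! ### The Fisher information matrix -/

section SecondMoments

variable {Ω : Type*} [MeasurableSpace Ω] {P : Measure Ω} {σ : ℝ} {w : ℕ → Ω → ℂ}

lemma integral_sq_of_map_eq_gaussianReal {X : Ω → ℝ} (hX : AEMeasurable X P) {v : ℝ} (hv : 0 ≤ v)
    (h : P.map X = gaussianReal 0 (Real.toNNReal v)) :
    Integrable (fun ω => X ω ^ 2) P ∧ ∫ ω, X ω ^ 2 ∂P = v := by
  have h1 : Integrable (fun x : ℝ => x ^ 2) (P.map X) := by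
    rw [h]; exact (memLp_id_gaussianReal 2).integrable_sq
  refine ⟨h1.comp_aemeasurable hX, ?_⟩
  have h2 : ∫ ω, X ω ^ 2 ∂P = ∫ x, x ^ 2 ∂(P.map X) :=
    (integral_map hX (f := fun x : ℝ => x ^ 2) (by fun_prop)).symm
  have h3 := variance_fun_id_gaussianReal (μ := 0) (v := Real.toNNReal v)
  rw [variance_of_integral_eq_zero (by fun_prop) (by simp)] at h3
  rw [h2, h, h3, Real.coe_toNNReal _ hv]

variable [IsProbabilityMeasure P]

/-- Polarisation: the sum and the difference of the two functionals are of the same form, and their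
second moments are known. -/
lemma IsWhiteGaussianNoise.integral_re_sum_mul (h : IsWhiteGaussianNoise P σ w) (c d : ℕ → ℂ)
    (N : ℕ) :
    ∫ ω, (∑ n ∈ Finset.range N, c n * w n ω).re * (∑ n ∈ Finset.range N, d n * w n ω).re ∂P =
      σ ^ 2 / 2 * ∑ n ∈ Finset.range N, inner ℝ (c n) (d n) := by
  have hw := h.measurable
  have hm : ∀ e : ℕ → ℂ, AEMeasurable (fun ω => (∑ n ∈ Finset.range N, e n * w n ω).re) P :=
    fun e => by fun_prop
  have hsq := fun e : ℕ → ℂ => integral_sq_of_map_eq_gaussianReal (hm e)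
    (mul_nonneg (by positivity) (Finset.sum_nonneg fun _ _ => by positivity)) (h.map_re_sum e N)
  have e1 : ∀ ω, (∑ n ∈ Finset.range N, c n * w n ω).re * (∑ n ∈ Finset.range N, d n * w n ω).re =
      1 / 4 * ((∑ n ∈ Finset.range N, (c n + d n) * w n ω).re ^ 2 -
        (∑ n ∈ Finset.range N, (c n - d n) * w n ω).re ^ 2) := fun ω => by
    simp only [add_mul, sub_mul, Finset.sum_add_distrib, Finset.sum_sub_distrib, Complex.add_re,
      Complex.sub_re]
    ring
  simp only [e1]
  rw [integral_const_mul, integral_sub (hsq (fun n => c n + d n)).1 (hsq (fun n => c n - d n)).1,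
    (hsq (fun n => c n + d n)).2, (hsq (fun n => c n - d n)).2, ← mul_sub, ← Finset.sum_sub_distrib]
  have e2 : ∀ n, ‖c n + d n‖ ^ 2 - ‖c n - d n‖ ^ 2 = 4 * inner ℝ (c n) (d n) := fun n => by
    rw [norm_add_sq_real, norm_sub_sq_real]; ring
  simp only [e2, ← Finset.mul_sum]
  ring

end SecondMoments

section Fisher

variable {L : ℕ}

/-- Partial derivatives of the signal with respect to its real parameters. -/
def signalDeriv (A : Fin L → ℂ) (f : Fin L → ℝ) (i : Fin L × Fin 3) (n : ℕ) : ℂ :=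
  ![A i.1 * (2 * Real.pi * Complex.I * n), 1, Complex.I] i.2 * cis (f i.1 * n)

lemma paramSignal_params (A : Fin L → ℂ) (f : Fin L → ℝ) : paramSignal (params A f) = signal A f := by
  simp [paramSignal, params]

lemma hasDerivAt_paramSignal (A : Fin L → ℂ) (f : Fin L → ℝ) (i : Fin L × Fin 3) (n : ℕ) :
    HasDerivAt (fun t => paramSignal (Function.update (params A f) i t) n) (signalDeriv A f i n)
      (params A f i) := by
  obtain ⟨l, k⟩ := i
  have hterm : ∀ l' ∈ Finset.univ, HasDerivAt (fun t : ℝ =>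
      (⟨Function.update (params A f) (l, k) t (l', 1), Function.update (params A f) (l, k) t (l', 2)⟩ : ℂ) *
        Complex.exp (2 * Real.pi * Complex.I * (Function.update (params A f) (l, k) t (l', 0) : ℝ) * n))
      (if l' = l then signalDeriv A f (l, k) n else 0) (params A f (l, k)) := by
    intro l' _
    rcases eq_or_ne l' l with rfl | hl
    · rw [if_pos rfl]
      have hcis : Complex.exp (2 * Real.pi * Complex.I * f l' * n) = cis (f l' * n) := by
        unfold cis; push_cast; ring_nf
      fin_cases k
      · have h1 : HasDerivAt (fun t : ℝ => (A l') * Complex.exp (2 * Real.pi * Complex.I * (t : ℂ) * n))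
            ((A l') * (Complex.exp (2 * Real.pi * Complex.I * f l' * n) *
              (2 * Real.pi * Complex.I * 1 * n))) (f l') :=
          (((((hasDerivAt_id (f l')).ofReal_comp).const_mul _).mul_const _).cexp).const_mul _
        rw [hcis] at h1
        have : signalDeriv A f (l', (0 : Fin 3)) n =
          (A l') * (cis (f l' * n) * (2 * Real.pi * Complex.I * 1 * n)) := by
          simp [signalDeriv]; ring
        simpa [params, this] using h1
      · have h1 : HasDerivAt (fun t : ℝ => ((t : ℂ) + (A l').im * Complex.I) *
            Complex.exp (2 * Real.pi * Complex.I * f l' * n))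
            (1 * Complex.exp (2 * Real.pi * Complex.I * f l' * n)) (A l').re :=
          (((hasDerivAt_id _).ofReal_comp).add_const _).mul_const _
        rw [hcis] at h1
        have e2 : ∀ t : ℝ, (⟨t, (A l').im⟩ : ℂ) = t + (A l').im * Complex.I := fun t => Complex.mk_eq_add_mul_I _ _
        simpa [params, signalDeriv, hcis, e2] using h1
      · have h1 : HasDerivAt (fun t : ℝ => ((A l').re + (t : ℂ) * Complex.I) *
            Complex.exp (2 * Real.pi * Complex.I * f l' * n))
            ((1 * Complex.I) * Complex.exp (2 * Real.pi * Complex.I * f l' * n)) (A l').im :=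
          ((((hasDerivAt_id _).ofReal_comp).mul_const _).const_add _).mul_const _
        rw [hcis] at h1
        have e2 : ∀ t : ℝ, (⟨(A l').re, t⟩ : ℂ) = (A l').re + t * Complex.I := fun t => Complex.mk_eq_add_mul_I _ _
        simpa [params, signalDeriv, hcis, e2] using h1
    · rw [if_neg hl]
      have : ∀ k' t, Function.update (params A f) (l, k) t (l', k') = params A f (l', k') :=
        fun k' t => Function.update_of_ne (by simp [hl]) _ _
      simp only [this]
      exact hasDerivAt_const _ _
  have := HasDerivAt.fun_sum hterm
  simp only [Finset.sum_ite_eq', Finset.mem_univ, if_true] at this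
  exact this

/-- At the true parameters the residual of the model is the noise itself, so the score is linear in
it. -/
lemma score_eq (σ : ℝ) (N : ℕ) (A : Fin L → ℂ) (f : Fin L → ℝ) (w : ℕ → ℂ) (i : Fin L × Fin 3) :
    score σ N (observed A f w) (params A f) i =
      2 / σ ^ 2 * (∑ n ∈ Finset.range N, starRingEnd ℂ (signalDeriv A f i n) * w n).re := by
  rw [score]
  have h1 : ∀ n ∈ Finset.range N, HasDerivAt (fun t => ‖observed A f w n -
      paramSignal (Function.update (params A f) i t) n‖ ^ 2)
      (2 * inner ℝ (w n) (-signalDeriv A f i n)) (params A f i) := fun n _ => by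
    have h2 := ((hasDerivAt_paramSignal A f i n).const_sub (observed A f w n)).norm_sq
    simp only [Function.update_eq_self, paramSignal_params] at h2
    have : observed A f w n - signal A f n = w n := by simp [observed]
    rw [this] at h2
    exact h2
  have h3 := ((HasDerivAt.fun_sum h1).const_mul (1 / σ ^ 2)).const_sub
    (-(N : ℝ) * Real.log (Real.pi * σ ^ 2))
  have h4 : deriv (fun t => logLikelihood σ N (observed A f w) (Function.update (params A f) i t))
      (params A f i) = _ := h3.deriv
  rw [h4, Complex.re_sum, Finset.mul_sum, Finset.mul_sum, ← Finset.sum_neg_distrib]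
  refine Finset.sum_congr rfl fun n _ => ?_
  rw [Complex.inner]
  simp [Complex.mul_re]
  ring

/-- Gram matrix of the first `N` samples of a family of sequences. -/
def sampleGram {ι : Type*} (v : ι → ℕ → ℂ) (N : ℕ) : Matrix ι ι ℝ :=
  Matrix.of fun i j => ∑ n ∈ Finset.range N, inner ℝ (v i n) (v j n)

lemma posSemidef_sampleGram {ι : Type*} [Finite ι] (v : ι → ℕ → ℂ) (N : ℕ) :
    (sampleGram v N).PosSemidef := by
  have : sampleGram v N = Matrix.gram ℝ (fun i => (WithLp.toLp 2 fun n : Fin N => v i n :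
      EuclideanSpace ℂ (Fin N))) := by
    ext i j
    simp only [sampleGram, Matrix.of_apply, Matrix.gram_apply]
    rw [← Fin.sum_univ_eq_sum_range (fun n => inner ℝ (v i n) (v j n)) N]
    rfl
  rw [this]
  exact Matrix.posSemidef_gram _ _

lemma sampleGram_comb {ι κ : Type*} [Fintype ι] (v : ι → ℕ → ℂ) (R : Matrix ι κ ℝ)
    (u : κ → ℕ → ℂ) (hu : ∀ k n, u k n = ∑ i, R i k • v i n) (N : ℕ) :
    sampleGram u N = R.transpose * sampleGram v N * R := by
  ext k k'
  simp only [sampleGram, Matrix.of_apply, Matrix.mul_apply, Matrix.transpose_apply, hu, sum_inner,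
    inner_sum, real_inner_smul_left, real_inner_smul_right, Finset.mul_sum, Finset.sum_mul]
  rw [Finset.sum_comm]
  refine Finset.sum_congr rfl fun i _ => ?_
  rw [Finset.sum_comm]
  refine Finset.sum_congr rfl fun j _ => Finset.sum_congr rfl fun n _ => ?_
  ring

lemma fisherInfo_eq {Ω : Type*} [MeasurableSpace Ω] {P : Measure Ω} [IsProbabilityMeasure P] {σ : ℝ}
    {w : ℕ → Ω → ℂ} (h : IsWhiteGaussianNoise P σ w) (hσ : 0 < σ) (N : ℕ) (A : Fin L → ℂ)
    (f : Fin L → ℝ) :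
    fisherInfo P σ w N A f = (2 / σ ^ 2) • sampleGram (signalDeriv A f) N := by
  ext i j
  simp only [fisherInfo, Matrix.of_apply, score_eq, Matrix.smul_apply, smul_eq_mul, sampleGram]
  have h1 : ∀ ω, 2 / σ ^ 2 * (∑ n ∈ Finset.range N, starRingEnd ℂ (signalDeriv A f i n) * w n ω).re *
      (2 / σ ^ 2 * (∑ n ∈ Finset.range N, starRingEnd ℂ (signalDeriv A f j n) * w n ω).re) =
      (2 / σ ^ 2) ^ 2 * ((∑ n ∈ Finset.range N, starRingEnd ℂ (signalDeriv A f i n) * w n ω).re *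
      (∑ n ∈ Finset.range N, starRingEnd ℂ (signalDeriv A f j n) * w n ω).re) := fun ω => by ring
  simp only [h1]
  rw [integral_const_mul, h.integral_re_sum_mul]
  have h2 : ∀ n, inner ℝ (starRingEnd ℂ (signalDeriv A f i n)) (starRingEnd ℂ (signalDeriv A f j n)) =
      inner ℝ (signalDeriv A f i n) (signalDeriv A f j n) := fun n => by
    rw [Complex.inner, Complex.inner]; simp [Complex.mul_re]
  simp only [h2]
  field_simp

/-- Phase factor of a complex number. -/
def phase (z : ℂ) : ℂ := z / ‖z‖

lemma norm_phase {z : ℂ} (hz : z ≠ 0) : ‖phase z‖ = 1 := by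
  rw [phase, norm_div, Complex.norm_real, norm_norm, div_self (norm_ne_zero_iff.2 hz)]

/-- Profiles of the normalised partial derivatives, the frequency being orthogonalised. -/
def profile (k : Fin 3) (t : ℝ) : ℂ :=
  ![2 * Real.pi * Complex.I * (t - 1 / 2), 1, Complex.I] k

/-- Normalised and asymptotically orthogonal combinations of the partial derivatives. -/
def normalisedDeriv (N : ℕ) (A : Fin L → ℂ) (f : Fin L → ℝ) (i : Fin L × Fin 3) (n : ℕ) : ℂ :=
  (1 / √N : ℝ) * profile i.2 (n / N) * phase (A i.1) * cis (f i.1 * n)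

/-- The coefficients of these combinations. -/
def normalisation (N : ℕ) (A : Fin L → ℂ) : Matrix (Fin L × Fin 3) (Fin L × Fin 3) ℝ :=
  Matrix.of fun j i => if j.1 = i.1 then
    !![1 / (√N * N * ‖A i.1‖), 0, 0;
      Real.pi * (phase (A i.1)).im / √N, (phase (A i.1)).re / √N, -(phase (A i.1)).im / √N;
      -Real.pi * (phase (A i.1)).re / √N, (phase (A i.1)).im / √N, (phase (A i.1)).re / √N] j.2 i.2
    else 0

/-- With `g` the phase of the amplitude, the weights `π * g.im` and `-π * g.re` of the first column
add up to `-π i g`, which centres the time `n / N` at `1 / 2`. The other two columns rotate `1` and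
`i` by `g`. -/
lemma normalisedDeriv_eq {N : ℕ} (hN : N ≠ 0) {A : Fin L → ℂ} (hA : ∀ l, A l ≠ 0) (f : Fin L → ℝ)
    (i : Fin L × Fin 3) (n : ℕ) :
    normalisedDeriv N A f i n = ∑ j, normalisation N A j i • signalDeriv A f j n := by
  obtain ⟨l, k⟩ := i
  have hN0 : (0 : ℝ) < N := by exact_mod_cast Nat.pos_of_ne_zero hN
  have hs : (√N : ℂ) ≠ 0 := by
    have := Real.sqrt_pos.2 hN0
    exact_mod_cast this.ne'
  have hNc : (N : ℂ) ≠ 0 := by exact_mod_cast hN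
  have hAn : ((‖A l‖ : ℝ) : ℂ) ≠ 0 := by exact_mod_cast norm_ne_zero_iff.2 (hA l)
  rw [Fintype.sum_prod_type, Finset.sum_eq_single l]
  · have hph : ((phase (A l)).re : ℂ) = phase (A l) - (phase (A l)).im * Complex.I := by
      rw [eq_sub_iff_add_eq]; exact Complex.re_add_im _
    have hAph : A l = phase (A l) * ‖A l‖ := by rw [phase]; field_simp
    simp only [Fin.sum_univ_three, normalisation, Matrix.of_apply, if_true, normalisedDeriv, signalDeriv]
    generalize phase (A l) = g at hph hAph
    have hI := Complex.I_sq
    fin_cases k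
    · simp only [profile, Fin.zero_eta, Matrix.cons_val_zero]
      simp
      rw [hph]
      generalize (‖A l‖ : ℂ) = r at hAn hAph
      rw [hAph]
      have h1 : r⁻¹ * ((N : ℂ)⁻¹ * (√N : ℂ)⁻¹) * (g * r * (2 * Real.pi * Complex.I * n) * cis (f l * n)) =
          (√N : ℂ)⁻¹ * (2 * Real.pi * Complex.I * (n / N)) * g * cis (f l * n) := by field_simp
      rw [h1]
      linear_combination (-(Real.pi * g.im / √N * cis (f l * n))) * hI
    · simp [profile]
      rw [hph]
      ring
    · simp [profile]
      rw [hph]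
      linear_combination (g.im / √N * cis (f l * n)) * hI
  · intro b _ hb
    refine Finset.sum_eq_zero fun k' _ => ?_
    simp [normalisation, hb]
  · simp

/-! ### Limit of the normalised Gram matrix -/

/-- Abel summation: multiplication by `1 - z` leaves boundary terms and the increments of the
weights. -/
lemma norm_geom_sum_weighted_le {z : ℂ} (hz : ‖z‖ = 1) (p : ℕ → ℂ) {M K : ℝ} (N : ℕ)
    (hM : ∀ n ≤ N, ‖p n‖ ≤ M) (hK : ∀ n < N, ‖p (n + 1) - p n‖ ≤ K) :
    ‖∑ n ∈ Finset.range N, p n * z ^ n‖ * ‖1 - z‖ ≤ 2 * M + N * K := by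
  have h1 : (∑ n ∈ Finset.range N, p n * z ^ n) * (1 - z) =
      p 0 - p N * z ^ N + ∑ n ∈ Finset.range N, (p (n + 1) - p n) * z ^ (n + 1) := by
    clear hM hK
    induction N with
    | zero => simp
    | succ N ih => rw [Finset.sum_range_succ, Finset.sum_range_succ, add_mul, ih]; ring
  rw [← norm_mul, h1]
  refine (norm_add_le _ _).trans ?_
  have h2 : ‖p 0 - p N * z ^ N‖ ≤ 2 * M := by
    refine (norm_sub_le _ _).trans ?_
    rw [norm_mul, norm_pow, hz, one_pow, mul_one]
    linarith [hM 0 (Nat.zero_le _), hM N le_rfl]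
  have h3 : ‖∑ n ∈ Finset.range N, (p (n + 1) - p n) * z ^ (n + 1)‖ ≤ N * K := by
    refine (norm_sum_le _ _).trans ((Finset.sum_le_card_nsmul _ _ K fun n hn => ?_).trans (by simp))
    rw [norm_mul, norm_pow, hz, one_pow, mul_one]
    exact hK n (Finset.mem_range.1 hn)
  linarith

lemma norm_profile_le (k : Fin 3) {t : ℝ} (h0 : 0 ≤ t) (h1 : t ≤ 1) : ‖profile k t‖ ≤ 4 := by
  fin_cases k
  · have h2 : |t - 1 / 2| ≤ 1 / 2 := abs_le.2 ⟨by linarith, by linarith⟩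
    have : profile 0 t = ((2 * Real.pi * (t - 1 / 2) : ℝ) : ℂ) * Complex.I := by
      simp [profile]; ring
    change ‖profile 0 t‖ ≤ 4
    rw [this, norm_mul, Complex.norm_I, Complex.norm_real, Real.norm_eq_abs, abs_mul,
      abs_of_pos (by positivity : 0 < 2 * Real.pi)]
    nlinarith [Real.pi_lt_d2, Real.pi_pos]
  · simp [profile]
  · simp [profile]

lemma norm_profile_sub_le (k : Fin 3) (t t' : ℝ) : ‖profile k t - profile k t'‖ ≤ 7 * |t - t'| := by
  fin_cases k
  · have : profile 0 t - profile 0 t' = ((2 * Real.pi * (t - t') : ℝ) : ℂ) * Complex.I := by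
      simp [profile]; ring
    change ‖profile 0 t - profile 0 t'‖ ≤ _
    rw [this, norm_mul, Complex.norm_I, Complex.norm_real, Real.norm_eq_abs, abs_mul,
      abs_of_pos (by positivity : 0 < 2 * Real.pi)]
    nlinarith [Real.pi_lt_d2, abs_nonneg (t - t')]
  · simp [profile]
  · simp [profile]

lemma inner_normalisedDeriv {N : ℕ} (A : Fin L → ℂ) (f : Fin L → ℝ)
    (i j : Fin L × Fin 3) (n : ℕ) :
    inner ℝ (normalisedDeriv N A f i n) (normalisedDeriv N A f j n) =
      1 / N * (starRingEnd ℂ (profile i.2 (n / N)) * profile j.2 (n / N) *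
        (starRingEnd ℂ (phase (A i.1)) * phase (A j.1)) * cis (f j.1 - f i.1) ^ n).re := by
  have h1 : cis (f j.1 - f i.1) ^ n = starRingEnd ℂ (cis (f i.1 * n)) * cis (f j.1 * n) := by
    have : starRingEnd ℂ (cis (f i.1 * n)) = cis (-(f i.1 * n)) := by
      rw [cis_eq_cos_add_sin, cis_eq_cos_add_sin, mul_neg, Real.cos_neg, Real.sin_neg]
      simp only [map_add, map_mul, Complex.conj_ofReal, Complex.conj_I, Complex.ofReal_neg]
      ring
    rw [this, ← cis_add, ← cis_nat_mul]; congr 1; ring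
  have h2 : ((1 / √N : ℝ) : ℂ) * ((1 / √N : ℝ) : ℂ) = ((1 / N : ℝ) : ℂ) := by
    rw [← Complex.ofReal_mul, div_mul_div_comm, Real.mul_self_sqrt (Nat.cast_nonneg N), one_mul]
  rw [Complex.inner, normalisedDeriv, normalisedDeriv, ← Complex.re_ofReal_mul, h1, ← h2]
  congr 1
  simp only [map_mul, Complex.conj_ofReal]
  ring

/-- Between different components the summands oscillate with a slowly varying weight, so their sum
stays bounded. The weight is at most `4 * 4`, its increments at most `2 * 7 * 4 / N`, and `(2 * 16 +
56) / (4 * Δ) = 22 / Δ`. -/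
lemma abs_sampleGram_le_of_ne {N : ℕ} (hN : 0 < N) {A : Fin L → ℂ} (hA : ∀ l, A l ≠ 0)
    {f : Fin L → ℝ} {Δ : ℝ} (hΔ : 0 < Δ) {i j : Fin L × Fin 3} 
    (h1 : Δ ≤ |f j.1 - f i.1|) (h2 : |f j.1 - f i.1| ≤ 1 - Δ) :
    |sampleGram (normalisedDeriv N A f) N i j| ≤ 22 / Δ / N := by
  have hN0 : (0 : ℝ) < N := by exact_mod_cast hN
  set c := starRingEnd ℂ (phase (A i.1)) * phase (A j.1) with hc
  have hcn : ‖c‖ = 1 := by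
    rw [hc, norm_mul, RCLike.norm_conj, norm_phase (hA _), norm_phase (hA _), one_mul]
  set p : ℕ → ℂ := fun n => starRingEnd ℂ (profile i.2 (n / N)) * profile j.2 (n / N) * c with hp
  have hunit : ∀ n ≤ N, (0 : ℝ) ≤ n / N ∧ (n : ℝ) / N ≤ 1 := fun n hn =>
    ⟨by positivity, div_le_one_of_le₀ (by exact_mod_cast hn) hN0.le⟩
  have key := norm_geom_sum_weighted_le (norm_cis (f j.1 - f i.1)) p (M := 16) (K := 56 / N) N
    (fun n hn => by
      obtain ⟨a, b⟩ := hunit n hn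
      simp only [hp, norm_mul, hcn, mul_one, RCLike.norm_conj]
      have := norm_profile_le i.2 a b
      have := norm_profile_le j.2 a b
      nlinarith [norm_nonneg (profile i.2 (n / N)), norm_nonneg (profile j.2 (n / N))])
    (fun n hn => by
      obtain ⟨a, b⟩ := hunit n hn.le
      obtain ⟨a', b'⟩ := hunit (n + 1) hn
      have e1 : p (n + 1) - p n = (starRingEnd ℂ (profile i.2 ((n + 1 : ℕ) / N) - profile i.2 (n / N)) *
          profile j.2 ((n + 1 : ℕ) / N) + starRingEnd ℂ (profile i.2 (n / N)) *
          (profile j.2 ((n + 1 : ℕ) / N) - profile j.2 (n / N))) * c := by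
        simp only [hp, map_sub]; ring
      rw [e1, norm_mul, hcn, mul_one]
      refine (norm_add_le _ _).trans ?_
      rw [norm_mul, norm_mul, RCLike.norm_conj, RCLike.norm_conj]
      have e2 : |((n + 1 : ℕ) : ℝ) / N - n / N| = 1 / N := by
        rw [← sub_div]; push_cast; rw [add_sub_cancel_left, abs_of_pos (by positivity)]
      have p1 := norm_profile_sub_le i.2 ((n + 1 : ℕ) / N) (n / N)
      have p2 := norm_profile_sub_le j.2 ((n + 1 : ℕ) / N) (n / N)
      rw [e2] at p1 p2
      have q1 := mul_le_mul p1 (norm_profile_le j.2 a' b') (norm_nonneg _) (by positivity)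
      have q2 := mul_le_mul (norm_profile_le i.2 a b) p2 (norm_nonneg _) (by norm_num)
      refine (add_le_add q1 q2).trans (le_of_eq ?_)
      ring)
  have hd := le_norm_one_sub_cis hΔ.le h1 h2
  have e3 : sampleGram (normalisedDeriv N A f) N i j =
      1 / N * (∑ n ∈ Finset.range N, p n * cis (f j.1 - f i.1) ^ n).re := by
    rw [sampleGram, Matrix.of_apply, Complex.re_sum, Finset.mul_sum]
    exact Finset.sum_congr rfl fun n _ => inner_normalisedDeriv A f i j n
  rw [e3, abs_mul, abs_of_pos (by positivity : (0 : ℝ) < 1 / N), one_div_mul_eq_div]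
  refine div_le_div_of_nonneg_right ?_ hN0.le
  refine (Complex.abs_re_le_norm _).trans ?_
  rw [le_div_iff₀ hΔ]
  have e4 : (N : ℝ) * (56 / N) = 56 := by field_simp
  rw [e4] at key
  nlinarith [norm_nonneg (∑ n ∈ Finset.range N, p n * cis (f j.1 - f i.1) ^ n)]

/-- Limit of the Gram matrix of the normalised derivatives. -/
def limitGram (L : ℕ) : Matrix (Fin L × Fin 3) (Fin L × Fin 3) ℝ :=
  Matrix.diagonal fun i => ![Real.pi ^ 2 / 3, 1, 1] i.2

/-- Phases and oscillations cancel within a component, leaving power sums. The off-diagonal `-π / N`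
arises because the mean of `n / N` is `(N - 1) / (2 N)` rather than `1 / 2`. -/
lemma sampleGram_same {N : ℕ} (hN : 0 < N) {A : Fin L → ℂ} (hA : ∀ l, A l ≠ 0)
    (f : Fin L → ℝ) (l : Fin L) (k k' : Fin 3) :
    sampleGram (normalisedDeriv N A f) N (l, k) (l, k') =
      !![Real.pi ^ 2 / 3 + 2 * Real.pi ^ 2 / (3 * N ^ 2), 0, -Real.pi / N; 0, 1, 0;
        -Real.pi / N, 0, 1] k k' := by
  have hN0 : (N : ℝ) ≠ 0 := by exact_mod_cast hN.ne'
  have hph : starRingEnd ℂ (phase (A l)) * phase (A l) = 1 := by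
    rw [mul_comm, Complex.mul_conj, Complex.normSq_eq_norm_sq, norm_phase (hA l)]; simp
  have s1 : ∑ n ∈ Finset.range N, (n : ℝ) = N * (N - 1) / 2 := by
    clear hN hN0
    induction N with
    | zero => simp
    | succ N ih => rw [Finset.sum_range_succ, ih]; push_cast; ring
  have s2 : ∑ n ∈ Finset.range N, (n : ℝ) ^ 2 = N * (N - 1) * (2 * N - 1) / 6 := by
    clear hN hN0 s1
    induction N with
    | zero => simp
    | succ N ih => rw [Finset.sum_range_succ, ih]; push_cast; ring
  have t1 : ∑ n ∈ Finset.range N, 2 * Real.pi * ((n : ℝ) / N - 2⁻¹) = -Real.pi := by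
    have : ∀ n ∈ Finset.range N, 2 * Real.pi * ((n : ℝ) / N - 2⁻¹) =
        2 * Real.pi / N * n - Real.pi := fun n _ => by ring
    rw [Finset.sum_congr rfl this, Finset.sum_sub_distrib, ← Finset.mul_sum, s1]
    simp only [Finset.sum_const, Finset.card_range, nsmul_eq_mul]
    field_simp
    ring
  have t2 : ∑ n ∈ Finset.range N, 2 * Real.pi * ((n : ℝ) / N - 2⁻¹) *
      (2 * Real.pi * ((n : ℝ) / N - 2⁻¹)) = N * (Real.pi ^ 2 / 3 + 2 * Real.pi ^ 2 / (3 * N ^ 2)) := by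
    have : ∀ n ∈ Finset.range N, 2 * Real.pi * ((n : ℝ) / N - 2⁻¹) *
        (2 * Real.pi * ((n : ℝ) / N - 2⁻¹)) =
        4 * Real.pi ^ 2 / N ^ 2 * (n : ℝ) ^ 2 - 4 * Real.pi ^ 2 / N * n + Real.pi ^ 2 :=
      fun n _ => by ring
    rw [Finset.sum_congr rfl this, Finset.sum_add_distrib, Finset.sum_sub_distrib, ← Finset.mul_sum,
      ← Finset.mul_sum, s1, s2]
    simp only [Finset.sum_const, Finset.card_range, nsmul_eq_mul]
    field_simp
    ring
  rw [sampleGram, Matrix.of_apply]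
  simp only [inner_normalisedDeriv, hph, sub_self, cis_zero, one_pow, mul_one]
  rw [← Finset.mul_sum]
  fin_cases k <;> fin_cases k' <;> simp [profile, t1, t2]
  all_goals field_simp

lemma tendsto_sampleGram {A : ℕ → Fin L → ℂ} (hA : ∀ N l, A N l ≠ 0) {f : ℕ → Fin L → ℝ} {Δ : ℝ}
    (hΔ : 0 < Δ) (hf : ∀ N l p, l ≠ p → Δ ≤ |f N l - f N p| ∧ |f N l - f N p| ≤ 1 - Δ) :
    Tendsto (fun N => sampleGram (normalisedDeriv N (A N) (f N)) N) atTop (𝓝 (limitGram L)) := by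
  have hinv : Tendsto (fun N : ℕ => (1 : ℝ) / N) atTop (𝓝 0) := tendsto_one_div_atTop_nhds_zero_nat
  refine tendsto_pi_nhds.2 fun i => tendsto_pi_nhds.2 fun j => ?_
  obtain ⟨l, k⟩ := i
  obtain ⟨l', k'⟩ := j
  rcases eq_or_ne l l' with rfl | hl
  · have h0 : Tendsto (fun N : ℕ => !![Real.pi ^ 2 / 3 + 2 * Real.pi ^ 2 / 3 * (1 / (N : ℝ)) ^ 2, 0,
        -Real.pi * (1 / (N : ℝ)); 0, 1, 0; -Real.pi * (1 / (N : ℝ)), 0, 1] k k') atTop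
        (𝓝 (!![Real.pi ^ 2 / 3 + 2 * Real.pi ^ 2 / 3 * 0 ^ 2, 0,
        -Real.pi * 0; 0, 1, 0; -Real.pi * 0, 0, 1] k k')) := by
      fin_cases k <;> fin_cases k' <;> simp only [Matrix.of_apply, Matrix.cons_val', Matrix.cons_val,
        Fin.zero_eta, Fin.mk_one, Fin.reduceFinMk]
      any_goals exact tendsto_const_nhds
      · exact ((hinv.pow 2).const_mul _).const_add _
      · exact hinv.const_mul _
      · exact hinv.const_mul _
    have e1 : limitGram L (l, k) (l, k') = !![Real.pi ^ 2 / 3 + 2 * Real.pi ^ 2 / 3 * 0 ^ 2, 0,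
        -Real.pi * 0; 0, 1, 0; -Real.pi * 0, 0, 1] k k' := by
      fin_cases k <;> fin_cases k' <;> simp [limitGram]
    rw [e1]
    refine h0.congr' ?_
    filter_upwards [eventually_gt_atTop 0] with N hN
    rw [sampleGram_same hN (hA N)]
    fin_cases k <;> fin_cases k' <;> simp
    all_goals field_simp
  · have e1 : limitGram L (l, k) (l', k') = 0 := by
      simp [limitGram, hl]
    rw [e1]
    have h0 := hinv.const_mul (22 / Δ)
    rw [mul_zero] at h0
    refine squeeze_zero_norm' ?_ h0
    filter_upwards [eventually_gt_atTop 0] with N hN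
    obtain ⟨h1, h2⟩ := hf N l' l hl.symm
    rw [Real.norm_eq_abs, mul_one_div]
    exact abs_sampleGram_le_of_ne hN (hA N) hΔ h1 h2

/-- The inverse is the adjugate over the determinant, both continuous. -/
lemma tendsto_matrix_inv {ι : Type*} [Fintype ι] [DecidableEq ι] {G : ℕ → Matrix ι ι ℝ}
    {H : Matrix ι ι ℝ} (hG : Tendsto G atTop (𝓝 H)) (hH : H.det ≠ 0) :
    Tendsto (fun N => (G N)⁻¹) atTop (𝓝 H⁻¹) ∧ ∀ᶠ N in atTop, (G N).det ≠ 0 := by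
  have hdet : Tendsto (fun N => (G N).det) atTop (𝓝 H.det) :=
    ((Continuous.matrix_det continuous_id).tendsto H).comp hG
  have hadj : Tendsto (fun N => (G N).adjugate) atTop (𝓝 H.adjugate) :=
    ((Continuous.matrix_adjugate continuous_id).tendsto H).comp hG
  refine ⟨?_, hdet.eventually_ne hH⟩
  simp only [Matrix.inv_def, Ring.inverse_eq_inv']
  exact (hdet.inv₀ hH).smul hadj

lemma det_limitGram_ne_zero (L : ℕ) : (limitGram L).det ≠ 0 := by
  rw [limitGram, Matrix.det_diagonal, Finset.prod_ne_zero_iff]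
  rintro ⟨l, k⟩ _
  fin_cases k <;> simp [Real.pi_ne_zero]

lemma inv_limitGram_apply (p : Fin L) : (limitGram L)⁻¹ (p, 0) (p, 0) = 3 / Real.pi ^ 2 := by
  have : (limitGram L)⁻¹ = Matrix.diagonal fun i : Fin L × Fin 3 => (![Real.pi ^ 2 / 3, 1, 1] i.2)⁻¹ := by
    refine Matrix.inv_eq_right_inv ?_
    rw [limitGram, Matrix.diagonal_mul_diagonal, Matrix.diagonal_eq_one]
    ext ⟨l, k⟩
    fin_cases k <;> simp [Real.pi_ne_zero]
  rw [this, Matrix.diagonal_apply_eq]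
  simp

/-- The Cramér-Rao bound in terms of the normalised Gram matrix. -/
lemma crlb_eq {Ω : Type*} [MeasurableSpace Ω] {P : Measure Ω} [IsProbabilityMeasure P] {σ : ℝ}
    {w : ℕ → Ω → ℂ} (h : IsWhiteGaussianNoise P σ w) (hσ : 0 < σ) {N : ℕ} (hN : N ≠ 0)
    {A : Fin L → ℂ} (hA : ∀ l, A l ≠ 0) (f : Fin L → ℝ)
    (hdet : (sampleGram (normalisedDeriv N A f) N).det ≠ 0) :
    (fisherInfo P σ w N A f).PosDef ∧ ∀ p, snr σ (A p) * (N : ℝ) ^ 3 * crlb P σ w N A f p =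
      1 / 2 * (sampleGram (normalisedDeriv N A f) N)⁻¹ (p, 0) (p, 0) := by
  set G := sampleGram (normalisedDeriv N A f) N with hG
  set R := normalisation N A with hR
  set F := fisherInfo P σ w N A f with hF
  have hF1 : F = (2 / σ ^ 2) • sampleGram (signalDeriv A f) N := fisherInfo_eq h hσ N A f
  have hGF : G = (σ ^ 2 / 2) • (R.transpose * F * R) := by
    rw [hG, sampleGram_comb _ R _ (normalisedDeriv_eq hN hA f), hF1, Matrix.mul_smul,
      Matrix.smul_mul, smul_smul]
    rw [show σ ^ 2 / 2 * (2 / σ ^ 2) = 1 by field_simp, one_smul]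
  -- Nonsingularity of the congruent matrix forces that of both factors; no direct inversion of `R`
  -- is needed.
  have hdets : R.det ≠ 0 ∧ F.det ≠ 0 := by
    rw [hGF, Matrix.det_smul, Matrix.det_mul, Matrix.det_mul, Matrix.det_transpose] at hdet
    constructor <;> intro h0 <;> simp [h0] at hdet
  have hpos : F.PosSemidef := by
    rw [hF1]; exact (posSemidef_sampleGram _ _).smul (by positivity)
  refine ⟨hpos.posDef_iff_det_ne_zero.2 hdets.2, fun p => ?_⟩
  have hGu : IsUnit G.det := isUnit_iff_ne_zero.2 hdet
  have hRu : IsUnit R.transpose.det := by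
    rw [Matrix.det_transpose]; exact isUnit_iff_ne_zero.2 hdets.1
  have hinv : F⁻¹ = (σ ^ 2 / 2) • (R * G⁻¹ * R.transpose) := by
    refine Matrix.inv_eq_right_inv ?_
    have h1 : R.transpose * (F * ((σ ^ 2 / 2) • (R * G⁻¹ * R.transpose))) = R.transpose * 1 := by
      have : R.transpose * (F * ((σ ^ 2 / 2) • (R * G⁻¹ * R.transpose))) =
          ((σ ^ 2 / 2) • (R.transpose * F * R)) * G⁻¹ * R.transpose := by
        simp only [Matrix.mul_smul, Matrix.smul_mul, Matrix.mul_assoc]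
      rw [this, ← hGF, Matrix.mul_nonsing_inv _ hGu, Matrix.one_mul, Matrix.mul_one]
    have := congrArg (fun M => (R.transpose)⁻¹ * M) h1
    simpa only [← Matrix.mul_assoc, Matrix.nonsing_inv_mul _ hRu, Matrix.one_mul, Matrix.mul_one] using this
  have hN0 : (0 : ℝ) < N := by exact_mod_cast Nat.pos_of_ne_zero hN
  -- The row of the frequency has a single entry, so the frequency entry of `R * G⁻¹ * Rᵀ` is a
  -- rescaled diagonal entry of `G⁻¹`.
  have hrow : ∀ i, R (p, 0) i = if i = (p, 0) then 1 / (√N * N * ‖A p‖) else 0 := by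
    rintro ⟨l, k⟩
    rcases eq_or_ne l p with rfl | hl
    · fin_cases k <;> simp [hR, normalisation]
    · have : p ≠ l := hl.symm
      simp [hR, normalisation, this, hl]
  have happ : (R * G⁻¹ * R.transpose) (p, 0) (p, 0) =
      (1 / (√N * N * ‖A p‖)) ^ 2 * G⁻¹ (p, 0) (p, 0) := by
    simp only [Matrix.mul_apply, Matrix.transpose_apply, hrow, ite_mul, zero_mul, mul_ite, mul_zero,
      Finset.sum_ite_eq', Finset.mem_univ, if_true]
    ring
  rw [crlb, ← hF, hinv, Matrix.smul_apply, happ, snr, smul_eq_mul]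
  have hAp : ‖A p‖ ≠ 0 := norm_ne_zero_iff.2 (hA p)
  rw [div_pow, mul_pow, mul_pow, Real.sq_sqrt hN0.le]
  field_simp

end Fisher

/-! ### Rates -/

section Rates

variable {L N : ℕ} {A : Fin L → ℂ} {f : Fin L → ℝ} {Δ : ℝ}

/-- Separated frequencies are few. -/
lemma card_le_of_separated (hΔ : 0 < Δ) (hf : ∀ l, f l ∈ Set.Icc (-(1 / 2) : ℝ) (1 / 2))
    (hsep : ∀ l p, l ≠ p → Δ ≤ |f l - f p|) : (L : ℝ) ≤ 1 / Δ + 2 := by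
  set lo := ⌊-(1 / 2) / Δ⌋ with hlo
  set hi := ⌊(1 / 2) / Δ⌋ with hhi
  have hmaps : ∀ l ∈ (Finset.univ : Finset (Fin L)), ⌊f l / Δ⌋ ∈ Finset.Icc lo hi := fun l _ => by
    obtain ⟨h1, h2⟩ := hf l
    rw [Finset.mem_Icc]
    exact ⟨Int.floor_le_floor (by gcongr), Int.floor_le_floor (by gcongr)⟩
  -- Pigeonhole: each half-open cell of length `Δ` contains at most one frequency.
  have hinj : Set.InjOn (fun l => ⌊f l / Δ⌋) (Finset.univ : Finset (Fin L)) := fun l _ p _ h => by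
    by_contra hlp
    have h1 := Int.abs_sub_lt_one_of_floor_eq_floor h
    rw [← sub_div, abs_div, abs_of_pos hΔ, div_lt_one hΔ] at h1
    exact absurd (hsep l p hlp) (not_le.2 h1)
  have hcard := Finset.card_le_card_of_injOn _ hmaps hinj
  rw [Finset.card_univ, Fintype.card_fin, Int.card_Icc] at hcard
  have h1 := Int.floor_le ((1 / 2) / Δ)
  have h2 := Int.lt_floor_add_one (-(1 / 2) / Δ)
  rw [← hhi] at h1
  rw [← hlo] at h2
  have h3 : (L : ℝ) ≤ ((hi + 1 - lo).toNat : ℝ) := by exact_mod_cast hcard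
  have h4 : lo ≤ hi := Int.floor_le_floor (by gcongr; norm_num)
  have h5 : ((hi + 1 - lo).toNat : ℝ) = hi + 1 - lo := by
    have : (((hi + 1 - lo).toNat : ℤ) : ℝ) = ((hi + 1 - lo : ℤ) : ℝ) := by
      rw [Int.toNat_of_nonneg (by omega)]
    push_cast at this
    exact_mod_cast this
  have h6 : (1 / 2) / Δ - -(1 / 2) / Δ = 1 / Δ := by ring
  linarith

lemma sqrt_Gam (N : ℕ) (A : Fin L → ℂ) (f : Fin L → ℝ) (l p : Fin L) :
    √(Gam N A f l p) = ‖A l‖ / |((round ((N : ℝ) * (f l - f p)) : ℤ) : ℝ)| := by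
  rw [Gam, Real.sqrt_div (by positivity), Real.sqrt_sq (norm_nonneg _), Real.sqrt_sq_eq_abs]

lemma abs_round_bounds (hN : 2 / Δ ≤ N) (hΔ : 0 < Δ) {g : ℝ} (h1 : Δ ≤ |g|) (h2 : |g| ≤ 1 - Δ) :
    N * Δ / 2 ≤ |((round ((N : ℝ) * g) : ℤ) : ℝ)| ∧ |((round ((N : ℝ) * g) : ℤ) : ℝ)| ≤ 2 * N := by
  have hN' : (0 : ℝ) < N := lt_of_lt_of_le (by positivity) hN
  have hN1 : (1 : ℝ) ≤ N := by
    have : 0 < N := by exact_mod_cast hN'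
    exact_mod_cast this
  rw [div_le_iff₀ hΔ] at hN
  have h3 := abs_sub_round ((N : ℝ) * g)
  have h4 := abs_sub_abs_le_abs_sub ((N : ℝ) * g) (round ((N : ℝ) * g) : ℤ)
  have h5 := abs_sub_abs_le_abs_sub ((round ((N : ℝ) * g) : ℤ) : ℝ) ((N : ℝ) * g)
  rw [abs_sub_comm _ ((N : ℝ) * g)] at h5
  have h6 : |(N : ℝ) * g| = N * |g| := by rw [abs_mul, Nat.abs_cast]
  have h7 := mul_le_mul_of_nonneg_left h1 hN'.le
  have h8 := mul_le_mul_of_nonneg_left h2 hN'.le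
  rw [h6] at h4 h5
  constructor <;> nlinarith

lemma sqrt_log_le_rateBound (N : ℕ) (A : Fin L → ℂ) (f : Fin L → ℝ) :
    √(Real.log N / N) ≤ rateBound N A f := le_max_right _ _

/-- The largest amplitude, paired with any other component, already occurs in the maximum; this
needs a second component. The rounded distance is at most `2 * N`. -/
lemma iSup_div_le_rateBound (hL : 2 ≤ L) (hΔ : 0 < Δ) (hN : 2 / Δ ≤ N)
    (hsep : ∀ l p, l ≠ p → Δ ≤ |f l - f p| ∧ |f l - f p| ≤ 1 - Δ) :
    (⨆ k, ‖A k‖) / N ≤ 2 * rateBound N A f := by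
  have hN' : (0 : ℝ) < N := lt_of_lt_of_le (by positivity) hN
  have : Nonempty (Fin L) := ⟨⟨0, by omega⟩⟩
  have : Nontrivial (Fin L) := Fin.nontrivial_iff_two_le.2 hL
  obtain ⟨l, hl⟩ := exists_eq_ciSup_of_finite (f := fun k => ‖A k‖)
  obtain ⟨p, hp⟩ := exists_ne l
  rw [← hl]
  have h1 : √(Gam N A f l p) ≤ rateBound N A f := by
    refine le_trans ?_ (le_max_left _ _)
    exact le_ciSup (f := fun q : {q : Fin L × Fin L // q.1 ≠ q.2} => √(Gam N A f q.1.1 q.1.2))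
      (Set.finite_range _).bddAbove ⟨(l, p), hp.symm⟩
  obtain ⟨h2, h3⟩ := abs_round_bounds hN hΔ (hsep l p hp.symm).1 (hsep l p hp.symm).2
  rw [sqrt_Gam] at h1
  have h4 : ‖A l‖ / (2 * N) ≤ ‖A l‖ / |((round ((N : ℝ) * (f l - f p)) : ℤ) : ℝ)| :=
    div_le_div_of_nonneg_left (norm_nonneg _) (lt_of_lt_of_le (by positivity) h2) h3
  have h5 : ‖A l‖ / N = 2 * (‖A l‖ / (2 * N)) := by field_simp
  rw [h5]; linarith

/-- Converse comparison, using that the rounded distances are at least `N * Δ / 2`; it shows that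
the rate tends to `0`. -/
lemma rateBound_le (hΔ : 0 < Δ) (hN : 2 / Δ ≤ N)
    (hsep : ∀ l p, l ≠ p → Δ ≤ |f l - f p| ∧ |f l - f p| ≤ 1 - Δ) :
    rateBound N A f ≤ 2 / Δ * ((⨆ k, ‖A k‖) / N) + √(Real.log N / N) := by
  have hN' : (0 : ℝ) < N := lt_of_lt_of_le (by positivity) hN
  have hB : 0 ≤ ⨆ k, ‖A k‖ := Real.iSup_nonneg fun k => norm_nonneg _
  refine max_le ?_ (le_add_of_nonneg_left (by positivity))
  refine le_trans (Real.iSup_le (fun q => ?_) (by positivity)) (le_add_of_nonneg_right (Real.sqrt_nonneg _))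
  obtain ⟨h2, h3⟩ := abs_round_bounds hN hΔ (hsep _ _ q.2).1 (hsep _ _ q.2).2
  rw [sqrt_Gam]
  calc _ ≤ (⨆ k, ‖A k‖) / (N * Δ / 2) := by
        gcongr
        exact norm_le_iSup A _
    _ = _ := by field_simp

end Rates

/-! ### Limits of the noise scale and of the remainder -/

section Limits

lemma tendsto_log_div : Tendsto (fun N : ℕ => Real.log N / N) atTop (𝓝 0) := by
  have := (Real.tendsto_pow_log_div_mul_add_atTop 1 0 1 one_ne_zero).comp tendsto_natCast_atTop_atTop
  simpa [Function.comp_def] using this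

lemma tendsto_sq_log_div : Tendsto (fun N : ℕ => Real.log N ^ 2 / N) atTop (𝓝 0) := by
  have := (Real.tendsto_pow_log_div_mul_add_atTop 1 0 2 one_ne_zero).comp tendsto_natCast_atTop_atTop
  simpa [Function.comp_def] using this

lemma tendsto_sqrt_log_div : Tendsto (fun N : ℕ => √(Real.log N / N)) atTop (𝓝 0) := by
  simpa using tendsto_log_div.sqrt

lemma noiseScale_eq (σ : ℝ) (N : ℕ) : noiseScale σ N = σ * √5 * √(Real.log N / N) := by
  rw [noiseScale, Real.sqrt_mul (by norm_num), mul_assoc]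

lemma tendsto_noiseScale (σ : ℝ) : Tendsto (fun N => noiseScale σ N) atTop (𝓝 0) := by
  simp only [noiseScale_eq]
  simpa using tendsto_sqrt_log_div.const_mul (σ * √5)

/-- The quadratic term is of order `log N / √N`, and the other one smaller still: a remainder
quadratic in the noise is negligible at the scale `1 / √N`. -/
lemma tendsto_sqrt_mul_noiseScale (σ c K : ℝ) : Tendsto (fun N : ℕ => √N *
    (26 * noiseScale σ N * (c * (26 * noiseScale σ N) + K / N))) atTop (𝓝 0) := by
  have h1 : Tendsto (fun N : ℕ => c * 26 ^ 2 * σ ^ 2 * 5 * √(Real.log N ^ 2 / N)) atTop (𝓝 0) := by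
    simpa using (tendsto_sq_log_div.sqrt).const_mul (c * 26 ^ 2 * σ ^ 2 * 5)
  have h3 : Tendsto (fun N : ℕ => 1 / √(N : ℝ)) atTop (𝓝 0) := by
    simpa using (tendsto_one_div_atTop_nhds_zero_nat (𝕜 := ℝ)).sqrt
  have h2 : Tendsto (fun N : ℕ => 26 * K * (noiseScale σ N * (1 / √(N : ℝ)))) atTop (𝓝 0) := by
    simpa using ((tendsto_noiseScale σ).mul h3).const_mul (26 * K)
  have h4 := h1.add h2
  rw [add_zero] at h4
  refine h4.congr' ?_
  filter_upwards [eventually_gt_atTop 0] with N hN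
  have hN0 : (0 : ℝ) < N := by exact_mod_cast hN
  have hs : 0 < √(N : ℝ) := Real.sqrt_pos.2 hN0
  have hss : √(N : ℝ) * √(N : ℝ) = N := Real.mul_self_sqrt hN0.le
  have hlog : 0 ≤ Real.log N := Real.log_natCast_nonneg N
  have e1 : √(Real.log N ^ 2 / N) = √N * (Real.log N / N) := by
    rw [Real.sqrt_div (by positivity), Real.sqrt_sq hlog]
    field_simp
    linear_combination (-Real.log N) * hss
  have e2 : noiseScale σ N ^ 2 = σ ^ 2 * (5 * (Real.log N / N)) := by
    rw [noiseScale, mul_pow, Real.sq_sqrt (by positivity)]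
  have e3 : 1 / √(N : ℝ) = √N / N := by
    field_simp
    linear_combination -hss
  rw [e1, e3]
  linear_combination (-(√N * 26 ^ 2 * c)) * e2

end Limits

/-! ### Measurability -/

section Measurability

variable {Ω : Type*} [MeasurableSpace Ω] {L : ℕ}

lemma measurable_tone (N : ℕ) : Measurable (tone N) := by unfold tone; fun_prop

lemma measurable_leakFree (N : ℕ) {x : ℕ → Ω → ℂ} (hx : ∀ n, Measurable (x n)) {m : Ω → Fin L → ℤ}
    (hm : ∀ l, Measurable fun ω => m ω l) {s : Ω → Estimates L} (hs : Measurable s) (p : Fin L)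
    {y : Ω → ℝ} (hy : Measurable y) :
    Measurable fun ω => leakFree N (fun n => x n ω) (m ω) (s ω) p (y ω) := by
  have hm' : ∀ l, Measurable fun ω => (m ω l : ℝ) := fun l =>
    (measurable_of_countable (fun k : ℤ => (k : ℝ))).comp (hm l)
  have hs' : ∀ l, Measurable fun ω => s ω l := fun l => (measurable_pi_apply l).comp hs
  unfold leakFree fourierCoeffAt leakage
  refine Measurable.sub ?_ ?_
  · fun_prop
  · refine Finset.measurable_fun_sum _ fun l _ => (hs' l).snd.mul ((measurable_tone N).comp ?_)
    exact ((hm' l).add (hs' l).fst).sub hy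

lemma measurable_update (N : ℕ) {x : ℕ → Ω → ℂ} (hx : ∀ n, Measurable (x n)) {m : Ω → Fin L → ℤ}
    (hm : ∀ l, Measurable fun ω => m ω l) {s : Ω → Estimates L} (hs : Measurable s) (p : Fin L) :
    Measurable fun ω => update N (fun n => x n ω) (m ω) (s ω) p := by
  have hm' : ∀ l, Measurable fun ω => (m ω l : ℝ) := fun l =>
    (measurable_of_countable (fun k : ℤ => (k : ℝ))).comp (hm l)
  have hs' : ∀ l, Measurable fun ω => s ω l := fun l => (measurable_pi_apply l).comp hs
  have hr : Measurable fun ω => newResidual N (fun n => x n ω) (m ω) (s ω) p := by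
    unfold newResidual residualOf interpolant
    have h1 := measurable_leakFree N hx hm hs p (((hm' p).add (hs' p).fst).add_const (1 / 2))
    have h2 := measurable_leakFree N hx hm hs p (((hm' p).add (hs' p).fst).sub_const (1 / 2))
    have h3 := (hs' p).fst
    simp only [Pi.add_apply] at h1 h2
    fun_prop
  exact hr.prodMk (measurable_leakFree N hx hm hs p ((hm' p).add hr))

lemma measurable_sweep (sch : Schedule) (N : ℕ) {x : ℕ → Ω → ℂ} (hx : ∀ n, Measurable (x n))
    {m : Ω → Fin L → ℤ} (hm : ∀ l, Measurable fun ω => m ω l) {s : Ω → Estimates L}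
    (hs : Measurable s) :
    Measurable fun ω => sweep sch N (fun n => x n ω) (m ω) (s ω) := by
  cases sch with
  | simultaneous => exact measurable_pi_iff.2 fun p => measurable_update N hx hm hs p
  | sequential =>
    simp only [sweep_sequential]
    induction List.finRange L using List.reverseRecOn with
    | nil => exact hs
    | append_singleton l p ih =>
      simp only [sweepList_append_singleton]
      refine measurable_pi_iff.2 fun q => ?_
      rcases eq_or_ne q p with rfl | hq
      · simpa only [Function.update_self] using measurable_update N hx hm ih q
      · simp only [Function.update_of_ne hq]
        exact (measurable_pi_apply q).comp ih

lemma measurable_estimates (sch : Schedule) (N : ℕ) {x : ℕ → Ω → ℂ} (hx : ∀ n, Measurable (x n))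
    {m : Ω → Fin L → ℤ} (hm : ∀ l, Measurable fun ω => m ω l) (q : ℕ) :
    Measurable fun ω => estimates sch N (fun n => x n ω) (m ω) q := by
  induction q with
  | zero => exact measurable_const
  | succ q ih =>
    simp only [estimates, Function.iterate_succ_apply']
    exact measurable_sweep sch N hx hm ih

end Measurability

/-! ### Asymptotic normality -/

section Normality

variable {Ω : Type*} [MeasurableSpace Ω] {P : Measure Ω} [IsProbabilityMeasure P] {σ : ℝ}
  {w : ℕ → Ω → ℂ}

/-- The linear part of the normalised estimation error of a component of amplitude `a` at the
frequency `g`. -/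
def linearError (σ : ℝ) (N : ℕ) (a : ℂ) (g : ℝ) (w : ℕ → ℂ) : ℝ :=
  -(‖a‖ * √N / σ * (Real.pi / 8) * ((fourierCoeffAt N w (N * g + 1 / 2) +
    fourierCoeffAt N w (N * g - 1 / 2)) / a).im)

lemma sum_cis_div {N : ℕ} (hN : 2 ≤ N) : ∑ n ∈ Finset.range N, cis (n / N) = 0 := by
  have hN0 : N ≠ 0 := by omega
  have hNc : (N : ℂ) ≠ 0 := by exact_mod_cast hN0
  have hN2 : (2 : ℝ) ≤ N := by exact_mod_cast hN
  have h := tone_mul hN0 1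
  have h1 : cis 1 = 1 := by simpa using cis_int 1
  rw [h1, sub_self, tone_eq_sum, ← mul_assoc, mul_one_div_cancel hNc, one_mul, mul_eq_zero] at h
  rcases h with h | h
  · simpa using h
  · exfalso
    have h4 : 4 * (1 / N : ℝ) ≤ ‖1 - cis (1 / N)‖ := by
      have : |(1 / N : ℝ)| = 1 / N := abs_of_pos (by positivity)
      apply le_norm_one_sub_cis (by positivity) this.ge
      rw [this, le_sub_iff_add_le, ← add_div, div_le_one (by linarith)]; linarith
    rw [h, norm_zero] at h4
    have : (0 : ℝ) < 1 / N := by positivity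
    linarith

/-- The coefficients are exactly one bin apart, so their noises are uncorrelated for every
frequency: in the squared weights `2 + 2 cos (2 π n / N)` the cosines sum to `0`. The law is exact
for each `N ≥ 2`, not only in the limit. -/
lemma map_linearError (h : IsWhiteGaussianNoise P σ w) (hσ : 0 < σ) {N : ℕ} (hN : 2 ≤ N) {a : ℂ}
    (ha : a ≠ 0) (g : ℝ) :
    P.map (fun ω => linearError σ N a g fun n => w n ω) =
      gaussianReal 0 (Real.toNNReal (Real.pi ^ 2 / 64)) := by
  have hN0 : (0 : ℝ) < N := by exact_mod_cast (by omega : 0 < N)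
  set b : ℂ := (‖a‖ * √N / σ * (Real.pi / 8) : ℝ) * (Complex.I / a) with hb
  set c : ℕ → ℂ := fun n => b * ((1 / N : ℝ) * (cis (-((N * g + 1 / 2) * n / N)) +
    cis (-((N * g - 1 / 2) * n / N)))) with hc
  have hlin : ∀ ω, linearError σ N a g (fun n => w n ω) = (∑ n ∈ Finset.range N, c n * w n ω).re := by
    intro ω
    have h1 : ∑ n ∈ Finset.range N, c n * w n ω = b * (fourierCoeffAt N (fun n => w n ω) (N * g + 1 / 2) +
        fourierCoeffAt N (fun n => w n ω) (N * g - 1 / 2)) := by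
      rw [fourierCoeffAt_eq, fourierCoeffAt_eq, ← Finset.sum_add_distrib, Finset.mul_sum]
      refine Finset.sum_congr rfl fun n _ => ?_
      rw [hc]; ring
    have h2 : ∀ z : ℂ, b * z = (‖a‖ * √N / σ * (Real.pi / 8) : ℝ) * (Complex.I * (z / a)) :=
      fun z => by rw [hb]; ring
    rw [h1, h2, linearError, Complex.re_ofReal_mul, Complex.I_mul_re]
    ring
  have hbn : ‖b‖ ^ 2 = N * Real.pi ^ 2 / (64 * σ ^ 2) := by
    have : ‖a‖ ≠ 0 := norm_ne_zero_iff.2 ha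
    rw [hb, norm_mul, norm_div, Complex.norm_I, Complex.norm_real, Real.norm_eq_abs, mul_pow, sq_abs]
    have hs : √(N : ℝ) ^ 2 = N := Real.sq_sqrt hN0.le
    field_simp
    rw [hs]; ring
  have hcn : ∀ n, ‖c n‖ ^ 2 = ‖b‖ ^ 2 / N ^ 2 * (2 + 2 * (cis (n / N)).re) := fun n => by
    have h1 : cis (-((N * g + 1 / 2) * n / N)) + cis (-((N * g - 1 / 2) * n / N)) =
        cis (-((N * g + 1 / 2) * n / N)) * (1 + cis (n / N)) := by
      rw [mul_add, mul_one, ← cis_add]; congr 2; field_simp; ring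
    have h2 : ‖1 + cis (n / N)‖ ^ 2 = 2 + 2 * (cis (n / N)).re := by
      rw [norm_add_sq_real, norm_cis, norm_one, Complex.inner]; simp; ring
    simp only [hc]
    rw [h1, norm_mul b, norm_mul _ (_ * _), norm_mul (cis _), norm_cis, one_mul, Complex.norm_real, Real.norm_eq_abs,
      abs_of_pos (by positivity), mul_pow, mul_pow, h2]
    ring
  have hsum : σ ^ 2 / 2 * ∑ n ∈ Finset.range N, ‖c n‖ ^ 2 = Real.pi ^ 2 / 64 := by
    simp only [hcn]
    rw [← Finset.mul_sum, Finset.sum_add_distrib, ← Finset.mul_sum, ← Complex.re_sum, sum_cis_div hN,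
      hbn]
    simp only [Finset.sum_const, Finset.card_range, nsmul_eq_mul, Complex.zero_re]
    field_simp
    norm_num
  simp only [hlin]
  rw [h.map_re_sum, hsum]

end Normality

/-! ### Conclusions for a fixed typical noise sequence -/

section Asymptotics

variable {L : ℕ} {Δ a σ : ℝ}

/-- Ratio of the error bound, for typical noise, to `rateBound`. -/
def rateConst (Δ a σ : ℝ) : ℝ := 26 * σ * √5 + 2 * (1 / Δ + 2) * (3 + 1 / a) * leakConst Δ

lemma rateConst_pos (hΔ : 0 < Δ) (ha : 0 < a) (hσ : 0 < σ) : 0 < rateConst Δ a σ := by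
  have := leakConst_pos hΔ
  unfold rateConst; positivity

lemma rateBound_nonneg (N : ℕ) (A : Fin L → ℂ) (f : Fin L → ℝ) : 0 ≤ rateBound N A f :=
  (Real.sqrt_nonneg _).trans (sqrt_log_le_rateBound N A f)

/-- The number of components enters `errBound` linearly; the separation replaces it by `1 / Δ + 2`,
so that the constant does not depend on `L`. -/
lemma errBound_le_rateBound (hL : 2 ≤ L) (hΔ : 0 < Δ) (ha : 0 < a) (hσ : 0 < σ) {N : ℕ}
    (hN : 2 / Δ ≤ N) (A : Fin L → ℂ) {f : Fin L → ℝ}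
    (hf : ∀ l, f l ∈ Set.Icc (-(1 / 2) : ℝ) (1 / 2))
    (hsep : ∀ l p, l ≠ p → Δ ≤ |f l - f p| ∧ |f l - f p| ≤ 1 - Δ) :
    errBound L N Δ a (⨆ k, ‖A k‖) (26 * noiseScale σ N) ≤ rateConst Δ a σ * rateBound N A f := by
  have hlc := leakConst_pos hΔ
  have h1 := card_le_of_separated hΔ hf fun l p h => (hsep l p h).1
  have h2 := iSup_div_le_rateBound (A := A) hL hΔ hN hsep
  have h3 := sqrt_log_le_rateBound N A f
  have h0 := rateBound_nonneg N A f
  have hB : 0 ≤ (⨆ k, ‖A k‖) / N :=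
    div_nonneg (Real.iSup_nonneg fun k => norm_nonneg _) (Nat.cast_nonneg N)
  calc errBound L N Δ a (⨆ k, ‖A k‖) (26 * noiseScale σ N)
      = 26 * σ * √5 * √(Real.log N / N) +
          L * (((⨆ k, ‖A k‖) / N) * ((3 + 1 / a) * leakConst Δ)) := by
        rw [errBound, noiseScale_eq]; ring
    _ ≤ 26 * σ * √5 * rateBound N A f +
          (1 / Δ + 2) * ((2 * rateBound N A f) * ((3 + 1 / a) * leakConst Δ)) := by
        gcongr
    _ = _ := by rw [rateConst]; ring

lemma tendsto_iSup_div {A : ℕ → Fin L → ℂ}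
    (hA : ∀ l, Tendsto (fun N : ℕ => ‖A N l‖ / N) atTop (𝓝 0)) :
    Tendsto (fun N : ℕ => (⨆ k, ‖A N k‖) / N) atTop (𝓝 0) := by
  have h := tendsto_finsetSum Finset.univ fun l _ => hA l
  rw [Finset.sum_const_zero] at h
  refine squeeze_zero (fun N => ?_) (fun N => ?_) h
  · exact div_nonneg (Real.iSup_nonneg fun k => norm_nonneg _) (Nat.cast_nonneg N)
  · rw [← Finset.sum_div]
    gcongr
    exact Real.iSup_le (fun l => Finset.single_le_sum (f := fun l => ‖A N l‖)
      (fun l _ => norm_nonneg _) (Finset.mem_univ l)) (Finset.sum_nonneg fun l _ => norm_nonneg _)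

lemma eventually_le_natCast (c : ℝ) : ∀ᶠ N : ℕ in atTop, c ≤ N :=
  tendsto_natCast_atTop_atTop.eventually_ge_atTop c

lemma tendsto_rateBound (hΔ : 0 < Δ) {A : ℕ → Fin L → ℂ}
    (hA : ∀ l, Tendsto (fun N : ℕ => ‖A N l‖ / N) atTop (𝓝 0)) {f : ℕ → Fin L → ℝ}
    (hsep : ∀ N l p, l ≠ p → Δ ≤ |f N l - f N p| ∧ |f N l - f N p| ≤ 1 - Δ) :
    Tendsto (fun N => rateBound N (A N) (f N)) atTop (𝓝 0) := by
  have h := ((tendsto_iSup_div hA).const_mul (2 / Δ)).add tendsto_sqrt_log_div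
  rw [mul_zero, add_zero] at h
  refine squeeze_zero' (.of_forall fun N => rateBound_nonneg N _ _) ?_ h
  filter_upwards [eventually_le_natCast (2 / Δ)] with N hN
  exact rateBound_le hΔ hN (hsep N)

/-- The constant of the convergence rate. -/
def contractionConst (Δ a σ : ℝ) : ℝ := 2 * ((160000 / a + 1100000) * rateConst Δ a σ)

lemma contractionConst_pos (hΔ : 0 < Δ) (ha : 0 < a) (hσ : 0 < σ) :
    0 < contractionConst Δ a σ := by
  have := rateConst_pos hΔ ha hσ
  unfold contractionConst; positivity

variable {A : ℕ → Fin L → ℂ} {f : ℕ → Fin L → ℝ} {w : ℕ → ℂ} {m : ℕ → Fin L → ℤ}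

lemma eventually_regime (hL : 2 ≤ L) (hΔ : 0 < Δ) (ha : 0 < a) (hσ : 0 < σ)
    (hAa : ∀ N l, a ≤ ‖A N l‖) (hA : ∀ l, Tendsto (fun N : ℕ => ‖A N l‖ / N) atTop (𝓝 0))
    (hf : ∀ N l, f N l ∈ Set.Icc (-(1 / 2) : ℝ) (1 / 2))
    (hsep : ∀ N l p, l ≠ p → Δ ≤ |f N l - f N p| ∧ |f N l - f N p| ≤ 1 - Δ)
    (hm : ∀ᶠ N : ℕ in atTop, ∀ l, |(N : ℝ) * f N l - m N l| ≤ 1 / 2)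
    (hw : ∀ᶠ N in atTop, NoiseBound N w (26 * noiseScale σ N)) :
    ∀ᶠ N in atTop, Regime Δ a (⨆ k, ‖A N k‖) (26 * noiseScale σ N) N (A N) (f N) w (m N) := by
  have hlim := (tendsto_rateBound hΔ hA hsep).const_mul (2000 * rateConst Δ a σ)
  rw [mul_zero] at hlim
  filter_upwards [hm, hw, eventually_le_natCast (7 / Δ), eventually_ge_atTop 22,
    hlim.eventually_le_const ha] with N h1 h2 h3 h4 h5
  have h6 : 2 / Δ ≤ N := le_trans (by gcongr; norm_num) h3
  have h7 := errBound_le_rateBound hL hΔ ha hσ h6 (A N) (hf N) (hsep N)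
  exact ⟨⟨hΔ, h3, h4, hf N, hsep N, h1⟩, ha, hAa N, norm_le_iSup (A N), h2, by linarith⟩

/-- The limit of the iterates of the algorithm. -/
def limitEstimates (sch : Schedule) (N : ℕ) (x : ℕ → ℂ) (m : Fin L → ℤ) : Estimates L :=
  limUnder atTop (estimates sch N x m)

lemma eventually_contraction (hL : 2 ≤ L) (hΔ : 0 < Δ) (ha : 0 < a) (hσ : 0 < σ)
    (hA : ∀ l, Tendsto (fun N : ℕ => ‖A N l‖ / N) atTop (𝓝 0))
    (hR : ∀ᶠ N in atTop, Regime Δ a (⨆ k, ‖A N k‖) (26 * noiseScale σ N) N (A N) (f N) w (m N))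
    (hsep : ∀ N l p, l ≠ p → Δ ≤ |f N l - f N p| ∧ |f N l - f N p| ≤ 1 - Δ) (sch : Schedule) :
    ∀ᶠ N : ℕ in atTop,
      let T := sweep sch N (observed (A N) (f N) w) (m N)
      let K := region (A N)
      let r := √L * (contractionConst Δ a σ * rateBound N (A N) (f N))
      let s := limitEstimates sch N (observed (A N) (f N) w) (m N)
      r < 1 ∧ Set.MapsTo T K K ∧ (∀ u ∈ K, ∀ v ∈ K, estDist (T u) (T v) ≤ r * estDist u v) ∧
        (∀ u ∈ K, T u = u ↔ u = s) ∧ s ∈ K ∧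
        Tendsto (estimates sch N (observed (A N) (f N) w) (m N)) atTop (𝓝 s) := by
  have hlim := (tendsto_rateBound hΔ hA hsep).const_mul (√L * contractionConst Δ a σ)
  rw [mul_zero] at hlim
  filter_upwards [hR, hlim.eventually_lt_const one_pos] with N h hr1
  rw [mul_assoc] at hr1
  have h6 : 2 / Δ ≤ N := le_trans (div_le_div_of_nonneg_right (by norm_num) hΔ.le) h.large
  have h7 := errBound_le_rateBound hL hΔ ha hσ h6 (A N) h.mem h.sep
  have hr : √L * (2 * ((160000 / a + 1100000) *
      errBound L N Δ a (⨆ k, ‖A N k‖) (26 * noiseScale σ N))) ≤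
      √L * (contractionConst Δ a σ * rateBound N (A N) (f N)) := by
    rw [contractionConst, mul_assoc 2, mul_assoc (160000 / a + 1100000)]
    gcongr
  obtain ⟨hmaps, hlip⟩ := h.sweep_contraction sch hr hr1
  have hr0 : 0 ≤ √L * (contractionConst Δ a σ * rateBound N (A N) (f N)) :=
    mul_nonneg (Real.sqrt_nonneg _)
      (mul_nonneg (contractionConst_pos hΔ ha hσ).le (rateBound_nonneg N _ _))
  have h0 : (0 : Estimates L) ∈ region (A N) := fun l => by
    have := Real.iSup_nonneg fun k => norm_nonneg (A N k)
    simp only [Pi.zero_apply, Prod.fst_zero, Prod.snd_zero, abs_zero, norm_zero]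
    constructor
    · norm_num
    · positivity
  obtain ⟨s, hsK, hst, hs⟩ := exists_fixedPoint (isClosed_region (A N)) h0 hmaps hr0 hr1 hlip
  have hs' : limitEstimates sch N (observed (A N) (f N) w) (m N) = s := Tendsto.limUnder_eq hst
  refine ⟨hr1, hmaps, hlip, ?_, ?_, ?_⟩
  · rwa [hs']
  · rwa [hs']
  · rw [hs']; exact hst

lemma sqrt_snr_mul (hσ : 0 < σ) (N : ℕ) (z : ℂ) :
    √(snr σ z * (N : ℝ) ^ 3) = ‖z‖ / σ * (N * √N) := by
  have h : snr σ z * (N : ℝ) ^ 3 = (‖z‖ / σ * N) ^ 2 * N := by rw [snr]; ring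
  rw [h, Real.sqrt_mul (sq_nonneg _), Real.sqrt_sq (by positivity), mul_assoc]

/-- Consistency, and asymptotic linearity of the normalised error. -/
lemma tendsto_error (hσ : 0 < σ) (ha : 0 < a) {s : ℕ → Estimates L} {sch : Schedule}
    (hR : ∀ᶠ N in atTop, Regime Δ a (⨆ k, ‖A N k‖) (26 * noiseScale σ N) N (A N) (f N) w (m N))
    (hs : ∀ᶠ N in atTop, s N ∈ region (A N) ∧ sweep sch N (observed (A N) (f N) w) (m N) (s N) = s N)
    (l : Fin L) :
    Tendsto (fun N : ℕ => (s N l).1 - ((N : ℝ) * f N l - m N l)) atTop (𝓝 0) ∧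
    Tendsto (fun N : ℕ => √(snr σ (A N l) * (N : ℝ) ^ 3) * ((m N l + (s N l).1) / N - f N l) -
      linearError σ N (A N l) (f N l) w) atTop (𝓝 0) := by
  have hlarge := eventually_le_natCast (4600 * (L * leakConst Δ))
  constructor
  · have hlim : Tendsto (fun N : ℕ => 4600 * (26 * noiseScale σ N) / a) atTop (𝓝 0) := by
      simpa using (((tendsto_noiseScale σ).const_mul 26).const_mul 4600).div_const a
    refine squeeze_zero_norm' ?_ hlim
    filter_upwards [hR, hs, hlarge] with N h1 h2 h3
    have h4 := h1.fixedPoint_error_le h2.1 (update_eq_of_sweep_eq h2.2) h3 l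
    rw [Real.norm_eq_abs, le_div_iff₀ ha, show (s N l).1 - ((N : ℝ) * f N l - m N l) =
      m N l + (s N l).1 - N * f N l by ring]
    have h5 := mul_le_mul_of_nonneg_right (h1.le_norm l) (abs_nonneg (m N l + (s N l).1 - N * f N l))
    linarith [norm_nonneg ((s N l).2 - A N l)]
  · have hlim := (tendsto_sqrt_mul_noiseScale σ (10000000 / a)
      (2000 + 10000 * (L * leakConst Δ))).const_mul (1 / σ)
    rw [mul_zero] at hlim
    refine squeeze_zero_norm' ?_ hlim
    filter_upwards [hR, hs, hlarge] with N h1 h2 h3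
    have h4 := h1.fixedPoint_linearization h2.1 (update_eq_of_sweep_eq h2.2) h3 l
    have hN : (N : ℝ) ≠ 0 := h1.natCast_pos.ne'
    have h5 : √(snr σ (A N l) * (N : ℝ) ^ 3) * ((m N l + (s N l).1) / N - f N l) -
        linearError σ N (A N l) (f N l) w = 1 / σ * √N * (‖A N l‖ * (m N l + (s N l).1 - N * f N l +
        Real.pi / 8 * ((fourierCoeffAt N w (N * f N l + 1 / 2) +
          fourierCoeffAt N w (N * f N l - 1 / 2)) / A N l).im)) := by
      rw [sqrt_snr_mul hσ, linearError]
      field_simp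
      ring
    rw [h5, Real.norm_eq_abs, abs_mul, abs_mul ‖A N l‖, abs_norm,
      abs_of_nonneg (by positivity : 0 ≤ 1 / σ * √(N : ℝ)), mul_assoc]
    refine (mul_le_mul_of_nonneg_left (mul_le_mul_of_nonneg_left h4 (Real.sqrt_nonneg _))
      (by positivity)).trans_eq ?_
    ring

end Asymptotics

/-! ### Measurability, convergence in distribution and the limit of the Cramér-Rao bound -/

section Probability

variable {Ω : Type*} [MeasurableSpace Ω] {P : Measure Ω} [IsProbabilityMeasure P] {σ : ℝ}
  {w : ℕ → Ω → ℂ} {L : ℕ}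

/-- Defining the fixed point as `limUnder` of the iterates makes it measurable for every `N`,
including outcomes where the iteration does not converge. -/
lemma measurable_limitEstimates (sch : Schedule) (N : ℕ) {x : ℕ → Ω → ℂ} (hx : ∀ n, Measurable (x n))
    {m : Ω → Fin L → ℤ} (hm : ∀ l, Measurable fun ω => m ω l) :
    Measurable fun ω => limitEstimates sch N (fun n => x n ω) (m ω) :=
  (StronglyMeasurable.limUnder fun q =>
    (measurable_estimates sch N hx hm q).stronglyMeasurable).measurable

lemma measurable_linearError (hw : ∀ n, Measurable (w n)) (N : ℕ) (a : ℂ) (g : ℝ) :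
    Measurable fun ω => linearError σ N a g fun n => w n ω := by
  unfold linearError fourierCoeffAt; fun_prop

/-- Slutsky: the linear errors have a constant law, and almost sure convergence of the difference
implies convergence in measure. -/
lemma tendstoInDistribution_of_sub_linearError (h : IsWhiteGaussianNoise P σ w) (hσ : 0 < σ)
    {a : ℕ → ℂ} (ha : ∀ N, a N ≠ 0) (g : ℕ → ℝ) {X : ℕ → Ω → ℝ} (hX : ∀ N, Measurable (X N))
    (hlim : ∀ᵐ ω ∂P, Tendsto (fun N => X N ω - linearError σ N (a N) (g N) fun n => w n ω)
      atTop (𝓝 0)) :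
    TendstoInDistribution X atTop (id : ℝ → ℝ) (fun _ => P)
      (gaussianReal 0 (Real.toNNReal (Real.pi ^ 2 / 64))) := by
  -- The exact law requires at least two samples; `max N 2` provides them and changes only finitely
  -- many terms.
  set Y : ℕ → Ω → ℝ := fun N ω => linearError σ (max N 2) (a N) (g N) fun n => w n ω with hY
  have hYm : ∀ N, Measurable (Y N) := fun N => measurable_linearError h.measurable _ _ _
  have hYl : ∀ N, P.map (Y N) = gaussianReal 0 (Real.toNNReal (Real.pi ^ 2 / 64)) := fun N =>
    map_linearError h hσ (le_max_right N 2) (ha N) (g N)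
  have hYd : TendstoInDistribution Y atTop (id : ℝ → ℝ) (fun _ => P)
      (gaussianReal 0 (Real.toNNReal (Real.pi ^ 2 / 64))) :=
    tendstoInDistribution_of_identDistrib 0
      (fun N => ⟨(hYm 0).aemeasurable, (hYm N).aemeasurable, by rw [hYl, hYl]⟩)
      ⟨(hYm 0).aemeasurable, aemeasurable_id, by rw [hYl, Measure.map_id]⟩
  refine tendstoInDistribution_of_tendstoInMeasure_sub X id hYd ?_ fun N => (hX N).aemeasurable
  refine tendstoInMeasure_of_tendsto_ae
    (fun N => ((hX N).sub (hYm N)).aestronglyMeasurable) ?_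
  filter_upwards [hlim] with ω hω
  refine hω.congr' ?_
  filter_upwards [eventually_ge_atTop 2] with N hN
  simp only [hY, Pi.sub_apply, max_eq_left hN]

lemma measurable_observed (hw : ∀ n, Measurable (w n)) (A : Fin L → ℂ) (f : Fin L → ℝ) (n : ℕ) :
    Measurable fun ω => observed A f (fun n => w n ω) n :=
  (hw n).const_add _

lemma tendsto_crlb (h : IsWhiteGaussianNoise P σ w) (hσ : 0 < σ) {A : ℕ → Fin L → ℂ}
    (hA : ∀ N l, A N l ≠ 0) {f : ℕ → Fin L → ℝ} {Δ : ℝ} (hΔ : 0 < Δ)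
    (hsep : ∀ N l p, l ≠ p → Δ ≤ |f N l - f N p| ∧ |f N l - f N p| ≤ 1 - Δ) :
    (∀ᶠ N : ℕ in atTop, (fisherInfo P σ w N (A N) (f N)).PosDef) ∧
    ∀ p, Tendsto (fun N : ℕ => snr σ (A N p) * (N : ℝ) ^ 3 * crlb P σ w N (A N) (f N) p) atTop
      (𝓝 (6 / (4 * Real.pi ^ 2))) := by
  obtain ⟨hinv, hdet⟩ := tendsto_matrix_inv (tendsto_sampleGram hA hΔ hsep) (det_limitGram_ne_zero L)
  constructor
  · filter_upwards [hdet, eventually_ne_atTop 0] with N h1 h2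
    exact (crlb_eq h hσ h2 (hA N) (f N) h1).1
  · intro p
    have h1 := ((tendsto_pi_nhds.1 (tendsto_pi_nhds.1 hinv (p, 0))) (p, 0)).const_mul (1 / 2)
    rw [inv_limitGram_apply, show 1 / 2 * (3 / Real.pi ^ 2) = 6 / (4 * Real.pi ^ 2) by
      field_simp; norm_num] at h1
    refine h1.congr' ?_
    filter_upwards [hdet, eventually_ne_atTop 0] with N h2 h3
    exact ((crlb_eq h hσ h3 (hA N) (f N) h2).2 p).symm

end Probability

lemma abs_variance_ratio_sub_lt :
    |(Real.pi ^ 2 / 64) / (6 / (4 * Real.pi ^ 2)) - 1.0147| < 0.00005 := by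
  have h1 := Real.pi_gt_d6
  have h2 := Real.pi_lt_d6
  -- The ratio is `π ^ 4 / 96`, and six decimals of `π` decide the rounding.
  have h3 : (Real.pi ^ 2 / 64) / (6 / (4 * Real.pi ^ 2)) = (Real.pi ^ 2) ^ 2 / 96 := by
    field_simp; norm_num
  have h4 : (3.141592 : ℝ) ^ 2 < Real.pi ^ 2 := by gcongr
  have h5 : Real.pi ^ 2 < (3.141593 : ℝ) ^ 2 := by gcongr
  have h6 : ((3.141592 : ℝ) ^ 2) ^ 2 < (Real.pi ^ 2) ^ 2 := by gcongr
  have h7 : (Real.pi ^ 2) ^ 2 < ((3.141593 : ℝ) ^ 2) ^ 2 := by gcongr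
  rw [h3, abs_lt]
  norm_num at h6 h7 ⊢
  constructor <;> linarith

end MultiTone

end

theorem theorem2 (Δ a σ : ℝ) (hΔ : 0 < Δ) (ha : 0 < a) (hσ : 0 < σ) :
    -- the implied constant of the rate
    ∃ C : ℝ, 0 < C ∧
    ∀ (L : ℕ), 2 ≤ L →
    ∀ (Ω : Type*) [MeasurableSpace Ω] (P : Measure Ω) [IsProbabilityMeasure P] (w : ℕ → Ω → ℂ),
    MultiTone.IsWhiteGaussianNoise P σ w →
    -- amplitudes and frequencies of the signal of length `N`
    ∀ (A : ℕ → Fin L → ℂ) (f : ℕ → Fin L → ℝ),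
    (∀ N l, a ≤ ‖A N l‖) →
    (∀ l, Tendsto (fun N : ℕ => ‖A N l‖ / N) atTop (𝓝 0)) →
    (∀ N l, f N l ∈ Set.Icc (-(1 / 2) : ℝ) (1 / 2)) →
    (∀ N l p, l ≠ p → Δ ≤ |f N l - f N p| ∧ |f N l - f N p| ≤ 1 - Δ) →
    -- the maximum bins, found by the coarse search
    ∀ (m : ℕ → Ω → Fin L → ℤ),
    (∀ N l, Measurable (fun ω => m N ω l)) →
    (∀ᵐ ω ∂P, ∀ᶠ N : ℕ in atTop, ∀ l, |(N : ℝ) * f N l - m N ω l| ≤ 1 / 2) →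
    ∀ sch : MultiTone.Schedule,
    -- the limit of the algorithm
    (∃ s : ℕ → Ω → MultiTone.Estimates L,
      (∀ N, Measurable (s N)) ∧
      (∀ᵐ ω ∂P, ∀ᶠ N : ℕ in atTop,
        let T := MultiTone.sweep sch N (MultiTone.observed (A N) (f N) (fun n => w n ω)) (m N ω)
        let K := MultiTone.region (A N)
        let r := Real.sqrt L * (C * MultiTone.rateBound N (A N) (f N))
        r < 1 ∧
        Set.MapsTo T K K ∧
        (∀ u ∈ K, ∀ v ∈ K, MultiTone.estDist (T u) (T v) ≤ r * MultiTone.estDist u v) ∧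
        (∀ u ∈ K, T u = u ↔ u = s N ω) ∧
        s N ω ∈ K ∧
        Tendsto (MultiTone.estimates sch N
          (MultiTone.observed (A N) (f N) (fun n => w n ω)) (m N ω)) atTop (𝓝 (s N ω))) ∧
      -- the fixed point is asymptotically at the true residuals
      (∀ᵐ ω ∂P, ∀ l, Tendsto
        (fun N : ℕ => (s N ω l).1 - ((N : ℝ) * f N l - m N ω l)) atTop (𝓝 0)) ∧
      -- the frequency estimates are asymptotically normal and unbiased, of variance
      -- `π ^ 2 / (64 * ρ * N ^ 3)`
      (∀ p, TendstoInDistribution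
        (fun (N : ℕ) ω => Real.sqrt (MultiTone.snr σ (A N p) * (N : ℝ) ^ 3) *
          ((m N ω p + (s N ω p).1) / N - f N p))
        atTop (id : ℝ → ℝ) (fun _ => P) (gaussianReal 0 (Real.toNNReal (Real.pi ^ 2 / 64))))) ∧
    -- the asymptotic Cramér-Rao lower bound is `6 / (4 * π ^ 2 * ρ * N ^ 3)`
    (∀ᶠ N : ℕ in atTop, (MultiTone.fisherInfo P σ w N (A N) (f N)).PosDef) ∧
    (∀ p, Tendsto (fun N : ℕ => MultiTone.snr σ (A N p) * (N : ℝ) ^ 3 *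
        MultiTone.crlb P σ w N (A N) (f N) p) atTop (𝓝 (6 / (4 * Real.pi ^ 2)))) ∧
    -- the variance is 1.0147 times as large, up to rounding
    |(Real.pi ^ 2 / 64) / (6 / (4 * Real.pi ^ 2)) - 1.0147| < 0.00005 := by
  refine ⟨MultiTone.contractionConst Δ a σ, MultiTone.contractionConst_pos hΔ ha hσ, ?_⟩
  intro L hL Ω _ P _ w hw A f hAa hA hf hsep m hmm hm sch
  have hA0 : ∀ N l, A N l ≠ 0 := fun N l => norm_pos_iff.1 (ha.trans_le (hAa N l))
  have hcr := MultiTone.tendsto_crlb hw hσ hA0 hΔ hsep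
  have hreg : ∀ᵐ ω ∂P, ∀ᶠ N in atTop, MultiTone.Regime Δ a (⨆ k, ‖A N k‖)
      (26 * MultiTone.noiseScale σ N) N (A N) (f N) (fun n => w n ω) (m N ω) := by
    filter_upwards [hm, hw.ae_noiseBound hσ] with ω h1 h2
    exact MultiTone.eventually_regime hL hΔ ha hσ hAa hA hf hsep h1 h2
  have hcon := hreg.mono fun ω h =>
    MultiTone.eventually_contraction hL hΔ ha hσ hA h hsep sch
  -- Applying the uniqueness equivalence to the limit itself gives the fixed point equation on which
  -- the error analysis rests.
  have herr := (hreg.and hcon).mono fun ω h (l : Fin L) =>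
    MultiTone.tendsto_error hσ ha (sch := sch) h.1
      (h.2.mono fun N h' => ⟨h'.2.2.2.2.1, (h'.2.2.2.1 _ h'.2.2.2.2.1).2 rfl⟩) l
  have hmeas : ∀ N, Measurable fun ω => MultiTone.limitEstimates sch N
      (MultiTone.observed (A N) (f N) fun n => w n ω) (m N ω) := fun N =>
    MultiTone.measurable_limitEstimates sch N
      (MultiTone.measurable_observed hw.measurable (A N) (f N)) (hmm N)
  refine ⟨⟨fun N ω => MultiTone.limitEstimates sch N
    (MultiTone.observed (A N) (f N) fun n => w n ω) (m N ω), hmeas, hcon, herr.mono fun ω h l => (h l).1, fun p => ?_⟩, hcr.1, hcr.2,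
    MultiTone.abs_variance_ratio_sub_lt⟩
  refine MultiTone.tendstoInDistribution_of_sub_linearError hw hσ (fun N => hA0 N p)
    (fun N => f N p) (fun N => ?_) (herr.mono fun ω h => (h p).2)
  have h1 : Measurable fun ω => (m N ω p : ℝ) :=
    (measurable_of_countable fun k : ℤ => (k : ℝ)).comp (hmm N p)
  have h2 := ((measurable_pi_apply p).comp (hmeas N)).fst
  exact (((h1.add h2).div_const _).sub_const _).const_mul _
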